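/- **Theorem.** Let $N\ge 3$, let $\mathbb F$ be a field of characteristic $2$, and let $R=\mathbb F[V_0,\dots,V_{N+1}]$. Indices of spokes are taken modulo $N$. *The algebra.* Let $\mathcal A$ be the $R$-algebra with orthogonal idempotents $I_1,\dots,I_N$ (with sum $1$) and generators $U_1,\dots,U_N$ and $s_{i,i+1}$ $(1\le i\le N)$, where $U_i=I_iU_iI_i$ and $s_{i,i+1}=I_is_{i,i+1}I_{i+1}$, subject to the relations $U_is_{i,i+1}=0$ and $s_{i-1,i}U_i=0$. (Hence also $U_iU_j=0$ for $i\neq j$.) So $\mathcal A$ is a free $R$-module with basis the *chords*: $I_i$, $U_i^p$ $(p\ge 1)$, and the products $s_{i,i+\ell}=s_{i,i+1}s_{i+1,i+2}\cdots s_{i+\ell-1,i+\ell}$ of $\ell\ge1$ short chords. Let $s_{ii}$ denote such a product with $\ell=N$, and put $U_{N+1}=\sum_{i=1}^N s_{ii}$. The basic elements are the $U_i$ and the $s_{i,i+1}$. *Weights.* A weight is $\mathbf w=\sum_{i=1}^{N+1}k_i\mathbf e_i$ with $k_i\in\mathbb Z_{\ge0}$, and $|\mathbf w|=\sum_i k_i$.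 *Allowable graphs.* Consider connected planar graphs in the disk with $j\ge 1$ internal vertices, each of valence $2N$, whose sectors are labelled, in clockwise order around each vertex, by $U_1,s_{12},U_2,s_{23},\dots,U_N,s_{N1}$. An edge of a vertex has colour $i$ if it borders the sector $U_i$ at that vertex. Each edge either joins two half-edges at internal vertices (an internal edge; the two vertices may coincide) or ends on the boundary of the disk (a leaf), and there is at least one leaf. The graph is *allowable* if each internal edge joins two half-edges of the same colour in such a way that on each side of it the labels of the two sectors which meet along it are multipliable ($U_i$ meets $U_i$, and $s_{i-1,i}$ meets $s_{i,i+1}$), and if each face not touching the boundary of the disk is either a *petal cycle*, consisting of a single sector $U_i$ (it contributes $\mathbf e_i$ to the weight), or an *internal cycle*, consisting of exactly $N$ sectors $s_{12},s_{23},\dots,s_{N1}$ (it contributes $\mathbf e_{N+1}$). A face touching the boundary is labelled by the product of the labels of its sectors. A *root* is a chosen leaf; the *input sequence* of a rooted graph is the sequence $(a_1,\dots,a_n)$ of the labels of the faces touching the boundary, read clockwise from the root. Rooted graphs are considered up to isomorphism. *Operations.* Define $R$-multilinear maps $\mu_n^{\mathbf w}:\mathcal A^{\otimes n}\to\mathcal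 A$ on sequences of chords as the sum of the following contributions: * $\mu_2^{0}(a,b)=ab$, and $\mu_0^{\mathbf e_i}=U_i$ for $1\le i\le N+1$; * each rooted allowable graph with $j$ vertices, weight $\mathbf w$ and input sequence $(a_1,\dots,a_n)$ contributes * (centered) $V_0^jI$ to $\mu_n^{\mathbf w}(a_1,\dots,a_n)$, where $I$ is the initial idempotent of $a_1$; * (left extended) $V_0^j\alpha$ to $\mu_n^{\mathbf w}(\alpha a_1,a_2,\dots,a_n)$, for each chord $\alpha\notin\{I_1,\dots,I_N\}$ with $\alpha a_1\ne0$; * (right extended) $V_0^j\alpha$ to $\mu_n^{\mathbf w}(a_1,\dots,a_{n-1},a_n\alpha)$, for each chord $\alpha\notin\{I_1,\dots,I_N\}$ with $a_n\alpha\ne 0$. There are no other contributions. In particular, if several graphs have the same weight and the same input sequence, then their contributions are added in $R$. *Claim.* $\mathcal A$ with these operations satisfies the weighted $A_\infty$-relations, i.e. it is a weighted $A_\infty$-algebra: for every weight $\mathbf w$, every $n\ge 0$ and all $a_1,\dots,a_n\in\mathcal A$, $$\sum_{\mathbf w'+\mathbf w''=\mathbf w}\ \sum_{p+r+q=n}\mu_{p+1+q}^{\mathbf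 w'}\bigl(a_1,\dots,a_p,\ \mu_r^{\mathbf w''}(a_{p+1},\dots,a_{p+r}),\ a_{p+r+1},\dots,a_n\bigr)=0,$$ where $p,r,q\ge 0$. -/

import Mathlib

noncomputable section

namespace StarAlgebra

/-! ### Weighted A-infinity algebras in characteristic two -/

/-- A family of operations `μ_n^w : A^{⊗ n} → A`, where `n ≥ 0` and the weight `w` is a finite
formal sum (with multiplicities) of the basic weights `e_i`, `i : ι`. -/
abbrev Operations (R A ι : Type*) [CommRing R] [AddCommGroup A] [Module R A] :=
  (ι →₀ ℕ) → (n : ℕ) → MultilinearMap R (fun _ : Fin n => A) A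

/-- The sequence `a_0, …, a_{p-1}, x, a_{p+r}, a_{p+r+1}, …`: the block of `r` entries beginning at
position `p` is replaced by the single entry `x` (for `r = 0`, `x` is inserted). -/
def splice {A : Type*} (a : ℕ → A) (p r : ℕ) (x : A) : ℕ → A := fun k =>
  if k < p then a k else if k = p then x else a (k - 1 + r)

/-- The weighted A-infinity relations over a ring of characteristic two (so without signs). For each
weight `w` and each sequence of `n` inputs, the sum over all ways to write `n = p + r + q` and
`w = w' + w''` of
`μ_{p+1+q}^{w'} (a_0, …, a_{p-1}, μ_r^{w''} (a_p, …, a_{p+r-1}), a_{p+r}, …, a_{n-1})`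
vanishes. Equivalently: the sum over all ways of adding one edge to the weighted corolla. Only the
first `n` entries of the sequence `a` are used. -/
def IsWeightedAInfinity {R A ι : Type*} [CommRing R] [AddCommGroup A] [Module R A] [DecidableEq ι]
    (μ : Operations R A ι) : Prop :=
  ∀ (w : ι →₀ ℕ) (n : ℕ) (a : ℕ → A),
    ∑ x ∈ Finset.HasAntidiagonal.antidiagonal w, ∑ s ∈ Finset.HasAntidiagonal.antidiagonal n, ∑ t ∈ Finset.HasAntidiagonal.antidiagonal s.2,
      μ x.1 (s.1 + 1 + t.2) (fun k => splice a s.1 t.1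
        (μ x.2 t.1 (fun m => a (s.1 + (m : ℕ)))) (k : ℕ)) = 0

/-! ### Algebra elements and multiplication -/

/-- The basis chords. Spokes (idempotents) are indexed by `ZMod N`.
* `idem i` is the idempotent `I_i` of the `i`-th spoke;
* `petal i k` is `U_i ^ (k + 1)`;
* `central i k` is the central chord `s_{i, i + k + 1} = s_{i,i+1} s_{i+1,i+2} ⋯` that is a product
  of `k + 1` short chords. -/
inductive Chord (N : ℕ) : Type
  | idem (i : ZMod N)
  | petal (i : ZMod N) (k : ℕ)
  | central (i : ZMod N) (k : ℕ)

namespace Chord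

variable {N : ℕ}

/-- The initial idempotent. -/
def source : Chord N → ZMod N
  | idem i => i
  | petal i _ => i
  | central i _ => i

/-- The final idempotent. -/
def target : Chord N → ZMod N
  | idem i => i
  | petal i _ => i
  | central i k => i + (k + 1 : ℕ)

/-- The product of two basis chords is their concatenation (`some c`) or zero (`none`). -/
def mul : Chord N → Chord N → Option (Chord N)
  | idem i, c => if i = c.source then some c else none
  | c, idem i => if c.target = i then some c else none
  | petal i k, petal j l => if i = j then some (petal i (k + l + 1)) else none
  | central i k, central j l =>
      if i + (k + 1 : ℕ) = j then some (central i (k + l + 1)) else none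
  | petal _ _, central _ _ => none
  | central _ _, petal _ _ => none

/-- The chord is not an idempotent. -/
def Nontrivial : Chord N → Prop
  | idem _ => False
  | petal _ _ => True
  | central _ _ => True

end Chord

/-- The ground ring `F[V_0, …, V_{N+1}]`. -/
abbrev Ground (N : ℕ) (F : Type*) [Field F] := MvPolynomial (Fin (N + 2)) F

/-- The algebra, as the free module over `F[V_0, …, V_{N+1}]` on the basis chords. -/
abbrev Alg (N : ℕ) (F : Type*) [Field F] := Chord N →₀ Ground N F

/-- The basic weights: `some i` is the petal weight `e_i` (`1 ≤ i ≤ N`, counted modulo `N`), and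
`none` is the central weight `e_{N+1}`. -/
abbrev Weight (N : ℕ) := Option (ZMod N) →₀ ℕ

/-! ### Planar graphs -/

/-- The half-edges of a graph with `j` vertices, each of valence `2 N`. The half-edges at the vertex
`v` are, in clockwise order, `…, (v, i, false), (v, i, true), (v, i + 1, false), …`; both `(v, i, _)`
have colour `i`. -/
abbrev HalfEdge (N j : ℕ) := Fin j × ZMod N × Bool

/-- The next half-edge clockwise at the same vertex. The sector of the vertex between `h` and
`next h` carries the label `U_i` if `h = (v, i, false)` and `s_{i,i+1}` if `h = (v, i, true)`. So the
labels around each vertex are `U_1, s_{12}, U_2, s_{23}, …, U_N, s_{N1}` in clockwise order. -/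
def next {N j : ℕ} : HalfEdge N j → HalfEdge N j
  | (v, i, false) => (v, i, true)
  | (v, i, true) => (v, i + 1, false)

/-- A coherently coloured graph all of whose `j` internal vertices look like the basic vertex. Two
distinct half-edges `h` and `mate h` form an internal edge; if `mate h = h` then `h` is a leaf, i.e.
an edge which ends on the boundary of the disk. The two halves of an internal edge have the same
colour, and they are such that the labels of the sectors which meet along the edge are multipliable
(`U_i` meets `U_i`, and `s_{i-1,i}` meets `s_{i,i+1}`). -/
structure StarGraph (N j : ℕ) where
  mate : HalfEdge N j → HalfEdge N j
  mate_mate : ∀ h, mate (mate h) = h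
  coherent : ∀ h, mate h ≠ h → (mate h).2.1 = h.2.1 ∧ (mate h).2.2 = !h.2.2

namespace StarGraph

variable {N j : ℕ} (G : StarGraph N j)

/-- The half-edge ends on the boundary of the disk. -/
def IsLeaf (h : HalfEdge N j) : Prop := G.mate h = h

/-- Walking along a face of the ribbon graph: cross the sector that follows `h` clockwise, arrive at
the half-edge `next h`, and then cross that edge into the adjacent sector of the same region; if
`next h` is a leaf, then the next region along the boundary of the disk begins there. The orbits
without leaves are the bounded faces which do not touch the boundary, that is, the cycles. -/
def face (h : HalfEdge N j) : HalfEdge N j := G.mate (next h)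

/-- The sector that follows `h` lies in a region of the disk not touching the boundary. -/
def IsInner (h : HalfEdge N j) : Prop := ∀ m : ℕ, ¬ G.IsLeaf (G.face^[m] h)

/-- The label of `p + 1` consecutive sectors of one region, the first of which follows `h`: the
product of their labels. -/
def regionLabel (h : HalfEdge N j) (p : ℕ) : Chord N :=
  if h.2.2 then Chord.central h.2.1 p else Chord.petal h.2.1 p

/-- `G.Region h a h'`: the region of the disk that follows the leaf `h` clockwise along the boundary
is bounded by the leaves `h` and `h'` and has the label `a`. -/
def Region (h : HalfEdge N j) (a : Chord N) (h' : HalfEdge N j) : Prop :=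
  ∃ p : ℕ, G.IsLeaf h ∧ (∀ m, 0 < m → m < p + 1 → ¬ G.IsLeaf (G.face^[m] h)) ∧
    G.face^[p + 1] h = h' ∧ G.IsLeaf h' ∧ a = regionLabel h p

/-- `G.Reads h l h'`: walking clockwise along the boundary from the leaf `h` to the leaf `h'`, the
labels of the regions are those of the list `l`. -/
def Reads : HalfEdge N j → List (Chord N) → HalfEdge N j → Prop
  | h, [], h' => h = h'
  | h, a :: l, h' => ∃ h₁, G.Region h a h₁ ∧ Reads h₁ l h'

/-- The graph is allowable, of weight `w`. It is connected; each cycle (bounded face) is either a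
petal cycle, made of a single sector `U_i`, or an internal cycle, made of `N` sectors
`s_{12}, s_{23}, …, s_{N1}`; there are `w_i` petal cycles with the label `U_i`, and `w_{N+1}` internal
cycles (each has exactly one sector `s_{N1}`, which is used to count them). Finally the graph is
planar, in a disk, without further cycles: filling in the cycles of the ribbon graph gives a
connected surface with `V - E + F = 1`, where `F = |w|` is the number of cycles. -/
structure IsAllowable (w : Weight N) : Prop where
  connected : ∀ u v : Fin j,
    Relation.ReflTransGen (fun x y => ∃ h : HalfEdge N j, h.1 = x ∧ (G.mate h).1 = y) u v
  petal_cycle : ∀ v i, G.IsInner (v, i, false) → G.face (v, i, false) = (v, i, false)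
  internal_cycle : ∀ v i, G.IsInner (v, i, true) → G.face^[N] (v, i, true) = (v, i, true)
  petal_weight : ∀ i : ZMod N, w (some i) = Nat.card {v : Fin j // G.IsInner (v, i, false)}
  internal_weight : w none = Nat.card {v : Fin j // G.IsInner (v, 0, true)}
  planar : 2 * j + 2 * w.degree = Nat.card {h : HalfEdge N j // ¬ G.IsLeaf h} + 2

end StarGraph

/-! ### Operations from graphs -/

/-- `Extends l α l'`: a rooted graph whose regions are labelled by `l`, read clockwise from the root,
gives after extension at the root the sequence of inputs `l'`, and the output `α` times a power of
`V_0`. In the centered case `α` is an idempotent. In the left (right) extended case `α` is the product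
of the labels of the `2`-valent vertices that are added on the edge adjacent to the root, and it
multiplies the first (last) label on the left (right). -/
inductive Extends {N : ℕ} : List (Chord N) → Chord N → List (Chord N) → Prop
  | centered (a : Chord N) (l : List (Chord N)) : Extends (a :: l) (Chord.idem a.source) (a :: l)
  | left (α a b : Chord N) (l : List (Chord N)) (hα : α.Nontrivial) (h : α.mul a = some b) :
      Extends (a :: l) α (b :: l)
  | right (α a b : Chord N) (l : List (Chord N)) (hα : α.Nontrivial) (h : a.mul α = some b) :
      Extends (l ++ [a]) α (l ++ [b])

/-- The rooted allowable graphs, possibly extended, of weight `w` and with input sequence `l`. The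
root is one of the leaves; `labels` are the labels of all regions that touch the boundary, read
clockwise from the root. -/
structure OperationGraph (N : ℕ) (w : Weight N) (l : List (Chord N)) where
  size : ℕ
  graph : StarGraph N size
  allowable : graph.IsAllowable w
  root : HalfEdge N size
  root_leaf : graph.IsLeaf root
  labels : List (Chord N)
  reads : graph.Reads root labels root
  length_labels : labels.length = Nat.card {h : HalfEdge N size // graph.IsLeaf h}
  extension : Chord N
  extends_labels : Extends labels extension l

namespace OperationGraph

variable {N : ℕ} {w : Weight N} {l : List (Chord N)}

/-- An isomorphism of rooted (extended) labelled graphs. -/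
def Iso (G H : OperationGraph N w l) : Prop :=
  ∃ σ : Fin G.size ≃ Fin H.size,
    (∀ h : HalfEdge N G.size,
      H.graph.mate (σ h.1, h.2) = (σ (G.graph.mate h).1, (G.graph.mate h).2)) ∧
    H.root = (σ G.root.1, G.root.2) ∧ H.extension = G.extension

instance isoSetoid (N : ℕ) (w : Weight N) (l : List (Chord N)) :
    Setoid (OperationGraph N w l) where
  r := Iso
  iseqv := by
    refine ⟨fun G => ⟨Equiv.refl _, by simp, by simp, rfl⟩, ?_, ?_⟩
    · rintro G H ⟨σ, h1, h2, h3⟩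
      refine ⟨σ.symm, fun h => ?_, by rw [h2]; simp, h3.symm⟩
      have := h1 (σ.symm h.1, h.2)
      simp only [Equiv.apply_symm_apply, Prod.mk.eta] at this
      rw [this]
      simp
    · rintro G H K ⟨σ, h1, h2, h3⟩ ⟨τ, k1, k2, k3⟩
      refine ⟨σ.trans τ, fun h => ?_, by rw [k2, h2]; simp, k3.trans h3⟩
      have := k1 (σ h.1, h.2)
      rw [h1] at this
      simpa using this

/-- The output of the operation: `V_0 ^ j` times the offset, `j` being the number of vertices. -/
def output (F : Type*) [Field F] (G : OperationGraph N w l) : Alg N F :=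
  Finsupp.single G.extension (MvPolynomial.X 0 ^ G.size)

theorem output_eq_of_iso (F : Type*) [Field F] (G H : OperationGraph N w l) (h : G ≈ H) :
    G.output F = H.output F := by
  obtain ⟨σ, -, -, h3⟩ := h
  have : G.size = H.size := by simpa using Fintype.card_congr σ
  simp [output, this, h3]

/-- The output of an isomorphism class of graphs. -/
def classOutput (F : Type*) [Field F] : Quotient (isoSetoid N w l) → Alg N F :=
  Quotient.lift (fun G => G.output F) (output_eq_of_iso F)

end OperationGraph

/-- The higher operations on basis chords: the sum of the outputs of all allowable graphs (up to
isomorphism) with weight `w` and input sequence `l`. -/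
def graphOperation (N : ℕ) (F : Type*) [Field F] (w : Weight N) (l : List (Chord N)) : Alg N F :=
  ∑ᶠ G : Quotient (OperationGraph.isoSetoid N w l), OperationGraph.classOutput F G

/-- The ordinary product of two basis chords. -/
def product (N : ℕ) (F : Type*) [Field F] (a b : Chord N) : Alg N F :=
  match a.mul b with
  | some c => Finsupp.single c 1
  | none => 0

/-- The element `U_i` (`1 ≤ i ≤ N`) for `some i`, and
`U_{N+1} = s_{11} + ⋯ + s_{NN}` for `none`. -/
def orbit (N : ℕ) (F : Type*) [Field F] : Option (ZMod N) → Alg N F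
  | some i => Finsupp.single (Chord.petal i 0) 1
  | none => ∑ᶠ i : ZMod N, Finsupp.single (Chord.central i (N - 1)) 1

open scoped Classical in
/-- The operation of weight `w` on a sequence of basis chords. It consists of `μ_0^{e_i} = U_i` for
`1 ≤ i ≤ N + 1`, of the unweighted product `μ_2^0`, and of the operations given by graphs. -/
def basisOperation (N : ℕ) (F : Type*) [Field F] (w : Weight N) : List (Chord N) → Alg N F
  | [] => (∑ᶠ (i : Option (ZMod N)) (_ : w = Finsupp.single i 1), orbit N F i) +
      graphOperation N F w []
  | [a, b] => (if w = 0 then product N F a b else 0) + graphOperation N F w [a, b]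
  | l => graphOperation N F w l

/-- The extension of a function of `n` basis elements to an `n`-multilinear map. -/
def multilinearExtension {R B A : Type*} [CommRing R] [AddCommGroup A] [Module R A] :
    (n : ℕ) → (List B → A) → MultilinearMap R (fun _ : Fin n => B →₀ R) A
  | 0, f => MultilinearMap.constOfIsEmpty R _ (f [])
  | n + 1, f => LinearMap.uncurryLeft
      (Finsupp.linearCombination R fun b => multilinearExtension n fun l => f (b :: l))

theorem multilinearExtension_single {R B A : Type*} [CommRing R] [AddCommGroup A] [Module R A]
    (n : ℕ) (f : List B → A) (b : Fin n → B) :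
    multilinearExtension (R := R) n f (fun k => Finsupp.single (b k) 1) = f (List.ofFn b) := by
  induction n generalizing f with
  | zero => simp [multilinearExtension]
  | succ n ih =>
    have := ih (fun l => f (b 0 :: l)) (fun k => b k.succ)
    simpa [multilinearExtension, Fin.tail_def, List.ofFn_succ] using this

/-- The operations of the `α`-bordered algebra of the star diagram with `N` spokes. -/
def operations (N : ℕ) (F : Type*) [Field F] :
    Operations (Ground N F) (Alg N F) (Option (ZMod N)) :=
  fun w n => multilinearExtension n (basisOperation N F w)

end StarAlgebra

end

/-!
The proof is a count of planar graphs: in characteristic two it suffices to cancel the terms of the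
A-infinity relation in pairs, and the pairs come from cutting a graph at an internal edge.

For a sequence `l` of chords, let `br l` be the generating function of the allowable rooted graphs
with boundary labels `l`: a power series with one variable `t o` for each basic weight `o`, in which
a graph with `j` vertices counts `V_0 ^ j`. All that is needed about graphs is collected in the
structure `IsBracket`:

* `br` is invariant under cyclic rotation (move the root to the next leaf);
* `br l = 0` unless neighbouring labels are composable and alternate between powers of petals and
  central chords, and if `l` has only one entry;
* the cutting relation `count_cut`. If the first label is a product `b = a₁ a₂`, then its region
  contains an internal edge between the two factors. On the other side of this edge there is either
  a cycle, and cutting the edge opens it up to a region between `a₁` and `a₂`; or the boundary of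
  the disk, and cutting separates the graph into two pieces, where `a₂` starts one of them, `a₁`
  the other one, and the label of the region on the other side is factored too.

The planarity condition enters through the Euler inequality `V - E + F ≤ 2` of a connected ribbon
graph (`Ribbon.euler_le`, by linear algebra over `ZMod 2`). It shows that in an allowable graph all
leaves lie on one boundary circle, that an edge with the boundary on both sides separates the graph,
and that the pieces of an allowable graph are allowable again.

The cutting relation is the A-infinity relation at one place between two inputs
(`IsBracket.place_eq_zero`): the insertion of the elements `U_o`, the product of the two
neighbours, and the compositions of two graphs with an inner graph that is extended at this place
add up to zero. For centered graphs the contributions of the places cancel in this way, and those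
of the two ends cancel each other. For left and right extended graphs, the product of the first or
last input with its neighbour and the product of an output with the first or last input remain,
and they cancel because both enumerate the factorizations of the same closed path
(`Chord.sum_factors_cyclic`). The cases with at most one input or with an idempotent among the
inputs are treated separately. The result is `IsBracket.compSum_fullOp_eq_zero`, an identity of
power series; its coefficients are the relations for the operations on basis chords, evaluated by
a linear functional (`basis_relation`), and multilinearity extends them to all inputs.
-/

noncomputable section
namespace StarAlgebra
open Equiv

/-! ### Ribbon graphs and their boundary -/

section

/-- The half-edges of a graph with vertex set `V`. -/
abbrev Half (N : ℕ) (V : Type) := V × ZMod N × Bool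

/-- The clockwise rotation around the vertices, as a permutation of the half-edges. -/
def rot {N : ℕ} {V : Type} : Perm (Half N V) where
  toFun
    | (v, i, false) => (v, i, true)
    | (v, i, true) => (v, i + 1, false)
  invFun
    | (v, i, true) => (v, i, false)
    | (v, i, false) => (v, i - 1, true)
  left_inv := by rintro ⟨v, i, _ | _⟩ <;> simp
  right_inv := by rintro ⟨v, i, _ | _⟩ <;> simp

@[simp] theorem rot_false {N : ℕ} {V : Type} (v : V) (i : ZMod N) :
    rot (v, i, false) = (v, i, true) := rfl

@[simp] theorem rot_true {N : ℕ} {V : Type} (v : V) (i : ZMod N) :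
    rot (v, i, true) = (v, i + 1, false) := rfl

theorem rot_fst {N : ℕ} {V : Type} (h : Half N V) : (rot h).1 = h.1 := by
  rcases h with ⟨v, i, _ | _⟩ <;> rfl

theorem rot_color {N : ℕ} {V : Type} (h : Half N V) :
    (rot h).2.1 = h.2.1 + (if h.2.2 then 1 else 0) := by
  rcases h with ⟨v, i, _ | _⟩ <;> simp

theorem rot_side {N : ℕ} {V : Type} (h : Half N V) : (rot h).2.2 = !h.2.2 := by
  rcases h with ⟨v, i, _ | _⟩ <;> rfl

/-- A coherently coloured ribbon graph on an arbitrary vertex set `V`. This is `StarGraph` with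
`Fin j` replaced by `V`, and with the involution `mate` bundled as a permutation. -/
structure Ribbon (N : ℕ) (V : Type) where
  mate : Perm (Half N V)
  mate_mate : ∀ h, mate (mate h) = h
  coherent : ∀ h, mate h ≠ h → (mate h).2.1 = h.2.1 ∧ (mate h).2.2 = !h.2.2

/-- The chord which labels `p + 1` consecutive sectors of one region, beginning after `h`. -/
def lab {N : ℕ} {V : Type} (h : Half N V) (p : ℕ) : Chord N :=
  if h.2.2 then Chord.central h.2.1 p else Chord.petal h.2.1 p

/-- Whether a chord is a product of short chords `s_{i,i+1}`. -/
def Chord.isCentral {N : ℕ} : Chord N → Bool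
  | .central _ _ => true
  | _ => false

section lab
variable {N : ℕ} {V : Type} (h : Half N V) (p : ℕ)

theorem lab_source : (lab h p).source = h.2.1 := by
  unfold lab; split_ifs <;> rfl

theorem lab_isCentral : (lab h p).isCentral = h.2.2 := by
  unfold lab; split_ifs with h1 <;> simp [Chord.isCentral, h1]

theorem lab_nontrivial : (lab h p).Nontrivial := by
  unfold lab; split_ifs <;> trivial

theorem lab_target : (lab h p).target = h.2.1 + (if h.2.2 then ((p + 1 : ℕ) : ZMod N) else 0) := by
  unfold lab; split_ifs <;> simp [Chord.target]

theorem lab_mul {W : Type} (x : Half N W) (q : ℕ) (h1 : x.2.1 = (lab h p).target)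
    (h2 : x.2.2 = h.2.2) :
    (lab h p).mul (lab x q) = some (lab h (p + q + 1)) := by
  rw [lab_target] at h1
  unfold lab; rw [h1, h2]
  split_ifs <;> simp [Chord.mul]

theorem lab_injective {q : ℕ} (e : lab h p = lab h q) : p = q := by
  unfold lab at e; split_ifs at e <;> simpa using e

end lab

namespace Ribbon

variable {N : ℕ} {V : Type} (G : Ribbon N V)

/-- The face permutation: cross the next sector clockwise, and then the edge that follows it. -/
def face : Perm (Half N V) := G.mate * rot

theorem face_apply (h : Half N V) : G.face h = G.mate (rot h) := rfl

/-- The half-edge ends on the boundary of the disk. -/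
def IsLeaf (h : Half N V) : Prop := G.mate h = h

/-- The sector that follows `h` belongs to a face without leaves. -/
def IsInner (h : Half N V) : Prop := ∀ h', G.face.SameCycle h h' → ¬ G.IsLeaf h'

/-- `G.Arc h p h'`: after crossing `p + 1` sectors of one region, beginning with the one that
follows `h`, one arrives at `h'`. The end `h'` itself may be a leaf or half of an internal edge. -/
def Arc (h : Half N V) (p : ℕ) (h' : Half N V) : Prop :=
  (∀ m, 0 < m → m ≤ p → ¬ G.IsLeaf ((G.face ^ m) h)) ∧ (G.face ^ (p + 1)) h = h'

/-- `G.Walk h L h'`: the list `L` consists of the initial half-edges and the labels of consecutive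
arcs which lead from `h` to `h'`. -/
def Walk : Half N V → List (Half N V × Chord N) → Half N V → Prop
  | h, [], h' => h = h'
  | h, (x, a) :: L, h' => x = h ∧ ∃ p h₁, G.Arc h p h₁ ∧ a = lab h p ∧ Walk h₁ L h'

/-- `G.Boundary r L`: the list `L` describes the boundary of the disk, read clockwise from the leaf
`r`. It passes through each leaf once. -/
structure Boundary (r : Half N V) (L : List (Half N V × Chord N)) : Prop where
  walk : G.Walk r L r
  ne_nil : L ≠ []
  nodup : (L.map Prod.fst).Nodup
  isLeaf_iff : ∀ x, G.IsLeaf x ↔ x ∈ L.map Prod.fst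

variable {G}

theorem not_isLeaf_mate {h : Half N V} (hh : ¬ G.IsLeaf h) : ¬ G.IsLeaf (G.mate h) := by
  unfold IsLeaf at *
  rw [G.mate_mate]
  exact fun e => hh e.symm

/-- A leaf is reached by the rotation alone: it is fixed by `mate`. -/
theorem face_of_isLeaf {h : Half N V} (hl : G.IsLeaf (G.face h)) : G.face h = rot h := by
  unfold IsLeaf at hl
  rw [face_apply, G.mate_mate] at hl
  rw [face_apply, ← hl]

/-- Colours along a face do not depend on the edges that are crossed, since these are coherent. -/
theorem face_color (h : Half N V) : (G.face h).2.1 = h.2.1 + (if h.2.2 then 1 else 0) := by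
  rw [← rot_color, face_apply]
  by_cases hm : G.mate (rot h) = rot h
  · rw [hm]
  · exact (G.coherent _ hm).1

theorem face_side {h : Half N V} (hl : ¬ G.IsLeaf (G.face h)) : (G.face h).2.2 = h.2.2 := by
  rw [face_apply]
  have hm : G.mate (rot h) ≠ rot h := fun hm => hl (by unfold IsLeaf; rw [face_apply, hm, hm])
  rw [(G.coherent _ hm).2, rot_side, Bool.not_not]

theorem face_side_leaf {h : Half N V} (hl : G.IsLeaf (G.face h)) :
    (G.face h).2.2 = !h.2.2 := by
  rw [face_of_isLeaf hl, rot_side]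

theorem pow_side {h : Half N V} : ∀ {p : ℕ},
    (∀ m, 0 < m → m ≤ p → ¬ G.IsLeaf ((G.face ^ m) h)) → ((G.face ^ p) h).2.2 = h.2.2
  | 0, _ => by simp
  | p + 1, H => by
    have h1 := pow_side (p := p) fun m h0 hm => H m h0 (by omega)
    have h2 := H (p + 1) (by omega) le_rfl
    rw [pow_succ', Perm.mul_apply] at h2 ⊢
    rw [face_side h2, h1]

theorem pow_color {h : Half N V} : ∀ {p : ℕ},
    (∀ m, 0 < m → m < p → ¬ G.IsLeaf ((G.face ^ m) h)) →
      ((G.face ^ p) h).2.1 = h.2.1 + (if h.2.2 then (p : ZMod N) else 0)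
  | 0, _ => by simp
  | p + 1, H => by
    have h1 := pow_color (p := p) fun m h0 hm => H m h0 (by omega)
    have h2 := pow_side (G := G) (p := p) (h := h) fun m h0 hm => H m h0 (by omega)
    rw [pow_succ', Perm.mul_apply, face_color, h1, h2]
    split_ifs <;> push_cast <;> ring

theorem Arc.color {h h' : Half N V} {p : ℕ} (H : G.Arc h p h') :
    h'.2.1 = (lab h p).target := by
  rw [lab_target, ← H.2]
  exact pow_color fun m h0 hm => H.1 m h0 (by omega)

/-- Crossing a sector changes the side of a half-edge, and crossing an internal edge changes it
back. At a leaf the second change does not take place. -/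
theorem Arc.side_leaf {h h' : Half N V} {p : ℕ} (H : G.Arc h p h') (hl : G.IsLeaf h') :
    h'.2.2 = !h.2.2 := by
  have h2 := pow_side (G := G) (p := p) (h := h) H.1
  rw [← H.2, pow_succ', Perm.mul_apply] at *
  rw [face_side_leaf hl, h2]

theorem Arc.side {h h' : Half N V} {p : ℕ} (H : G.Arc h p h') (hl : ¬ G.IsLeaf h') :
    h'.2.2 = h.2.2 := by
  rw [← H.2]
  refine pow_side fun m h0 hm => ?_
  rcases Nat.lt_or_ge p m with h1 | h1
  · obtain rfl : m = p + 1 := by omega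
    rwa [H.2]
  · exact H.1 m h0 h1

theorem Arc.trans {h x h' : Half N V} {p q : ℕ} (H : G.Arc h p x) (hx : ¬ G.IsLeaf x)
    (K : G.Arc x q h') : G.Arc h (p + q + 1) h' := by
  refine ⟨fun m h0 hm => ?_, ?_⟩
  · rcases lt_trichotomy m (p + 1) with h1 | rfl | h1
    · exact H.1 m h0 (by omega)
    · rwa [H.2]
    · obtain ⟨k, rfl⟩ : ∃ k, m = k + (p + 1) := ⟨m - (p + 1), by omega⟩
      rw [pow_add, Perm.mul_apply, H.2]
      exact K.1 k (by omega) (by omega)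
  · rw [show p + q + 1 + 1 = (q + 1) + (p + 1) by ring, pow_add, Perm.mul_apply, H.2, K.2]

/-- The end of an arc that stops at the first leaf is determined by its beginning. -/
theorem Arc.unique {h x y : Half N V} {p q : ℕ} (H : G.Arc h p x) (K : G.Arc h q y)
    (hx : G.IsLeaf x) (hy : G.IsLeaf y) : p = q ∧ x = y := by
  have : p = q := by
    rcases lt_trichotomy p q with h1 | h1 | h1
    · exact absurd (by rwa [H.2]) (K.1 (p + 1) (by omega) (by omega))
    · exact h1
    · exact absurd (by rwa [K.2]) (H.1 (q + 1) (by omega) (by omega))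
  subst this
  exact ⟨rfl, H.2.symm.trans K.2⟩

theorem Arc.sameCycle {h x : Half N V} {p : ℕ} (H : G.Arc h p x) : G.face.SameCycle h x :=
  ⟨(p + 1 : ℕ), by rw [zpow_natCast]; exact H.2⟩

theorem arc_zero (h : Half N V) : G.Arc h 0 (G.face h) :=
  ⟨fun m h0 hm => by omega, by simp⟩

theorem walk_append {h h' : Half N V} {L₁ L₂ : List (Half N V × Chord N)} :
    G.Walk h (L₁ ++ L₂) h' ↔ ∃ x, G.Walk h L₁ x ∧ G.Walk x L₂ h' := by
  induction L₁ generalizing h with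
  | nil => simp [Walk]
  | cons a L ih =>
    obtain ⟨y, a⟩ := a
    simp only [List.cons_append, Walk, ih]
    constructor
    · rintro ⟨rfl, p, h1, H, ha, x, h2, h3⟩
      exact ⟨x, ⟨rfl, p, h1, H, ha, h2⟩, h3⟩
    · rintro ⟨x, ⟨rfl, p, h1, H, ha, h2⟩, h3⟩
      exact ⟨rfl, p, h1, H, ha, x, h2, h3⟩

theorem walk_singleton {h h' x : Half N V} {a : Chord N} :
    G.Walk h [(x, a)] h' ↔ x = h ∧ ∃ p, G.Arc h p h' ∧ a = lab h p := by
  simp only [Walk]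
  constructor
  · rintro ⟨rfl, p, _, H, ha, rfl⟩
    exact ⟨rfl, p, H, ha⟩
  · rintro ⟨rfl, p, H, ha⟩
    exact ⟨rfl, p, _, H, ha, rfl⟩

theorem Walk.head {h h' x : Half N V} {a : Chord N} {L : List (Half N V × Chord N)}
    (H : G.Walk h ((x, a) :: L) h') : x = h := H.1

theorem Walk.sameCycle {h h' : Half N V} {L : List (Half N V × Chord N)} (H : G.Walk h L h') :
    G.face.SameCycle h h' ∧ ∀ x ∈ L.map Prod.fst, G.face.SameCycle h x := by
  induction L generalizing h with
  | nil => cases H; simp [Perm.SameCycle.refl]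
  | cons a L ih =>
    obtain ⟨y, a⟩ := a
    obtain ⟨rfl, p, h1, K, ha, K'⟩ := H
    have := ih K'
    refine ⟨K.sameCycle.trans this.1, fun x hx => ?_⟩
    simp only [List.map_cons, List.mem_cons] at hx
    rcases hx with rfl | hx
    · exact Perm.SameCycle.refl _ _
    · exact K.sameCycle.trans (this.2 x hx)

/-- Two arcs that meet at an internal edge form a single arc, whose label is the product. -/
theorem Walk.merge {h h' x y : Half N V} {a b : Chord N} {A B : List (Half N V × Chord N)}
    (H : G.Walk h (A ++ (x, a) :: (y, b) :: B) h') (hy : ¬ G.IsLeaf y) :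
    ∃ c, a.mul b = some c ∧ G.Walk h (A ++ (x, c) :: B) h' := by
  rw [walk_append] at H
  obtain ⟨z, HA, rfl, p, w, H1, rfl, rfl, q, w', H2, rfl, HB⟩ := H
  refine ⟨lab x (p + q + 1), lab_mul _ _ _ _ H1.color (H1.side hy), ?_⟩
  rw [walk_append]
  exact ⟨x, HA, rfl, _, _, H1.trans hy H2, rfl, HB⟩

theorem Walk.exists_lab {h h' x : Half N V} {a : Chord N} {L : List (Half N V × Chord N)}
    (H : G.Walk h L h') (hx : (x, a) ∈ L) : ∃ p, a = lab x p := by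
  induction L generalizing h with
  | nil => simp at hx
  | cons b L ih =>
    obtain ⟨y, b⟩ := b
    obtain ⟨rfl, p, h1, -, hb, W⟩ := H
    rcases List.mem_cons.1 hx with hx | hx
    · rw [Prod.mk.injEq] at hx
      obtain ⟨rfl, rfl⟩ := hx
      exact ⟨p, hb⟩
    · exact ih W hx

/-- Walks from leaf to leaf are determined by their length. -/
theorem Walk.unique {h x y : Half N V} {L L' : List (Half N V × Chord N)} (H : G.Walk h L x)
    (K : G.Walk h L' y) (hL : ∀ z ∈ L.map Prod.fst, G.IsLeaf z)
    (hL' : ∀ z ∈ L'.map Prod.fst, G.IsLeaf z) (hx : G.IsLeaf x) (hy : G.IsLeaf y)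
    (hlen : L.length = L'.length) : L = L' ∧ x = y := by
  induction L generalizing h L' with
  | nil =>
    obtain rfl : L' = [] := List.length_eq_zero_iff.1 (by simpa using hlen.symm)
    exact ⟨rfl, H.symm.trans K⟩
  | cons a L ih =>
    obtain ⟨z, a⟩ := a
    rcases L' with _ | ⟨⟨z', a'⟩, L'⟩
    · simp at hlen
    obtain ⟨rfl, p, h1, H1, rfl, H2⟩ := H
    obtain ⟨rfl, q, h2, K1, rfl, K2⟩ := K
    have l1 : G.IsLeaf h1 := by
      rcases L with _ | ⟨⟨u, _⟩, L⟩
      · cases H2; exact hx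
      · rw [← H2.head]; exact hL u (by simp)
    have l2 : G.IsLeaf h2 := by
      rcases L' with _ | ⟨⟨u, _⟩, L'⟩
      · cases K2; exact hy
      · rw [← K2.head]; exact hL' u (by simp)
    obtain ⟨rfl, rfl⟩ := H1.unique K1 l1 l2
    obtain ⟨rfl, rfl⟩ := ih H2 K2 (fun u hu => hL u (by simp [hu]))
      (fun u hu => hL' u (by simp [hu])) (by simpa using hlen)
    exact ⟨rfl, rfl⟩

namespace Boundary

variable {r : Half N V} {L : List (Half N V × Chord N)}

theorem root_mem (H : G.Boundary r L) : r ∈ L.map Prod.fst := by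
  rcases L with _ | ⟨⟨x, a⟩, L⟩
  · exact absurd rfl H.ne_nil
  · simp [H.walk.head]

theorem root_isLeaf (H : G.Boundary r L) : G.IsLeaf r := (H.isLeaf_iff r).2 H.root_mem

theorem card (H : G.Boundary r L) : Nat.card {x // G.IsLeaf x} = L.length := by
  classical
  have : {x | G.IsLeaf x} = ((L.map Prod.fst).toFinset : Set (Half N V)) := by
    ext x; simp only [Set.mem_ofPred_eq, H.isLeaf_iff x, List.coe_toFinset]
  change Nat.card ({x | G.IsLeaf x} : Set _) = _
  rw [this, Nat.card_coe_set_eq, Set.ncard_coe_finset, List.toFinset_card_of_nodup H.nodup,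
    List.length_map]

theorem unique {L' : List (Half N V × Chord N)} (H : G.Boundary r L) (K : G.Boundary r L') :
    L = L' :=
  (H.walk.unique K.walk (fun z hz => (H.isLeaf_iff z).2 hz) (fun z hz => (K.isLeaf_iff z).2 hz)
    H.root_isLeaf H.root_isLeaf (H.card.symm.trans K.card)).1

/-- The boundary may be read from the second leaf instead. -/
theorem rotate {x y : Half N V} {a b : Chord N}
    (H : G.Boundary r ((x, a) :: (y, b) :: L)) : G.Boundary y ((y, b) :: L ++ [(x, a)]) := by
  obtain ⟨rfl, p, h1, H1, rfl, H2⟩ := H.walk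
  obtain rfl := H2.head
  refine ⟨?_, by simp, ?_, fun z => ?_⟩
  · rw [walk_append]
    exact ⟨x, H2, walk_singleton.2 ⟨rfl, p, H1, rfl⟩⟩
  · rw [List.map_append]
    exact (List.perm_append_comm.nodup_iff).1 H.nodup
  · rw [H.isLeaf_iff]
    simp only [List.map_cons, List.map_append, List.mem_cons, List.mem_append, List.map_nil,
      List.not_mem_nil, or_false]
    tauto

/-- The boundary may be read from the last leaf instead. -/
theorem rotate_back {x : Half N V} {a : Chord N} (H : G.Boundary r (L ++ [(x, a)])) :
    G.Boundary x ((x, a) :: L) := by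
  obtain ⟨y, H1, H2⟩ := walk_append.1 H.walk
  obtain ⟨rfl, p, H3, rfl⟩ := walk_singleton.1 H2
  refine ⟨⟨rfl, p, r, H3, rfl, H1⟩, by simp, ?_, fun z => ?_⟩
  · have := H.nodup
    rw [List.map_append] at this
    exact (List.perm_append_comm.nodup_iff).1 this
  · rw [H.isLeaf_iff]
    simp only [List.map_cons, List.map_append, List.mem_cons, List.mem_append, List.map_nil,
      List.not_mem_nil, or_false]
    tauto

/-- Consecutive labels on the boundary are composable, and alternate between powers of petals and
central chords. -/
theorem adjacent {x y : Half N V} {a b : Chord N} (H : G.Boundary r ((x, a) :: (y, b) :: L)) :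
    a.Nontrivial ∧ b.Nontrivial ∧ a.target = b.source ∧ b.isCentral = !a.isCentral := by
  have hy : G.IsLeaf y := (H.isLeaf_iff y).2 (by simp)
  obtain ⟨rfl, p, h1, H1, rfl, rfl, q, h2, H2, rfl, -⟩ := H.walk
  refine ⟨lab_nontrivial _ _, lab_nontrivial _ _, ?_, ?_⟩
  · rw [lab_source, H1.color]
  · rw [lab_isCentral, lab_isCentral, H1.side_leaf hy]

theorem ne_singleton {x : Half N V} {a : Chord N} (H : G.Boundary r [(x, a)]) : False := by
  obtain ⟨rfl, p, H1, rfl⟩ := walk_singleton.1 H.walk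
  have := H1.side_leaf H.root_isLeaf
  simp at this

end Boundary

/-- If all leaves lie on one face cycle, then that cycle gives a description of the boundary. -/
theorem exists_boundary [Finite V] [NeZero N] {r : Half N V} (hr : G.IsLeaf r)
    (H : ∀ x, G.IsLeaf x → G.face.SameCycle r x) : ∃ L, G.Boundary r L := by
  have hper : ∃ T, 0 < T ∧ (G.face ^ T) r = r ∧ ∀ m, 0 < m → m < T → (G.face ^ m) r ≠ r := by
    classical
    have h0 : ∃ T, 0 < T ∧ (G.face ^ T) r = r :=
      ⟨orderOf G.face, orderOf_pos _, by simp [pow_orderOf_eq_one]⟩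
    refine ⟨Nat.find h0, (Nat.find_spec h0).1, (Nat.find_spec h0).2, fun m hm hlt e => ?_⟩
    exact Nat.find_min h0 hlt ⟨hm, e⟩
  obtain ⟨T, hT, hTr, hmin⟩ := hper
  -- `T` is the length of the face cycle of `r`, so the first `T` half-edges on it are different.
  have hinj : ∀ m n, m < n → n < T → (G.face ^ m) r ≠ (G.face ^ n) r := by
    intro m n hmn hn e
    obtain ⟨k, rfl⟩ : ∃ k, n = m + k := ⟨n - m, by omega⟩
    rw [pow_add, Perm.mul_apply] at e
    exact hmin k (by omega) (by omega) ((G.face ^ m).injective e).symm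
  -- The walk along the first `k` sectors: at a leaf a new entry of the list begins, and at an
  -- internal edge the last entry is extended by one more sector.
  have key : ∀ k, 0 < k → k ≤ T → ∃ L, G.Walk r L ((G.face ^ k) r) ∧ L ≠ [] ∧
      (L.map Prod.fst).Nodup ∧
      ∀ x, x ∈ L.map Prod.fst ↔ ∃ m < k, x = (G.face ^ m) r ∧ G.IsLeaf x := by
    intro k
    induction k with
    | zero => intro h; omega
    | succ k ih =>
      intro _ hkT
      rcases Nat.eq_zero_or_pos k with rfl | hk
      · refine ⟨[(r, lab r 0)], walk_singleton.2 ⟨rfl, 0, by simpa using arc_zero r, rfl⟩, by simp,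
          by simp, fun x => ?_⟩
        simp only [List.map_cons, List.map_nil, List.mem_singleton, Nat.lt_one_iff, zero_add]
        constructor
        · rintro rfl; exact ⟨0, rfl, rfl, hr⟩
        · rintro ⟨m, rfl, rfl, -⟩; rfl
      · obtain ⟨L, h1, h2, h3, h4⟩ := ih hk (by omega)
        set y := (G.face ^ k) r with hy
        have h5 : G.Walk r (L ++ [(y, lab y 0)]) ((G.face ^ (k + 1)) r) := by
          rw [walk_append]
          refine ⟨y, h1, walk_singleton.2 ⟨rfl, 0, ?_, rfl⟩⟩
          rw [pow_succ', Perm.mul_apply]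
          exact arc_zero y
        by_cases hl : G.IsLeaf y
        · refine ⟨_, h5, by simp, ?_, fun x => ?_⟩
          · rw [List.map_append, List.nodup_append]
            refine ⟨h3, by simp, ?_⟩
            intro a ha b hb
            simp only [List.map_cons, List.map_nil, List.mem_singleton] at hb
            subst hb
            obtain ⟨m, hm, rfl, -⟩ := (h4 a).1 ha
            exact hinj m k hm (by omega)
          · simp only [List.map_append, List.mem_append, h4, List.map_cons, List.map_nil,
              List.mem_singleton]
            constructor
            · rintro (⟨m, hm, e, hx⟩ | rfl)
              · exact ⟨m, by omega, e, hx⟩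
              · exact ⟨k, by omega, hy, hl⟩
            · rintro ⟨m, hm, e, hx⟩
              rcases Nat.lt_or_ge m k with h6 | h6
              · exact Or.inl ⟨m, h6, e, hx⟩
              · obtain rfl : m = k := by omega
                exact Or.inr e
        · obtain ⟨L', z, rfl⟩ : ∃ L' z, L = L' ++ [z] :=
            ⟨L.dropLast, L.getLast h2, (List.dropLast_append_getLast h2).symm⟩
          obtain ⟨z, a⟩ := z
          rw [List.append_assoc] at h5
          obtain ⟨c, -, h6⟩ := Walk.merge h5 hl
          have e : (L' ++ [(z, c)]).map Prod.fst = (L' ++ [(z, a)]).map Prod.fst := by simp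
          refine ⟨_, h6, by simp, e ▸ h3, fun x => ?_⟩
          rw [e, h4]
          constructor
          · rintro ⟨m, hm, e, hx⟩
            exact ⟨m, by omega, e, hx⟩
          · rintro ⟨m, hm, e, hx⟩
            refine ⟨m, lt_of_le_of_ne (by omega) ?_, e, hx⟩
            rintro rfl
            exact hl (by rw [hy, ← e]; exact hx)
  obtain ⟨L, h1, h2, h3, h4⟩ := key T hT le_rfl
  refine ⟨L, by rwa [hTr] at h1, h2, h3, fun x => ?_⟩
  rw [h4]
  refine ⟨fun hx => ?_, fun ⟨m, _, _, hx⟩ => hx⟩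
  obtain ⟨n, hn⟩ := (H x hx).exists_nat_pow_eq
  refine ⟨n % T, Nat.mod_lt _ hT, ?_, hx⟩
  rw [← hn]
  conv_lhs => rw [← Nat.mod_add_div n T, pow_add, Perm.mul_apply]
  have : ∀ k, ((G.face ^ T) ^ k) r = r := by
    intro k
    induction k with
    | zero => simp
    | succ k ih => rw [pow_succ, Perm.mul_apply, hTr, ih]
  rw [pow_mul, this]

end Ribbon

end

open scoped Classical

section

namespace Ribbon

variable {N : ℕ} {V : Type} {G : Ribbon N V}

/-! ### Maps of graphs -/

/-- The map on half-edges induced by a map on vertices. -/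
def lift {V' : Type} (ι : V → V') (h : Half N V) : Half N V' := (ι h.1, h.2)

@[simp] theorem lift_snd {V' : Type} (ι : V → V') (h : Half N V) : (lift ι h).2 = h.2 := rfl

theorem lift_injective {V' : Type} {ι : V → V'} (hι : Function.Injective ι) :
    Function.Injective (lift (N := N) ι) := by
  rintro ⟨v, x⟩ ⟨w, y⟩ h
  simp only [lift, Prod.mk.injEq] at h
  rw [hι h.1, h.2]

/-- An injective map on vertices which identifies a graph with a union of components of another. -/
structure IsEmbedding {V' : Type} (ι : V → V') (G : Ribbon N V) (G' : Ribbon N V') : Prop where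
  injective : Function.Injective ι
  mate : ∀ h, G'.mate (lift ι h) = lift ι (G.mate h)

namespace IsEmbedding

variable {V' : Type} {ι : V → V'} {G' : Ribbon N V'} (E : IsEmbedding ι G G')
include E

theorem isLeaf {h : Half N V} : G'.IsLeaf (lift ι h) ↔ G.IsLeaf h := by
  unfold IsLeaf
  rw [E.mate]
  exact (lift_injective E.injective).eq_iff

theorem face (h : Half N V) : G'.face (lift ι h) = lift ι (G.face h) := by
  rw [face_apply, face_apply, ← E.mate]
  congr 1
  rcases h with ⟨v, i, _ | _⟩ <;> rfl

theorem face_pow (m : ℕ) (h : Half N V) : (G'.face ^ m) (lift ι h) = lift ι ((G.face ^ m) h) := by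
  induction m with
  | zero => rfl
  | succ m ih => rw [pow_succ', Perm.mul_apply, ih, E.face, pow_succ', Perm.mul_apply]

theorem face_zpow (m : ℤ) (h : Half N V) :
    (G'.face ^ m) (lift ι h) = lift ι ((G.face ^ m) h) := by
  obtain ⟨m, rfl | rfl⟩ := m.eq_nat_or_neg
  · simpa using E.face_pow m h
  · rw [zpow_neg, zpow_neg, Perm.inv_eq_iff_eq, zpow_natCast, zpow_natCast, E.face_pow,
      ← Perm.mul_apply, mul_inv_cancel, Perm.one_apply]

theorem sameCycle {h x : Half N V} :
    G'.face.SameCycle (lift ι h) (lift ι x) ↔ G.face.SameCycle h x := by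
  constructor
  · rintro ⟨m, hm⟩
    rw [E.face_zpow] at hm
    exact ⟨m, lift_injective E.injective hm⟩
  · rintro ⟨m, rfl⟩
    exact ⟨m, E.face_zpow m h⟩

theorem exists_of_sameCycle {h : Half N V} {x : Half N V'}
    (H : G'.face.SameCycle (lift ι h) x) : ∃ y, x = lift ι y := by
  obtain ⟨m, rfl⟩ := H
  exact ⟨_, E.face_zpow m h⟩

theorem isInner {h : Half N V} : G'.IsInner (lift ι h) ↔ G.IsInner h := by
  constructor
  · intro H x hx hl
    exact H (lift ι x) (E.sameCycle.2 hx) (E.isLeaf.2 hl)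
  · intro H x hx hl
    obtain ⟨y, rfl⟩ := E.exists_of_sameCycle hx
    exact H y (E.sameCycle.1 hx) (E.isLeaf.1 hl)

theorem arc {h x : Half N V} {p : ℕ} (H : G.Arc h p x) : G'.Arc (lift ι h) p (lift ι x) := by
  refine ⟨fun m h0 hm => ?_, ?_⟩
  · rw [E.face_pow, E.isLeaf]; exact H.1 m h0 hm
  · rw [E.face_pow, H.2]

theorem walk {h x : Half N V} {L : List (Half N V × Chord N)} (H : G.Walk h L x) :
    G'.Walk (lift ι h) (L.map (Prod.map (lift ι) id)) (lift ι x) := by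
  induction L generalizing h with
  | nil => cases H; rfl
  | cons a L ih =>
    obtain ⟨y, a⟩ := a
    obtain ⟨rfl, p, h1, H1, rfl, H2⟩ := H
    exact ⟨rfl, p, _, E.arc H1, rfl, ih H2⟩

end IsEmbedding

theorem map_fst_lift {V' : Type} (ι : V → V') (L : List (Half N V × Chord N)) :
    (L.map (Prod.map (lift ι) id)).map Prod.fst = (L.map Prod.fst).map (lift ι) := by
  simp [Function.comp_def]

theorem map_snd_lift {V' : Type} (ι : V → V') (L : List (Half N V × Chord N)) :
    (L.map (Prod.map (lift ι) id)).map Prod.snd = L.map Prod.snd := by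
  simp [Function.comp_def]

/-- Transport of the description of the boundary along an isomorphism. -/
theorem Boundary.map {V' : Type} {G' : Ribbon N V'} {σ : V ≃ V'} (E : IsEmbedding σ G G')
    {r : Half N V} {L : List (Half N V × Chord N)} (H : G.Boundary r L) :
    G'.Boundary (lift σ r) (L.map (Prod.map (lift σ) id)) := by
  refine ⟨E.walk H.walk, by simpa using H.ne_nil, ?_, fun x => ?_⟩
  · rw [map_fst_lift]
    exact H.nodup.map (lift_injective σ.injective)
  · obtain ⟨y, rfl⟩ : ∃ y, x = lift σ y := ⟨(σ.symm x.1, x.2), by simp [lift]⟩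
    rw [E.isLeaf, H.isLeaf_iff, map_fst_lift,
      List.mem_map_of_injective (lift_injective σ.injective)]

/-- Transport of a graph along a bijection of the vertex sets. -/
def map {V' : Type} (σ : V ≃ V') (G : Ribbon N V) : Ribbon N V' where
  mate := (σ.prodCongr (Equiv.refl _)).permCongr G.mate
  mate_mate h := by
    rw [Equiv.permCongr_apply, Equiv.permCongr_apply, Equiv.symm_apply_apply, G.mate_mate,
      Equiv.apply_symm_apply]
  coherent h hh := by
    have := G.coherent ((σ.prodCongr (Equiv.refl _)).symm h) (by
      intro e
      apply hh
      rw [Equiv.permCongr_apply, e, Equiv.apply_symm_apply])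
    simpa [Equiv.permCongr_apply] using this

theorem isEmbedding_map {V' : Type} (σ : V ≃ V') (G : Ribbon N V) :
    IsEmbedding σ G (G.map σ) := by
  refine ⟨σ.injective, fun h => ?_⟩
  simp [map, Equiv.permCongr_apply, lift, Prod.map]

theorem IsEmbedding.refl (G : Ribbon N V) : IsEmbedding id G G :=
  ⟨Function.injective_id, fun _ => rfl⟩

theorem IsEmbedding.trans {V' V'' : Type} {ι : V → V'} {κ : V' → V''} {G' : Ribbon N V'}
    {G'' : Ribbon N V''} (E : IsEmbedding ι G G') (F : IsEmbedding κ G' G'') :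
    IsEmbedding (κ ∘ ι) G G'' :=
  ⟨F.injective.comp E.injective, fun h => by
    have := F.mate (lift ι h)
    rw [E.mate] at this
    exact this⟩

theorem IsEmbedding.symm {V' : Type} {σ : V ≃ V'} {G' : Ribbon N V'} (E : IsEmbedding σ G G') :
    IsEmbedding σ.symm G' G := by
  refine ⟨σ.symm.injective, fun h => ?_⟩
  have := E.mate (lift σ.symm h)
  simp only [lift, Equiv.apply_symm_apply, Prod.mk.eta] at this ⊢
  rw [this]
  simp

/-! ### Joining two leaves to an internal edge -/

/-- Two leaves of the same colour that may be joined to form an internal edge. -/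
structure Joinable (G : Ribbon N V) (e e' : Half N V) : Prop where
  left : G.IsLeaf e
  right : G.IsLeaf e'
  color : e'.2.1 = e.2.1
  side : e'.2.2 = !e.2.2

theorem Joinable.ne {e e' : Half N V} (J : G.Joinable e e') : e ≠ e' := by
  rintro rfl
  simpa using J.side

/-- The graph obtained by joining the two leaves `e` and `e'`. -/
def glue (G : Ribbon N V) {e e' : Half N V} (J : G.Joinable e e') : Ribbon N V where
  mate := swap e e' * G.mate
  mate_mate h := by
    have h1 : G.mate e = e := J.left
    have h2 : G.mate e' = e' := J.right
    have key : ∀ x, G.mate (swap e e' x) = swap e e' (G.mate x) := by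
      intro x
      have := Equiv.swap_apply_apply G.mate e e'
      rw [h1, h2] at this
      conv_rhs => rw [this]
      simp [Perm.mul_apply]
    rw [Perm.mul_apply, Perm.mul_apply, key, G.mate_mate, swap_apply_self]
  coherent h hh := by
    have h1 : G.mate e = e := J.left
    have h2 : G.mate e' = e' := J.right
    rw [Perm.mul_apply] at hh ⊢
    by_cases he : h = e
    · subst he; rw [h1, swap_apply_left]; exact ⟨J.color, J.side⟩
    by_cases he' : h = e'
    · subst he'; rw [h2, swap_apply_right]; exact ⟨J.color.symm, by simp [J.side]⟩
    have a1 : G.mate h ≠ e := fun e1 => he (G.mate.injective (e1.trans h1.symm))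
    have a2 : G.mate h ≠ e' := fun e1 => he' (G.mate.injective (e1.trans h2.symm))
    rw [swap_apply_of_ne_of_ne a1 a2] at hh ⊢
    exact G.coherent h hh

section glue
variable {e e' : Half N V} (J : G.Joinable e e')

theorem glue_face : (G.glue J).face = swap e e' * G.face := by
  unfold face glue
  rw [mul_assoc]

theorem glue_mate_left : (G.glue J).mate e = e' := by
  have : G.mate e = e := J.left
  simp [glue, this]

theorem glue_mate_right : (G.glue J).mate e' = e := by
  have : G.mate e' = e' := J.right
  simp [glue, this]

theorem glue_mate_of_ne {h : Half N V} (h1 : h ≠ e) (h2 : h ≠ e') :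
    (G.glue J).mate h = G.mate h := by
  have a1 : G.mate h ≠ e := fun x => h1 (G.mate.injective (x.trans J.left.symm))
  have a2 : G.mate h ≠ e' := fun x => h2 (G.mate.injective (x.trans J.right.symm))
  simp only [glue, Perm.mul_apply]
  exact swap_apply_of_ne_of_ne a1 a2

theorem glue_isLeaf {h : Half N V} : (G.glue J).IsLeaf h ↔ G.IsLeaf h ∧ h ≠ e ∧ h ≠ e' := by
  unfold IsLeaf
  by_cases h1 : h = e
  · subst h1; simp [glue_mate_left, J.ne.symm]
  by_cases h2 : h = e'
  · subst h2; simp [glue_mate_right, J.ne]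
  rw [glue_mate_of_ne J h1 h2]
  tauto

/-- The faces agree up to the first half-edge that is glued. -/
theorem glue_pow {h : Half N V} : ∀ {p : ℕ},
    (∀ m, 0 < m → m ≤ p → (G.face ^ m) h ≠ e ∧ (G.face ^ m) h ≠ e') →
      ((G.glue J).face ^ p) h = (G.face ^ p) h
  | 0, _ => rfl
  | p + 1, H => by
    have ih := glue_pow (p := p) fun m h0 hm => H m h0 (by omega)
    have h2 := H (p + 1) (by omega) le_rfl
    rw [pow_succ', Perm.mul_apply] at h2 ⊢
    rw [ih, glue_face, Perm.mul_apply, swap_apply_of_ne_of_ne h2.1 h2.2, pow_succ',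
      Perm.mul_apply]

theorem glue_pow' {h : Half N V} : ∀ {p : ℕ},
    (∀ m, 0 < m → m ≤ p → ((G.glue J).face ^ m) h ≠ e ∧ ((G.glue J).face ^ m) h ≠ e') →
      ((G.glue J).face ^ p) h = (G.face ^ p) h
  | 0, _ => rfl
  | p + 1, H => by
    have ih := glue_pow' (p := p) fun m h0 hm => H m h0 (by omega)
    have h2 := H (p + 1) (by omega) le_rfl
    rw [pow_succ', Perm.mul_apply, ih, glue_face, Perm.mul_apply] at h2 ⊢
    rw [pow_succ', Perm.mul_apply]
    apply swap_apply_of_ne_of_ne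
    · intro e1; rw [e1, swap_apply_left] at h2; exact h2.2 rfl
    · intro e1; rw [e1, swap_apply_right] at h2; exact h2.1 rfl

/-- An arc survives the gluing; if it ends at one of the two leaves, it now crosses the new edge and
ends at the other one. -/
theorem Arc.glue {h x : Half N V} {p : ℕ} (H : G.Arc h p x) :
    (G.glue J).Arc h p (swap e e' x) := by
  have key : ∀ m, 0 < m → m ≤ p → (G.face ^ m) h ≠ e ∧ (G.face ^ m) h ≠ e' := fun m h0 hm =>
    ⟨fun e1 => H.1 m h0 hm (e1 ▸ J.left), fun e1 => H.1 m h0 hm (e1 ▸ J.right)⟩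
  refine ⟨fun m h0 hm hl => ?_, ?_⟩
  · rw [glue_pow J fun k k0 hk => key k k0 (hk.trans hm)] at hl
    exact H.1 m h0 hm ((glue_isLeaf J).1 hl).1
  · rw [pow_succ', Perm.mul_apply, glue_pow J key, glue_face, Perm.mul_apply, ← H.2, pow_succ',
      Perm.mul_apply]

/-- An arc of the glued graph which does not pass through the new edge. -/
theorem Arc.of_glue {h x : Half N V} {p : ℕ} (H : (G.glue J).Arc h p x)
    (H' : ∀ m, 0 < m → m ≤ p → ((G.glue J).face ^ m) h ≠ e ∧ ((G.glue J).face ^ m) h ≠ e') :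
    G.Arc h p (swap e e' x) := by
  refine ⟨fun m h0 hm hl => ?_, ?_⟩
  · have h1 := H' m h0 hm
    have h2 := glue_pow' J fun k k0 hk => H' k k0 (hk.trans hm)
    exact H.1 m h0 hm ((glue_isLeaf J).2 ⟨h2 ▸ hl, h1⟩)
  · rw [← H.2, pow_succ', pow_succ', Perm.mul_apply, Perm.mul_apply, glue_pow' J H', glue_face,
      Perm.mul_apply, swap_apply_self]

theorem Walk.glue {h x : Half N V} {L : List (Half N V × Chord N)} (H : G.Walk h L x)
    (hL : L ≠ []) (H' : ∀ z ∈ L.tail.map Prod.fst, z ≠ e ∧ z ≠ e') :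
    (G.glue J).Walk h L (swap e e' x) := by
  induction L generalizing h with
  | nil => exact absurd rfl hL
  | cons a L ih =>
    obtain ⟨y, a⟩ := a
    obtain ⟨rfl, p, h1, H1, rfl, H2⟩ := H
    have H3 := H1.glue J
    rcases L with _ | ⟨⟨z, b⟩, L⟩
    · cases H2
      exact ⟨rfl, p, _, H3, rfl, rfl⟩
    · have hz := H2.head
      subst hz
      have h2 := H' z (by simp)
      rw [swap_apply_of_ne_of_ne h2.1 h2.2] at H3
      exact ⟨rfl, p, _, H3, rfl, ih H2 (by simp) fun w hw => H' w (by
        simp only [List.tail_cons] at hw ⊢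
        simp [hw])⟩

theorem Arc.glue_left {h : Half N V} {p : ℕ} (H : G.Arc h p e) : (G.glue J).Arc h p e' := by
  simpa using H.glue J

theorem Arc.glue_right {h : Half N V} {p : ℕ} (H : G.Arc h p e') : (G.glue J).Arc h p e := by
  simpa using H.glue J

theorem Walk.glue_left {h : Half N V} {L : List (Half N V × Chord N)} (H : G.Walk h L e)
    (hL : L ≠ []) (H' : ∀ z ∈ L.tail.map Prod.fst, z ≠ e ∧ z ≠ e') : (G.glue J).Walk h L e' := by
  simpa using H.glue J hL H'

theorem Walk.glue_of_ne {h x : Half N V} {L : List (Half N V × Chord N)} (H : G.Walk h L x)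
    (hL : L ≠ []) (H' : ∀ z ∈ L.tail.map Prod.fst, z ≠ e ∧ z ≠ e') (h1 : x ≠ e) (h2 : x ≠ e') :
    (G.glue J).Walk h L x := by
  have := H.glue J hL H'
  rwa [swap_apply_of_ne_of_ne h1 h2] at this

theorem glue_pow_of_forall {h : Half N V} (H : ∀ x, G.face.SameCycle h x → x ≠ e ∧ x ≠ e')
    (m : ℕ) : ((G.glue J).face ^ m) h = (G.face ^ m) h :=
  glue_pow J fun m _ _ => H _ ⟨m, by simp⟩

theorem glue_pow_of_forall' {h : Half N V}
    (H : ∀ x, (G.glue J).face.SameCycle h x → x ≠ e ∧ x ≠ e') (m : ℕ) :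
    ((G.glue J).face ^ m) h = (G.face ^ m) h :=
  glue_pow' J fun m _ _ => H _ ⟨m, by simp⟩

variable [Finite V] [NeZero N]

theorem glue_sameCycle {h : Half N V} (H : ∀ x, G.face.SameCycle h x → x ≠ e ∧ x ≠ e')
    {x : Half N V} : (G.glue J).face.SameCycle h x ↔ G.face.SameCycle h x := by
  constructor
  · intro hx
    obtain ⟨m, rfl⟩ := hx.exists_nat_pow_eq
    exact ⟨m, by rw [glue_pow_of_forall J H]; simp⟩
  · intro hx
    obtain ⟨m, rfl⟩ := hx.exists_nat_pow_eq
    exact ⟨m, by rw [zpow_natCast, glue_pow_of_forall J H]⟩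

theorem glue_sameCycle' {h : Half N V}
    (H : ∀ x, (G.glue J).face.SameCycle h x → x ≠ e ∧ x ≠ e')
    {x : Half N V} : (G.glue J).face.SameCycle h x ↔ G.face.SameCycle h x := by
  constructor
  · intro hx
    obtain ⟨m, rfl⟩ := hx.exists_nat_pow_eq
    exact ⟨m, by rw [glue_pow_of_forall' J H]; simp⟩
  · intro hx
    obtain ⟨m, rfl⟩ := hx.exists_nat_pow_eq
    exact ⟨m, by rw [zpow_natCast, glue_pow_of_forall' J H]⟩

/-- Faces that do not pass through the new edge are not affected by gluing. -/
theorem glue_isInner {h : Half N V} : G.IsInner h ↔ (G.glue J).IsInner h ∧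
    ¬ (G.glue J).face.SameCycle h e ∧ ¬ (G.glue J).face.SameCycle h e' := by
  constructor
  · intro H
    have h1 : ∀ x, G.face.SameCycle h x → x ≠ e ∧ x ≠ e' := fun x hx =>
      ⟨fun h2 => H x hx (h2 ▸ J.left), fun h2 => H x hx (h2 ▸ J.right)⟩
    refine ⟨fun x hx hl => ?_, fun hx => ?_, fun hx => ?_⟩
    · exact H x ((glue_sameCycle J h1).1 hx) ((glue_isLeaf J).1 hl).1
    · exact (h1 _ ((glue_sameCycle J h1).1 hx)).1 rfl
    · exact (h1 _ ((glue_sameCycle J h1).1 hx)).2 rfl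
  · rintro ⟨H, h2, h3⟩ x hx hl
    have h1 : ∀ x, (G.glue J).face.SameCycle h x → x ≠ e ∧ x ≠ e' := fun x hx =>
      ⟨fun h => h2 (h ▸ hx), fun h => h3 (h ▸ hx)⟩
    have hx' := (glue_sameCycle' J h1).2 hx
    exact H x hx' ((glue_isLeaf J).2 ⟨hl, h1 x hx'⟩)

end glue

/-- The graph obtained by cutting the edge of `e` into two leaves. -/
def cut (G : Ribbon N V) (e : Half N V) : Ribbon N V :=
  { mate := swap e (G.mate e) * G.mate
    mate_mate := fun h => by
      have key : ∀ x, G.mate (swap e (G.mate e) x) = swap e (G.mate e) (G.mate x) := by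
        intro x
        have := Equiv.swap_apply_apply G.mate e (G.mate e)
        rw [G.mate_mate, swap_comm] at this
        conv_rhs => rw [this]
        simp [Perm.mul_apply]
      rw [Perm.mul_apply, Perm.mul_apply, key, G.mate_mate, swap_apply_self]
    coherent := fun h hh => by
      rw [Perm.mul_apply] at hh ⊢
      by_cases h1 : h = e
      · subst h1; simp at hh
      by_cases h2 : h = G.mate e
      · subst h2; rw [G.mate_mate] at hh; simp at hh
      have a1 : G.mate h ≠ e := fun x => h2 (by rw [← x, G.mate_mate])
      have a2 : G.mate h ≠ G.mate e := fun x => h1 (G.mate.injective x)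
      rw [swap_apply_of_ne_of_ne a1 a2] at hh ⊢
      exact G.coherent h hh }

theorem cut_joinable {e : Half N V} (he : ¬ G.IsLeaf e) :
    (G.cut e).Joinable e (G.mate e) := by
  refine ⟨?_, ?_, (G.coherent e he).1, (G.coherent e he).2⟩
  · simp [IsLeaf, cut]
  · simp [IsLeaf, cut, G.mate_mate]

theorem ext {G G' : Ribbon N V} (h : ∀ x, G.mate x = G'.mate x) : G = G' := by
  cases G; cases G'
  congr
  exact Equiv.ext h

theorem glue_cut {e : Half N V} (he : ¬ G.IsLeaf e) : (G.cut e).glue (cut_joinable he) = G := by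
  refine ext fun x => ?_
  simp [glue, cut]

end Ribbon

end

section

namespace Ribbon

variable {N : ℕ} {V : Type} {G : Ribbon N V}

/-! ### Connectedness and the Euler inequality -/

/-- Two vertices are joined by a path of edges. -/
def Conn (G : Ribbon N V) (u v : V) : Prop :=
  Relation.ReflTransGen (fun x y => ∃ h : Half N V, h.1 = x ∧ (G.mate h).1 = y) u v

theorem Conn.step (h : Half N V) : G.Conn h.1 (G.mate h).1 :=
  Relation.ReflTransGen.single ⟨h, rfl, rfl⟩

theorem Conn.refl (v : V) : G.Conn v v := Relation.ReflTransGen.refl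

theorem Conn.trans {u v w : V} (h : G.Conn u v) (k : G.Conn v w) : G.Conn u w :=
  Relation.ReflTransGen.trans h k

theorem Conn.symm {u v : V} (h : G.Conn u v) : G.Conn v u := by
  induction h with
  | refl => exact Conn.refl _
  | tail _ h ih =>
    obtain ⟨h, rfl, rfl⟩ := h
    refine Conn.trans ?_ ih
    have := Conn.step (G := G) (G.mate h)
    rwa [G.mate_mate] at this

theorem Conn.map_eq {α : Type*} {f : V → α} (hf : ∀ h : Half N V, f (G.mate h).1 = f h.1)
    {u v : V} (h : G.Conn u v) : f v = f u := by
  induction h with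
  | refl => rfl
  | tail _ h ih =>
    obtain ⟨h, rfl, rfl⟩ := h
    rw [hf, ih]

theorem conn_face (h : Half N V) : G.Conn h.1 (G.face h).1 := by
  have := Conn.step (G := G) (rot h)
  rwa [rot_fst] at this

theorem conn_of_sameCycle [Finite V] [NeZero N] {h x : Half N V} (H : G.face.SameCycle h x) :
    G.Conn h.1 x.1 := by
  obtain ⟨m, rfl⟩ := H.exists_nat_pow_eq
  induction m with
  | zero => exact Conn.refl _
  | succ m ih =>
    rw [pow_succ', Perm.mul_apply]
    exact (ih ⟨m, rfl⟩).trans (conn_face _)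

/-- A function on the half-edges of a connected graph which is invariant under `face` and `mate` is
constant: it is then invariant under `rot`, hence a function of the vertex. -/
theorem eq_of_invariant {α : Type*} {f : Half N V → α} (h1 : ∀ h, f (G.face h) = f h)
    (h2 : ∀ h, f (G.mate h) = f h) (hc : ∀ u v, G.Conn u v) (x y : Half N V) : f x = f y := by
  have h3 : ∀ h, f (rot h) = f h := fun h => by rw [← h1 h, face_apply, h2]
  have h4 : ∀ v i b, f (v, i, b) = f (v, 0, false) := by
    have h5 : ∀ v (i : ZMod N), f (v, i, false) = f (v, 0, false) := by
      intro v i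
      have : ∀ m : ℤ, f (v, (m : ZMod N), false) = f (v, 0, false) := by
        have step : ∀ i : ZMod N, f (v, i + 1, false) = f (v, i, false) := fun i => by
          rw [← h3 (v, i, false), ← h3 (rot (v, i, false))]; rfl
        intro m
        induction m using Int.induction_on with
        | zero => simp
        | succ m ih => push_cast at ih ⊢; rw [step, ih]
        | pred m ih =>
          rw [← ih, ← step]
          congr 3
          push_cast; ring
      obtain ⟨m, rfl⟩ := ZMod.intCast_surjective i
      exact this m
    rintro v i (_ | _)
    · exact h5 v i
    · rw [← rot_false, h3, h5]
  have h6 : ∀ h : Half N V, f h = f (h.1, 0, false) := fun h => h4 h.1 h.2.1 h.2.2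
  rw [h6 x, h6 y]
  refine (Conn.map_eq (f := fun v => f (v, 0, false)) (fun h => ?_) (hc y.1 x.1))
  rw [← h6, ← h6, h2]

section euler
variable [Fintype V] [NeZero N]

/-- The half-edges of the right side, one for each internal edge. -/
abbrev Edge (G : Ribbon N V) := {x : V × ZMod N // ¬ G.IsLeaf (x.1, x.2, true)}

/-- The chosen half of an internal edge. -/
def Edge.half (e : G.Edge) : Half N V := (e.1.1, e.1.2, true)

/-- A sum over all half-edges, as a sum over the internal edges. The two halves of an internal edge
lie on different sides, so the half of the right side represents the edge. -/
theorem sum_edge {M : Type*} [AddCommMonoid M] (φ : Half N V → M) (hφ : ∀ h, G.IsLeaf h → φ h = 0) :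
    ∑ h, φ h = ∑ e : G.Edge, (φ e.half + φ (G.mate e.half)) := by
  have h1 : ∑ h, φ h =
      ∑ x : V × ZMod N, φ (x.1, x.2, true) + ∑ x : V × ZMod N, φ (x.1, x.2, false) := by
    rw [Fintype.sum_prod_type, Fintype.sum_prod_type, Fintype.sum_prod_type,
      ← Finset.sum_add_distrib]
    refine Finset.sum_congr rfl fun v _ => ?_
    rw [Fintype.sum_prod_type, ← Finset.sum_add_distrib]
    exact Finset.sum_congr rfl fun i _ => by simp
  have h2 : ∀ b, ∑ x : V × ZMod N, φ (x.1, x.2, b) =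
      ∑ x : {x : V × ZMod N // ¬ G.IsLeaf (x.1, x.2, b)}, φ (x.1.1, x.1.2, b) := by
    intro b
    rw [← Finset.sum_filter_of_ne (p := fun x : V × ZMod N => ¬ G.IsLeaf (x.1, x.2, b))
      (fun x _ hx hl => hx (hφ _ hl))]
    exact Finset.sum_subtype _ (by simp) _
  have key : ∀ x : V × ZMod N, ∀ b, ¬ G.IsLeaf (x.1, x.2, b) →
      G.mate (x.1, x.2, b) = ((G.mate (x.1, x.2, b)).1, (G.mate (x.1, x.2, b)).2.1, !b) := by
    intro x b hx
    have := (G.coherent _ hx).2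
    rw [← this]
  rw [h1, h2, h2, Finset.sum_add_distrib]
  congr 1
  refine Finset.sum_bij'
    (fun x _ => ⟨((G.mate (x.1.1, x.1.2, false)).1, (G.mate (x.1.1, x.1.2, false)).2.1), ?_⟩)
    (fun x _ => ⟨((G.mate (x.1.1, x.1.2, true)).1, (G.mate (x.1.1, x.1.2, true)).2.1), ?_⟩)
    (by simp) (by simp) ?_ ?_ ?_
  · have h3 := key _ _ x.2
    simp only [Bool.not_false] at h3
    rw [← h3]; exact not_isLeaf_mate x.2
  · have h3 := key _ _ x.2
    simp only [Bool.not_true] at h3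
    rw [← h3]; exact not_isLeaf_mate x.2
  · intro x _
    have h3 := key _ _ x.2
    simp only [Bool.not_false] at h3
    ext1
    simp only [← h3, G.mate_mate]
  · intro x _
    have h3 := key _ _ x.2
    simp only [Bool.not_true] at h3
    ext1
    simp only [← h3, G.mate_mate]
  · intro x _
    have h3 := key _ _ x.2
    simp only [Bool.not_false] at h3
    simp only [Edge.half, ← h3, G.mate_mate]

theorem card_not_isLeaf : Nat.card {h // ¬ G.IsLeaf h} = 2 * Fintype.card G.Edge := by
  have := sum_edge (G := G) (fun h => if G.IsLeaf h then 0 else 1) (by simp +contextual)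
  rw [Nat.card_eq_fintype_card, Fintype.card_subtype, Finset.card_filter]
  simp only [ite_not]
  rw [this, Finset.sum_congr rfl (g := fun _ => 2), Finset.sum_const, Finset.card_univ, smul_eq_mul,
    mul_comm]
  intro e _
  have h1 : ¬ G.IsLeaf e.half := e.2
  have h2 := not_isLeaf_mate h1
  simp [h1, h2]

/-- The difference of a function on half-edges along the edges, modulo two. -/
def edgeDiff (G : Ribbon N V) : (Half N V → ZMod 2) →ₗ[ZMod 2] (G.Edge → ZMod 2) :=
  LinearMap.funLeft _ _ Edge.half + LinearMap.funLeft _ _ (fun e => G.mate (Edge.half e))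

omit [Fintype V] [NeZero N] in
theorem edgeDiff_apply (f : Half N V → ZMod 2) (e : G.Edge) :
    G.edgeDiff f e = f e.half + f (G.mate e.half) := rfl

omit [Fintype V] [NeZero N] in
theorem edgeDiff_eq_zero {f : Half N V → ZMod 2} (H : G.edgeDiff f = 0) (h : Half N V) :
    f (G.mate h) = f h := by
  by_cases hl : G.IsLeaf h
  · rw [show G.mate h = h from hl]
  · have key : ∀ h : Half N V, h.2.2 = true → ¬ G.IsLeaf h → f (G.mate h) = f h := by
      rintro ⟨v, i, b⟩ rfl hl
      have := congrFun H ⟨(v, i), hl⟩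
      rw [edgeDiff_apply, Pi.zero_apply, CharTwo.add_eq_zero] at this
      exact this.symm
    cases hb : h.2.2 with
    | true => exact key h hb hl
    | false =>
      have := key (G.mate h) (by rw [(G.coherent h hl).2, hb]; rfl) (not_isLeaf_mate hl)
      rw [G.mate_mate] at this
      exact this.symm

/-- The boundary of a union of faces is a cycle, hence orthogonal to all coboundaries. -/
theorem edgeDiff_orthogonal {f : Half N V → ZMod 2} (hf : ∀ h, f (G.face h) = f h)
    (u : V → ZMod 2) : ∑ e, G.edgeDiff f e * G.edgeDiff (fun h => u h.1) e = 0 := by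
  have h1 : ∑ e, G.edgeDiff f e * G.edgeDiff (fun h => u h.1) e =
      ∑ h : Half N V, (f h + f (G.mate h)) * u h.1 := by
    rw [sum_edge (G := G)]
    · refine Finset.sum_congr rfl fun e _ => ?_
      rw [edgeDiff_apply, edgeDiff_apply, G.mate_mate]; ring
    · intro h hl
      rw [show G.mate h = h from hl, CharTwo.add_self_eq_zero, zero_mul]
  have h2 : ∑ h : Half N V, f (G.mate h) * u h.1 = ∑ h : Half N V, f h * u h.1 := by
    rw [← Equiv.sum_comp rot]
    refine Finset.sum_congr rfl fun h _ => ?_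
    rw [← face_apply, hf, rot_fst]
  rw [h1]
  simp only [add_mul, Finset.sum_add_distrib]
  rw [h2, CharTwo.add_self_eq_zero]

/-- A map which kills only constant functions has a kernel of dimension at most one. -/
theorem finrank_ker_le_one {X M : Type*} [AddCommGroup M] [Module (ZMod 2) M] [Fintype X]
    (f : (X → ZMod 2) →ₗ[ZMod 2] M) (H : ∀ u, f u = 0 → ∀ x y, u x = u y) :
    Module.finrank (ZMod 2) (LinearMap.ker f) ≤ 1 := by
  have h1 : LinearMap.ker f ≤ Submodule.span (ZMod 2) {fun _ : X => (1 : ZMod 2)} := by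
    intro u hu
    rw [Submodule.mem_span_singleton]
    rcases isEmpty_or_nonempty X with hX | ⟨⟨x⟩⟩
    · exact ⟨0, by ext x; exact isEmptyElim x⟩
    · exact ⟨u x, by ext y; simp [H u hu x y]⟩
  exact (Submodule.finrank_mono h1).trans ((finrank_span_le_card _).trans (by simp))

theorem finrank_add_le_of_orthogonal {X : Type*} [Fintype X]
    (W W' : Submodule (ZMod 2) (X → ZMod 2)) (H : ∀ w ∈ W, ∀ w' ∈ W', ∑ x, w x * w' x = 0) :
    Module.finrank (ZMod 2) W + Module.finrank (ZMod 2) W' ≤ Fintype.card X := by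
  have h1 : W.map (dotProductEquiv (ZMod 2) X).toLinearMap ≤ W'.dualAnnihilator := by
    rintro _ ⟨w, hw, rfl⟩
    rw [Submodule.mem_dualAnnihilator]
    intro w' hw'
    exact H w hw w' hw'
  have h2 := Submodule.finrank_mono h1
  have h3 := Subspace.finrank_add_finrank_dualAnnihilator_eq W'
  rw [LinearEquiv.finrank_map_eq (dotProductEquiv (ZMod 2) X) W] at h2
  rw [Module.finrank_fintype_fun_eq_card] at h3
  omega

/-- The function on half-edges that takes the value `u x` on the face of `g x`. -/
def faceSum {X : Type*} [Fintype X] (G : Ribbon N V) (g : X → Half N V) :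
    (X → ZMod 2) →ₗ[ZMod 2] (Half N V → ZMod 2) where
  toFun u h := ∑ x, if G.face.SameCycle (g x) h then u x else 0
  map_add' u v := by
    ext h
    simp only [Pi.add_apply, ← Finset.sum_add_distrib]
    exact Finset.sum_congr rfl fun x _ => by split_ifs <;> simp
  map_smul' c u := by
    ext h
    simp [Finset.mul_sum]

/-- The Euler inequality `V - E + F ≤ 2` of a connected ribbon graph, where `F` counts any family of
different face cycles. The sum of the face boundaries over `ZMod 2` is the only possible relation
among them, and face boundaries lie in the space of cycles, whose dimension is `E - V + 1`. -/
theorem euler_le [Nonempty V] (hc : ∀ u v, G.Conn u v) {X : Type*} [Fintype X]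
    (g : X → Half N V) (hg : ∀ x y, G.face.SameCycle (g x) (g y) → x = y) :
    2 * Fintype.card X + 2 * Fintype.card V ≤ Nat.card {h // ¬ G.IsLeaf h} + 4 := by
  set A := G.edgeDiff ∘ₗ G.faceSum g with hA
  set B := G.edgeDiff ∘ₗ LinearMap.funLeft (ZMod 2) (ZMod 2) (Prod.fst : Half N V → V) with hB
  have inv : ∀ u h, G.faceSum g u (G.face h) = G.faceSum g u h := by
    intro u h
    simp [faceSum, Perm.sameCycle_apply_right]
  have kA : Module.finrank (ZMod 2) (LinearMap.ker A) ≤ 1 := by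
    refine finrank_ker_le_one A fun u hu x y => ?_
    have h1 : ∀ x, G.faceSum g u (g x) = u x := by
      intro x
      simp only [faceSum, LinearMap.coe_mk, AddHom.coe_mk]
      rw [Finset.sum_eq_single x]
      · simp [Perm.SameCycle.refl]
      · intro z _ hz
        rw [if_neg fun h => hz (hg _ _ h)]
      · simp
    rw [← h1 x, ← h1 y]
    exact eq_of_invariant (inv u) (edgeDiff_eq_zero hu) hc _ _
  have kB : Module.finrank (ZMod 2) (LinearMap.ker B) ≤ 1 := by
    refine finrank_ker_le_one B fun u hu x y => ?_
    exact (Conn.map_eq (f := u) (fun h => edgeDiff_eq_zero (f := fun h => u h.1) hu h)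
      (hc x y)).symm
  have orth := finrank_add_le_of_orthogonal (LinearMap.range A) (LinearMap.range B) (by
    rintro _ ⟨u, rfl⟩ _ ⟨v, rfl⟩
    exact edgeDiff_orthogonal (inv u) v)
  have rA := LinearMap.finrank_range_add_finrank_ker A
  have rB := LinearMap.finrank_range_add_finrank_ker B
  rw [Module.finrank_fintype_fun_eq_card] at rA rB
  rw [card_not_isLeaf]
  omega

end euler
end Ribbon

end

section

namespace Ribbon

variable {N : ℕ} {V : Type} {G : Ribbon N V}

/-! ### Weights and planarity -/

/-- The number of sectors of a cycle: one for a petal cycle, and `N` for an internal cycle. -/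
def period (N : ℕ) (b : Bool) : ℕ := if b then N else 1

/-- The sector that is used to count the cycles of a given weight. -/
def key {N : ℕ} : Option (ZMod N) → ZMod N × Bool
  | some i => (i, false)
  | none => (0, true)

/-- The weight of a cycle which contains a sector of the given type. -/
def kind {N : ℕ} (x : ZMod N × Bool) : Option (ZMod N) := if x.2 then none else some x.1

/-- The number of cycles of each type. -/
def weight [NeZero N] (G : Ribbon N V) : Weight N :=
  Finsupp.equivFunOnFinite.symm fun o => Nat.card {v : V // G.IsInner (v, key o)}

theorem weight_apply [NeZero N] (o : Option (ZMod N)) :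
    G.weight o = Nat.card {v : V // G.IsInner (v, key o)} := rfl

/-- The allowable graphs. -/
structure Good [NeZero N] (G : Ribbon N V) : Prop where
  connected : ∀ u v, G.Conn u v
  cycle : ∀ h, G.IsInner h → (G.face ^ period N h.2.2) h = h
  planar : 2 * Nat.card V + 2 * G.weight.degree = Nat.card {h // ¬ G.IsLeaf h} + 2

theorem IsInner.of_sameCycle {h x : Half N V} (H : G.IsInner h) (hx : G.face.SameCycle h x) :
    G.IsInner x := fun y hy => H y (hx.trans hy)

theorem IsInner.not_isLeaf_pow {h : Half N V} (H : G.IsInner h) (m : ℕ) :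
    ¬ G.IsLeaf ((G.face ^ m) h) := H _ ⟨m, by simp⟩

theorem IsInner.side {h : Half N V} (H : G.IsInner h) (m : ℕ) :
    ((G.face ^ m) h).2.2 = h.2.2 := pow_side fun k _ _ => H.not_isLeaf_pow k

theorem IsInner.color {h : Half N V} (H : G.IsInner h) (m : ℕ) :
    ((G.face ^ m) h).2.1 = h.2.1 + (if h.2.2 then (m : ZMod N) else 0) :=
  pow_color fun k _ _ => H.not_isLeaf_pow k

theorem not_isInner_of_isLeaf {h : Half N V} (H : G.IsLeaf h) : ¬ G.IsInner h :=
  fun K => K h (Perm.SameCycle.refl _ _) H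

section
variable [Finite V] [NeZero N]

theorem IsInner.cycle_of_sameCycle {h x : Half N V} (H : G.IsInner h)
    (hc : (G.face ^ period N h.2.2) h = h) (hx : G.face.SameCycle h x) :
    (G.face ^ period N x.2.2) x = x := by
  obtain ⟨m, rfl⟩ := hx.exists_nat_pow_eq
  rw [H.side, ← Perm.mul_apply, ← pow_add, add_comm, pow_add, Perm.mul_apply, hc]

omit [Finite V] in
/-- Each cycle contains the sector by which it is counted. For an internal cycle one reaches it from
the colour `i` in `-i` steps. -/
theorem IsInner.exists_key {h : Half N V} (H : G.IsInner h) :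
    ∃ v, G.face.SameCycle h (v, key (kind h.2)) := by
  obtain ⟨v, i, _ | _⟩ := h
  · exact ⟨v, Perm.SameCycle.refl _ _⟩
  · refine ⟨((G.face ^ (-i).val) (v, i, true)).1, ((-i).val : ℕ), ?_⟩
    have h1 := H.side (-i).val
    have h2 := H.color (-i).val
    rw [zpow_natCast]
    refine Prod.ext rfl (Prod.ext ?_ ?_)
    · rw [h2]; simp [kind, key]
    · rw [h1]; simp [kind, key]

/-- A petal cycle or internal cycle contains the sector by which it is counted only once. -/
theorem IsInner.key_unique {v v' : V} {o o' : Option (ZMod N)} (H : G.IsInner (v, key o))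
    (hc : (G.face ^ period N (key o).2) (v, key o) = (v, key o))
    (hs : G.face.SameCycle (v, key o) (v', key o')) : v = v' ∧ o = o' := by
  obtain ⟨m, hm⟩ := hs.exists_nat_pow_eq
  have h1 := H.side m
  have h2 := H.color m
  rw [hm] at h1 h2
  have hpow : ∀ k, (G.face ^ (period N (key o).2 * k)) (v, key o) = (v, key o) := by
    intro k
    induction k with
    | zero => rfl
    | succ k ih => rw [mul_add, mul_one, pow_add, Perm.mul_apply, hc, ih]
  rcases o with _ | i <;> rcases o' with _ | i' <;> simp [key, period] at h1 h2 hpow hm ⊢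
  · obtain ⟨k, rfl⟩ := (ZMod.natCast_eq_zero_iff m N).1 h2.symm
    rw [hpow] at hm
    simpa using hm
  · rw [hpow] at hm
    subst h2
    simpa using hm

/-- The degree of the weight is the number of cycles. -/
theorem degree_weight :
    G.weight.degree = Nat.card {x : Option (ZMod N) × V // G.IsInner (x.2, key x.1)} := by
  have := Fintype.ofFinite V
  rw [Finsupp.degree_eq_sum, Nat.card_eq_fintype_card, Fintype.card_subtype, Finset.card_filter,
    Fintype.sum_prod_type]
  refine Finset.sum_congr rfl fun o _ => ?_
  rw [weight_apply, Nat.card_eq_fintype_card, Fintype.card_subtype, Finset.card_filter]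

/-- The Euler inequality, for the cycles of a graph together with other faces. -/
theorem weight_euler_le [Nonempty V] (hc : ∀ u v, G.Conn u v)
    (hcyc : ∀ h, G.IsInner h → (G.face ^ period N h.2.2) h = h) {S : Type} [Fintype S]
    (g : S → Half N V) (hS : ∀ s, ¬ G.IsInner (g s))
    (hg : ∀ x y, G.face.SameCycle (g x) (g y) → x = y) :
    2 * (G.weight.degree + Fintype.card S) + 2 * Nat.card V ≤ Nat.card {h // ¬ G.IsLeaf h} + 4 := by
  have := Fintype.ofFinite V
  have := euler_le (G := G) hc
    (X := {x : Option (ZMod N) × V // G.IsInner (x.2, key x.1)} ⊕ S)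
    (Sum.elim (fun x => (x.1.2, key x.1.1)) g) (by
      rintro (⟨⟨o, v⟩, hx⟩ | s) (⟨⟨o', v'⟩, hy⟩ | s') hs
      · obtain ⟨rfl, rfl⟩ := IsInner.key_unique hx (hcyc _ hx) hs
        rfl
      · exact absurd (hx.of_sameCycle hs) (hS s')
      · exact absurd (hy.of_sameCycle hs.symm) (hS s)
      · rw [hg _ _ hs])
  rw [Fintype.card_sum, ← Nat.card_eq_fintype_card (α := {x : _ × _ // _}), ← degree_weight,
    ← Nat.card_eq_fintype_card (α := V)] at this
  exact this

/-- In an allowable graph all leaves lie on the single boundary circle. -/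
theorem Good.sameCycle (H : G.Good) {r : Half N V} (hr : G.IsLeaf r) {h : Half N V}
    (hh : ¬ G.IsInner h) : G.face.SameCycle r h := by
  by_contra hs
  have : Nonempty V := ⟨r.1⟩
  have := weight_euler_le H.connected H.cycle (S := Bool) (fun b => if b then r else h)
    (by rintro (_ | _); exacts [hh, not_isInner_of_isLeaf hr])
    (by
      rintro (_ | _) (_ | _) k
      · rfl
      · exact absurd (Perm.SameCycle.symm k) hs
      · exact absurd k hs
      · rfl)
  have h2 := H.planar
  rw [Fintype.card_bool] at this
  omega

theorem Good.exists_boundary (H : G.Good) {r : Half N V} (hr : G.IsLeaf r) :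
    ∃ L, G.Boundary r L :=
  Ribbon.exists_boundary hr fun _ hx => H.sameCycle hr (not_isInner_of_isLeaf hx)

/-! ### Gluing and allowable graphs -/

variable {e e' : Half N V} (J : G.Joinable e e')

theorem glue_card_not_isLeaf : Nat.card {h // ¬ (G.glue J).IsLeaf h} =
    Nat.card {h // ¬ G.IsLeaf h} + 2 := by
  have h1 : {h | ¬ (G.glue J).IsLeaf h} = insert e (insert e' {h | ¬ G.IsLeaf h}) := by
    ext h
    simp only [glue_isLeaf, Set.mem_ofPred_eq, Set.mem_insert_iff]
    tauto
  change Nat.card ({h | ¬ (G.glue J).IsLeaf h} : Set _) = Nat.card ({h | ¬ G.IsLeaf h} : Set _) + 2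
  rw [h1, Nat.card_coe_set_eq, Nat.card_coe_set_eq,
    Set.ncard_insert_of_notMem (by simp [J.ne, J.left]),
    Set.ncard_insert_of_notMem (by simp [J.right])]

omit [Finite V] [NeZero N] in
theorem glue_conn {u v : V} (H : G.Conn u v) : (G.glue J).Conn u v := by
  induction H with
  | refl => exact Conn.refl _
  | tail _ h ih =>
    obtain ⟨h, rfl, rfl⟩ := h
    refine ih.trans ?_
    by_cases h1 : h = e
    · rw [h1, show G.mate e = e from J.left]; exact Conn.refl _
    by_cases h2 : h = e'
    · rw [h2, show G.mate e' = e' from J.right]; exact Conn.refl _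
    rw [← glue_mate_of_ne J h1 h2]
    exact Conn.step h

omit [Finite V] [NeZero N] in
theorem conn_of_glue (h : G.Conn e.1 e'.1) {u v : V} (H : (G.glue J).Conn u v) : G.Conn u v := by
  induction H with
  | refl => exact Conn.refl _
  | tail _ k ih =>
    obtain ⟨k, rfl, rfl⟩ := k
    refine ih.trans ?_
    by_cases h1 : k = e
    · rw [h1, glue_mate_left]; exact h
    by_cases h2 : k = e'
    · rw [h2, glue_mate_right]; exact h.symm
    rw [glue_mate_of_ne J h1 h2]
    exact Conn.step k

omit [Finite V] [NeZero N] in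
theorem glue_conn_edge : (G.glue J).Conn e.1 e'.1 := by
  have := Conn.step (G := G.glue J) e
  rwa [glue_mate_left] at this

omit [Finite V] [NeZero N] in
/-- The cycles that do not pass through the new edge. -/
theorem glue_cycle {h : Half N V} (H : G.IsInner h) :
    (G.face ^ period N h.2.2) h = h ↔ ((G.glue J).face ^ period N h.2.2) h = h := by
  rw [glue_pow_of_forall J fun x hx =>
    ⟨fun h2 => H x hx (h2 ▸ J.left), fun h2 => H x hx (h2 ▸ J.right)⟩]

/-- Opening a face of the glued graph: the two sides of the new edge belong to one face before. -/
theorem sameCycle_of_glue (H : ¬ (G.glue J).face.SameCycle e e') : G.face.SameCycle e e' := by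
  have h0 : ∃ T, 0 < T ∧ ((G.glue J).face ^ T) e = e :=
    ⟨orderOf (G.glue J).face, orderOf_pos _, by simp [pow_orderOf_eq_one]⟩
  obtain ⟨T, ⟨hT, hTe⟩, hmin⟩ : ∃ T, (0 < T ∧ ((G.glue J).face ^ T) e = e) ∧
      ∀ m, m < T → ¬ (0 < m ∧ ((G.glue J).face ^ m) e = e) :=
    ⟨Nat.find h0, Nat.find_spec h0, fun m => Nat.find_min h0⟩
  obtain ⟨p, rfl⟩ : ∃ p, T = p + 1 := ⟨T - 1, by omega⟩
  have h1 : ((G.glue J).face ^ p) e = (G.face ^ p) e := glue_pow' J fun m h0 hm =>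
    ⟨fun h => hmin m (by omega) ⟨h0, h⟩, fun h => H ⟨m, by simpa using h⟩⟩
  rw [pow_succ', Perm.mul_apply, h1, glue_face, Perm.mul_apply, swap_apply_eq_iff,
    swap_apply_left] at hTe
  refine ⟨(p + 1 : ℕ), ?_⟩
  rw [zpow_natCast, pow_succ', Perm.mul_apply, hTe]

section cycle
/-! The new edge separates a cycle from the boundary. -/

variable (h1 : (G.glue J).IsInner e) (h2 : ((G.glue J).face ^ period N e.2.2) e = e)
  (h3 : ¬ (G.glue J).IsInner e')
include h3

theorem isInner_iff_of_cycle {h : Half N V} :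
    G.IsInner h ↔ (G.glue J).IsInner h ∧ ¬ (G.glue J).face.SameCycle h e := by
  rw [glue_isInner J]
  constructor
  · rintro ⟨a, b, _⟩; exact ⟨a, b⟩
  · rintro ⟨a, b⟩; exact ⟨a, b, fun c => h3 (a.of_sameCycle c)⟩

include h1 h2

/-- If one side of the new edge is a cycle and the other is not, then gluing adds this one cycle. -/
theorem glue_weight_of_cycle : (G.glue J).weight = G.weight + Finsupp.single (kind e.2) 1 := by
  obtain ⟨v₀, hv₀⟩ := h1.exists_key
  have hin := h1.of_sameCycle hv₀
  have hcy := h1.cycle_of_sameCycle h2 hv₀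
  ext o
  rw [Finsupp.add_apply, weight_apply, weight_apply]
  by_cases ho : kind e.2 = o
  · subst ho
    rw [Finsupp.single_eq_same]
    have h4 : {v | (G.glue J).IsInner (v, key (kind e.2))} =
        insert v₀ {v | G.IsInner (v, key (kind e.2))} := by
      ext v
      simp only [Set.mem_ofPred_eq, Set.mem_insert_iff, isInner_iff_of_cycle J h3]
      constructor
      · intro hv
        by_cases hs : (G.glue J).face.SameCycle (v, key (kind e.2)) e
        · exact Or.inl (hin.key_unique hcy (hs.trans hv₀).symm).1.symm
        · exact Or.inr ⟨hv, hs⟩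
      · rintro (rfl | hv)
        exacts [hin, hv.1]
    change Nat.card ({v | (G.glue J).IsInner (v, key (kind e.2))} : Set _) =
      Nat.card ({v | G.IsInner (v, key (kind e.2))} : Set _) + 1
    rw [h4, Nat.card_coe_set_eq, Nat.card_coe_set_eq, Set.ncard_insert_of_notMem]
    rw [Set.mem_ofPred_eq, isInner_iff_of_cycle J h3]
    exact fun h => h.2 hv₀.symm
  · rw [Finsupp.single_eq_of_ne (Ne.symm ho), add_zero]
    congr 2
    ext v
    rw [isInner_iff_of_cycle J h3]
    refine ⟨fun hv => ⟨hv, fun hs => ho ?_⟩, fun hv => hv.1⟩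
    exact (hin.key_unique hcy (hs.trans hv₀).symm).2

/-- Gluing adds one edge and one cycle, which does not change the Euler characteristic. -/
theorem Good.glue_of_cycle (H : G.Good) : (G.glue J).Good := by
  refine ⟨fun u v => glue_conn J (H.connected u v), fun h hh => ?_, ?_⟩
  · by_cases hs : (G.glue J).face.SameCycle h e
    · exact h1.cycle_of_sameCycle h2 hs.symm
    · have h4 : G.IsInner h := (isInner_iff_of_cycle J h3).2 ⟨hh, hs⟩
      exact (glue_cycle J h4).1 (H.cycle h h4)
  · rw [glue_card_not_isLeaf, glue_weight_of_cycle J h1 h2 h3, map_add, Finsupp.degree_single]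
    have := H.planar
    omega

/-- Cutting at a cycle keeps the graph connected, since both halves of the edge lie on the opened
face. -/
theorem Good.of_glue_of_cycle (H : (G.glue J).Good) : G.Good := by
  refine ⟨fun u v => ?_, fun h hh => ?_, ?_⟩
  · refine conn_of_glue J (conn_of_sameCycle (sameCycle_of_glue J fun hs => ?_)) (H.connected u v)
    exact h3 (h1.of_sameCycle hs)
  · exact (glue_cycle J hh).2 (H.cycle h ((isInner_iff_of_cycle J h3).1 hh).1)
  · have := H.planar
    rw [glue_card_not_isLeaf, glue_weight_of_cycle J h1 h2 h3, map_add,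
      Finsupp.degree_single] at this
    omega

end cycle

section boundary
/-! Both sides of the new edge lie on the boundary. -/

variable (h1 : ¬ (G.glue J).IsInner e) (h2 : ¬ (G.glue J).IsInner e')
include h1 h2

theorem isInner_iff_of_boundary {h : Half N V} : G.IsInner h ↔ (G.glue J).IsInner h := by
  rw [glue_isInner J]
  exact ⟨fun h => h.1, fun h => ⟨h, fun c => h1 (h.of_sameCycle c), fun c => h2 (h.of_sameCycle c)⟩⟩

theorem glue_weight_of_boundary : (G.glue J).weight = G.weight := by
  ext o
  simp only [weight_apply, isInner_iff_of_boundary J h1 h2]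

theorem glue_cycle_of_boundary : (∀ h, G.IsInner h → (G.face ^ period N h.2.2) h = h) ↔
    ∀ h, (G.glue J).IsInner h → ((G.glue J).face ^ period N h.2.2) h = h := by
  refine forall_congr' fun h => ?_
  rw [← isInner_iff_of_boundary J h1 h2]
  exact forall_congr' fun hh => glue_cycle J hh

end boundary
end

/-! ### Disjoint unions -/

section sum
variable {V₁ V₂ : Type} (G₁ : Ribbon N V₁) (G₂ : Ribbon N V₂)

/-- The disjoint union of two graphs. -/
def sum : Ribbon N (V₁ ⊕ V₂) where
  mate := (Equiv.sumProdDistrib V₁ V₂ _).symm.permCongr (Perm.sumCongr G₁.mate G₂.mate)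
  mate_mate := by rintro ⟨v | v, x⟩ <;> simp [Equiv.permCongr_apply, mate_mate]
  coherent := by
    rintro ⟨v | v, x⟩ hh
    · have := G₁.coherent (v, x) (fun e => hh (by simp [Equiv.permCongr_apply, e]))
      simpa [Equiv.permCongr_apply] using this
    · have := G₂.coherent (v, x) (fun e => hh (by simp [Equiv.permCongr_apply, e]))
      simpa [Equiv.permCongr_apply] using this

theorem isEmbedding_inl : IsEmbedding Sum.inl G₁ (G₁.sum G₂) :=
  ⟨Sum.inl_injective, fun h => by simp [sum, lift, Equiv.permCongr_apply]⟩

theorem isEmbedding_inr : IsEmbedding Sum.inr G₂ (G₁.sum G₂) :=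
  ⟨Sum.inr_injective, fun h => by simp [sum, lift, Equiv.permCongr_apply]⟩

theorem exists_lift (h : Half N (V₁ ⊕ V₂)) :
    (∃ x : Half N V₁, h = lift Sum.inl x) ∨ ∃ x : Half N V₂, h = lift Sum.inr x := by
  obtain ⟨v | v, x⟩ := h
  · exact Or.inl ⟨(v, x), rfl⟩
  · exact Or.inr ⟨(v, x), rfl⟩

variable {G₁ G₂}

theorem card_subtype_sum [Finite V₁] [Finite V₂] {p : V₁ ⊕ V₂ → Prop} :
    Nat.card {v // p v} = Nat.card {v // p (Sum.inl v)} + Nat.card {v // p (Sum.inr v)} := by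
  rw [← Nat.card_sum]
  exact Nat.card_congr (Equiv.subtypeSum)

theorem sum_weight [Finite V₁] [Finite V₂] [NeZero N] :
    (G₁.sum G₂).weight = G₁.weight + G₂.weight := by
  ext o
  rw [Finsupp.add_apply, weight_apply, weight_apply, weight_apply, card_subtype_sum]
  congr 3 <;> ext v
  · exact (isEmbedding_inl G₁ G₂).isInner (h := (v, key o))
  · exact (isEmbedding_inr G₁ G₂).isInner (h := (v, key o))

theorem sum_card_not_isLeaf [Finite V₁] [Finite V₂] [NeZero N] :
    Nat.card {h // ¬ (G₁.sum G₂).IsLeaf h} =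
      Nat.card {h // ¬ G₁.IsLeaf h} + Nat.card {h // ¬ G₂.IsLeaf h} := by
  rw [← Nat.card_congr ((Equiv.sumProdDistrib V₁ V₂ _).symm.subtypeEquiv
    (p := fun h => ¬ (G₁.sum G₂).IsLeaf ((Equiv.sumProdDistrib V₁ V₂ _).symm h)) fun _ => Iff.rfl),
    card_subtype_sum]
  congr 3 <;> ext v
  · exact not_congr (isEmbedding_inl G₁ G₂).isLeaf
  · exact not_congr (isEmbedding_inr G₁ G₂).isLeaf

theorem IsEmbedding.conn {V' : Type} {ι : V → V'} {G' : Ribbon N V'} (E : IsEmbedding ι G G')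
    {u v : V} (H : G.Conn u v) : G'.Conn (ι u) (ι v) := by
  induction H with
  | refl => exact Conn.refl _
  | tail _ k ih =>
    obtain ⟨k, rfl, rfl⟩ := k
    have := Conn.step (G := G') (lift ι k)
    rw [E.mate] at this
    exact ih.trans this

variable [Finite V₁] [Finite V₂] [NeZero N] {x₁ : Half N V₁} {x₂ : Half N V₂}
  (J : (G₁.sum G₂).Joinable (lift Sum.inl x₁) (lift Sum.inr x₂))
  (h1 : ¬ ((G₁.sum G₂).glue J).IsInner (lift Sum.inl x₁))
  (h2 : ¬ ((G₁.sum G₂).glue J).IsInner (lift Sum.inr x₂))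
include h1 h2

theorem glue_weight_of_sum : ((G₁.sum G₂).glue J).weight = G₁.weight + G₂.weight := by
  rw [glue_weight_of_boundary J h1 h2, sum_weight]

theorem cycle_of_sum : (∀ h, ((G₁.sum G₂).glue J).IsInner h →
      (((G₁.sum G₂).glue J).face ^ period N h.2.2) h = h) ↔
    (∀ h, G₁.IsInner h → (G₁.face ^ period N h.2.2) h = h) ∧
      ∀ h, G₂.IsInner h → (G₂.face ^ period N h.2.2) h = h := by
  rw [← glue_cycle_of_boundary J h1 h2]
  constructor
  · intro H
    constructor
    · intro h hh
      have := H (lift Sum.inl h) ((isEmbedding_inl G₁ G₂).isInner.2 hh)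
      rw [(isEmbedding_inl G₁ G₂).face_pow] at this
      exact lift_injective Sum.inl_injective this
    · intro h hh
      have := H (lift Sum.inr h) ((isEmbedding_inr G₁ G₂).isInner.2 hh)
      rw [(isEmbedding_inr G₁ G₂).face_pow] at this
      exact lift_injective Sum.inr_injective this
  · rintro ⟨H1, H2⟩ h hh
    rcases exists_lift h with ⟨x, rfl⟩ | ⟨x, rfl⟩
    · rw [(isEmbedding_inl G₁ G₂).face_pow, lift_snd,
        H1 x ((isEmbedding_inl G₁ G₂).isInner.1 hh)]
    · rw [(isEmbedding_inr G₁ G₂).face_pow, lift_snd,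
        H2 x ((isEmbedding_inr G₁ G₂).isInner.1 hh)]

theorem Good.glue_sum (H₁ : G₁.Good) (H₂ : G₂.Good) : ((G₁.sum G₂).glue J).Good := by
  have hl : ∀ v, ((G₁.sum G₂).glue J).Conn (Sum.inl x₁.1) (Sum.inl v) := fun v =>
    glue_conn J ((isEmbedding_inl G₁ G₂).conn (H₁.connected _ _))
  have hr : ∀ v, ((G₁.sum G₂).glue J).Conn (Sum.inr x₂.1) (Sum.inr v) := fun v =>
    glue_conn J ((isEmbedding_inr G₁ G₂).conn (H₂.connected _ _))
  have hlr : ((G₁.sum G₂).glue J).Conn (Sum.inl x₁.1) (Sum.inr x₂.1) := glue_conn_edge J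
  have hall : ∀ v, ((G₁.sum G₂).glue J).Conn (Sum.inl x₁.1) v := by
    rintro (v | v)
    exacts [hl v, hlr.trans (hr v)]
  refine ⟨fun u v => (hall u).symm.trans (hall v),
    (cycle_of_sum J h1 h2).2 ⟨H₁.cycle, H₂.cycle⟩, ?_⟩
  rw [glue_weight_of_sum J h1 h2, glue_card_not_isLeaf, sum_card_not_isLeaf, Nat.card_sum, map_add]
  have := H₁.planar
  have := H₂.planar
  omega

/-- If cutting an edge gives two connected graphs, both are allowable, by the Euler inequality. -/
theorem Good.of_glue_sum (H : ((G₁.sum G₂).glue J).Good) (c₁ : ∀ u v, G₁.Conn u v)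
    (c₂ : ∀ u v, G₂.Conn u v) : G₁.Good ∧ G₂.Good := by
  obtain ⟨k1, k2⟩ := (cycle_of_sum J h1 h2).1 H.cycle
  have hp := H.planar
  rw [glue_weight_of_sum J h1 h2, glue_card_not_isLeaf, sum_card_not_isLeaf, Nat.card_sum,
    map_add] at hp
  have l1 : G₁.IsLeaf x₁ := (isEmbedding_inl G₁ G₂).isLeaf.1 J.left
  have l2 : G₂.IsLeaf x₂ := (isEmbedding_inr G₁ G₂).isLeaf.1 J.right
  have : Nonempty V₁ := ⟨x₁.1⟩
  have : Nonempty V₂ := ⟨x₂.1⟩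
  have e1 := weight_euler_le c₁ k1 (S := Unit) (fun _ => x₁)
    (fun _ => not_isInner_of_isLeaf l1) (fun _ _ _ => rfl)
  have e2 := weight_euler_le c₂ k2 (S := Unit) (fun _ => x₂)
    (fun _ => not_isInner_of_isLeaf l2) (fun _ _ _ => rfl)
  rw [Fintype.card_unit] at e1 e2
  exact ⟨⟨c₁, k1, by omega⟩, ⟨c₂, k2, by omega⟩⟩

end sum
end Ribbon

end

/-! ### Products of chords -/

section

namespace Chord
variable {N : ℕ}

/-- The chord that goes once around a puncture, is based at the end of `a`, and is of the other type
than `a`: a single petal, or a product of `N` short chords. -/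
def loop (a : Chord N) : Chord N :=
  if a.isCentral then petal a.target 0 else central a.target (N - 1)

/-- The weight of the cycle that is labelled by `a.loop`. -/
def loopKind (a : Chord N) : Option (ZMod N) := if a.isCentral then some a.target else none

theorem mul_eq_some {a b c : Chord N} (ha : a.Nontrivial) (hb : b.Nontrivial)
    (h : a.mul b = some c) : a.target = b.source ∧ b.isCentral = a.isCentral ∧ c.Nontrivial ∧
      c.isCentral = a.isCentral ∧ c.source = a.source ∧ c.target = b.target := by
  rcases a with i | ⟨i, k⟩ | ⟨i, k⟩
  · exact ha.elim
  · rcases b with j | ⟨j, l⟩ | ⟨j, l⟩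
    · exact hb.elim
    · simp only [mul, Option.ite_none_right_eq_some, Option.some.injEq] at h
      obtain ⟨rfl, rfl⟩ := h
      exact ⟨rfl, rfl, trivial, rfl, rfl, rfl⟩
    · simp [mul] at h
  · rcases b with j | ⟨j, l⟩ | ⟨j, l⟩
    · exact hb.elim
    · simp [mul] at h
    · simp only [mul, Option.ite_none_right_eq_some, Option.some.injEq] at h
      obtain ⟨rfl, rfl⟩ := h
      refine ⟨rfl, rfl, trivial, rfl, rfl, ?_⟩
      simp only [target]; push_cast; ring

end Chord

namespace Ribbon

variable {N : ℕ} {V : Type} {G : Ribbon N V}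

theorem Arc.exists_le_of_sameCycle [Finite V] [NeZero N] {e x : Half N V} {q : ℕ}
    (H : G.Arc e q e) (hx : G.face.SameCycle e x) : ∃ m ≤ q, x = (G.face ^ m) e := by
  obtain ⟨n, rfl⟩ := hx.exists_nat_pow_eq
  have : ∀ k, ((G.face ^ (q + 1)) ^ k) e = e := by
    intro k
    induction k with
    | zero => rfl
    | succ k ih => rw [pow_succ, Perm.mul_apply, H.2, ih]
  refine ⟨n % (q + 1), Nat.lt_succ_iff.1 (Nat.mod_lt _ (by omega)), ?_⟩
  conv_lhs => rw [← Nat.mod_add_div n (q + 1), pow_add, Perm.mul_apply, pow_mul, this]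

/-- A region labelled by `a.loop` goes exactly once around a puncture, and the weight of the cycle
that arises if it is closed up is `a.loopKind`. -/
theorem lab_eq_loop [NeZero N] {e : Half N V} {q : ℕ} {a : Chord N} (h : a.loop = lab e q) :
    e.2 = (a.target, !a.isCentral) ∧ q + 1 = period N e.2.2 ∧ kind e.2 = a.loopKind := by
  obtain ⟨v, i, b⟩ := e
  have hN := NeZero.pos N
  unfold Chord.loop lab at h
  unfold Chord.loopKind kind period
  cases hc : a.isCentral <;> cases b <;> simp [hc] at h ⊢
  · exact ⟨h.1.symm, by omega⟩
  · exact ⟨h.1.symm, h.2.symm, h.1.symm⟩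

theorem loop_eq_lab [NeZero N] {e : Half N V} {q : ℕ} {a : Chord N}
    (h : e.2 = (a.target, !a.isCentral)) (hq : q + 1 = period N e.2.2) : a.loop = lab e q := by
  obtain ⟨v, i, b⟩ := e
  have hN := NeZero.pos N
  simp only [Prod.mk.injEq] at h
  obtain ⟨rfl, rfl⟩ := h
  unfold period at hq
  unfold Chord.loop lab
  cases hc : a.isCentral <;> simp [hc] at hq ⊢ <;> omega

section
variable [Finite V] [NeZero N]

/-- Gluing the two leaves next to a region which goes once around a puncture: the region closes up
to a cycle, and the regions before and after it, labelled `a₁` and `a₂`, are joined to one. -/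
theorem Boundary.glue_loop {r e e' : Half N V} {a₁ a₂ b : Chord N} {L : List (Half N V × Chord N)}
    (H : G.Boundary r ((r, a₁) :: (e, a₁.loop) :: (e', a₂) :: L)) (hb : a₁.mul a₂ = some b) :
    ∃ J : G.Joinable e e', (G.glue J).IsInner e ∧
      ((G.glue J).face ^ period N e.2.2) e = e ∧ ¬ (G.glue J).IsInner e' ∧
      kind e.2 = a₁.loopKind ∧ (G.glue J).Boundary r ((r, b) :: L) ∧
      ∃ p, a₁ = lab r p ∧ (G.glue J).Arc r p e' := by
  have hle : G.IsLeaf e := (H.isLeaf_iff e).2 (by simp)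
  have hle' : G.IsLeaf e' := (H.isLeaf_iff e').2 (by simp)
  have hnd := H.nodup
  obtain ⟨-, p, h1, A1, ha1, hh, q, h2, A2, ha2, W⟩ := H.walk
  subst hh
  obtain rfl := W.head
  obtain ⟨f1, f2, f3⟩ := lab_eq_loop ha2
  have J : G.Joinable e e' := by
    refine ⟨hle, hle', ?_, A2.side_leaf hle'⟩
    rw [A2.color, ← ha2]
    rw [f1]
    have hN := NeZero.pos N
    unfold Chord.loop
    split_ifs <;> simp [Chord.target, Nat.sub_add_cancel hN]
  simp only [List.map_cons, List.nodup_cons, List.mem_cons, not_or] at hnd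
  obtain ⟨⟨n1, n2, n3⟩, ⟨n4, n5⟩, n6, n7⟩ := hnd
  have A1' := A1.glue_left J
  have A2' := A2.glue_right J
  have W' := W.glue_of_ne J (by simp) (by
    intro z hz
    simp only [List.tail_cons] at hz
    exact ⟨fun h => n5 (h ▸ hz), fun h => n6 (h ▸ hz)⟩) n1 n2
  have lr : (G.glue J).IsLeaf r := (glue_isLeaf J).2 ⟨H.root_isLeaf, n1, n2⟩
  have le : ¬ (G.glue J).IsLeaf e := fun h => ((glue_isLeaf J).1 h).2.1 rfl
  have le' : ¬ (G.glue J).IsLeaf e' := fun h => ((glue_isLeaf J).1 h).2.2 rfl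
  refine ⟨J, fun x hx => ?_, by rw [← f2]; exact A2'.2, fun h => h r W'.sameCycle.1 lr, f3, ?_,
    p, ha1, A1'⟩
  · obtain ⟨m, hm, rfl⟩ := A2'.exists_le_of_sameCycle hx
    rcases Nat.eq_zero_or_pos m with rfl | h0
    · exact le
    · exact A2'.1 m h0 hm
  · have W2 : (G.glue J).Walk r ([] ++ (r, a₁) :: (e', a₂) :: L) r := ⟨rfl, p, e', A1', ha1, W'⟩
    obtain ⟨c, hc, W3⟩ := W2.merge le'
    obtain rfl : c = b := by simpa [hc] using hb
    refine ⟨W3, by simp, ?_, fun x => ?_⟩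
    · simp only [List.map_cons, List.nodup_cons]
      exact ⟨n3, n7⟩
    · rw [glue_isLeaf, H.isLeaf_iff]
      simp only [List.map_cons, List.mem_cons]
      constructor
      · rintro ⟨h1 | h1 | h1 | h1, h2, h3⟩
        exacts [Or.inl h1, absurd h1 h2, absurd h1 h3, Or.inr h1]
      · rintro (rfl | h1)
        · exact ⟨Or.inl rfl, n1, n2⟩
        · exact ⟨Or.inr (Or.inr (Or.inr h1)), fun h => n5 (h ▸ h1), fun h => n6 (h ▸ h1)⟩

end

section sum
variable {V₁ V₂ : Type} [Finite V₁] [Finite V₂] [NeZero N] {G₁ : Ribbon N V₁} {G₂ : Ribbon N V₂}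

omit [Finite V₁] [Finite V₂] [NeZero N] in
/-- Joining two graphs at the leaves `x₁` and `x₂`. The boundary circle of the first graph, read
from `x₁`, is inserted into that of the second at `x₂`: the regions `a₁` and `a₂` before and after
the insertion point merge to `b`, and at its end `c'` and `c''` merge to `c`. -/
theorem Boundary.glue_sum {x₁ y : Half N V₁} {r x₂ : Half N V₂} {a₁ a₂ b c c' c'' : Chord N}
    {L₁ : List (Half N V₁ × Chord N)} {L₂ : List (Half N V₂ × Chord N)}
    (H₁ : G₁.Boundary x₁ ((x₁, a₂) :: L₁ ++ [(y, c')]))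
    (H₂ : G₂.Boundary r ((r, a₁) :: (x₂, c'') :: L₂))
    (ha₁ : a₁.Nontrivial) (ha₂ : a₂.Nontrivial)
    (hb : a₁.mul a₂ = some b) (hc : c'.mul c'' = some c) :
    ∃ J : (G₁.sum G₂).Joinable (lift Sum.inl x₁) (lift Sum.inr x₂),
      ¬ ((G₁.sum G₂).glue J).IsInner (lift Sum.inl x₁) ∧
      ¬ ((G₁.sum G₂).glue J).IsInner (lift Sum.inr x₂) ∧
      ((G₁.sum G₂).glue J).Boundary (lift Sum.inr r) ((lift Sum.inr r, b) ::
        L₁.map (Prod.map (lift Sum.inl) id) ++ (lift Sum.inl y, c) ::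
        L₂.map (Prod.map (lift Sum.inr) id)) ∧
      ∃ p, a₁ = lab r p ∧ ((G₁.sum G₂).glue J).Arc (lift Sum.inr r) p (lift Sum.inl x₁) := by
  have E₁ := isEmbedding_inl G₁ G₂
  have E₂ := isEmbedding_inr G₁ G₂
  have l1 : (G₁.sum G₂).IsLeaf (lift Sum.inl x₁) := E₁.isLeaf.2 H₁.root_isLeaf
  have l2' : G₂.IsLeaf x₂ := (H₂.isLeaf_iff x₂).2 (by simp)
  have l2 : (G₁.sum G₂).IsLeaf (lift Sum.inr x₂) := E₂.isLeaf.2 l2'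
  have hlr : ∀ u v, (lift Sum.inl u : Half N (V₁ ⊕ V₂)) ≠ lift Sum.inr v := by
    intro u v h
    simpa [lift] using congrArg Prod.fst h
  have hrl : ∀ u v, (lift Sum.inr u : Half N (V₁ ⊕ V₂)) ≠ lift Sum.inl v :=
    fun u v h => hlr _ _ h.symm
  have hll : ∀ {u v}, (lift Sum.inl u : Half N (V₁ ⊕ V₂)) = lift Sum.inl v → u = v :=
    fun h => lift_injective Sum.inl_injective h
  have hrr : ∀ {u v}, (lift Sum.inr u : Half N (V₁ ⊕ V₂)) = lift Sum.inr v → u = v :=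
    fun h => lift_injective Sum.inr_injective h
  obtain ⟨m1, m2, -⟩ := Chord.mul_eq_some ha₁ ha₂ hb
  have nd1 := H₁.nodup
  have nd2 := H₂.nodup
  obtain ⟨-, p, h1, A1, ha1, W2⟩ := H₂.walk
  obtain rfl := W2.head
  have W1 := H₁.walk
  have hx1 : x₁.2 = (a₁.target, a₁.isCentral) := by
    obtain ⟨-, q, -, -, ha2, -⟩ := W1
    rw [m1, ← m2, ha2, lab_source, lab_isCentral]
  have J : (G₁.sum G₂).Joinable (lift Sum.inl x₁) (lift Sum.inr x₂) := by
    refine ⟨l1, l2, ?_, ?_⟩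
    · rw [lift_snd, lift_snd, hx1, A1.color, ← ha1]
    · rw [lift_snd, lift_snd, hx1, A1.side_leaf l2', ha1, lab_isCentral]
  simp only [List.map_cons, List.nodup_cons, List.mem_cons, not_or] at nd2
  obtain ⟨⟨n1, n2⟩, n3, n4⟩ := nd2
  simp only [List.cons_append, List.map_cons, List.nodup_cons] at nd1
  obtain ⟨n5, n6⟩ := nd1
  have A1' := (E₂.arc A1).glue_right J
  have W1' := (E₁.walk W1).glue_left J (by simp) (by
    intro z hz
    simp only [List.cons_append, List.map_cons, List.tail_cons] at hz
    rw [map_fst_lift, List.mem_map] at hz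
    obtain ⟨u, hu, rfl⟩ := hz
    exact ⟨fun h => n5 (hll h ▸ hu), hlr _ _⟩)
  have W2' := (E₂.walk W2).glue_of_ne J (by simp) (by
    intro z hz
    simp only [List.map_cons, List.tail_cons] at hz
    rw [map_fst_lift, List.mem_map] at hz
    obtain ⟨u, hu, rfl⟩ := hz
    exact ⟨hrl _ _, fun h => n3 (hrr h ▸ hu)⟩) (hrl _ _) (fun h => n1 (hrr h))
  have lr : ((G₁.sum G₂).glue J).IsLeaf (lift Sum.inr r) :=
    (glue_isLeaf J).2 ⟨E₂.isLeaf.2 H₂.root_isLeaf, hrl _ _, fun h => n1 (hrr h)⟩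
  have le1 : ¬ ((G₁.sum G₂).glue J).IsLeaf (lift Sum.inl x₁) :=
    fun h => ((glue_isLeaf J).1 h).2.1 rfl
  have le2 : ¬ ((G₁.sum G₂).glue J).IsLeaf (lift Sum.inr x₂) :=
    fun h => ((glue_isLeaf J).1 h).2.2 rfl
  have s2 := W2'.sameCycle.1
  have s1 := W1'.sameCycle.1.trans s2
  refine ⟨J, fun h => h _ s1 lr, fun h => h _ s2 lr, ?_, p, ha1, A1'⟩
  have W3 : ((G₁.sum G₂).glue J).Walk (lift Sum.inr r) ([] ++ (lift Sum.inr r, a₁) ::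
      (lift Sum.inl x₁, a₂) :: (L₁.map (Prod.map (lift Sum.inl) id) ++ (lift Sum.inl y, c') ::
        (lift Sum.inr x₂, c'') :: L₂.map (Prod.map (lift Sum.inr) id))) (lift Sum.inr r) := by
    refine ⟨rfl, p, _, A1', ha1, ?_⟩
    have := walk_append.2 ⟨_, W1', W2'⟩
    simpa using this
  -- On the concatenation of the two walks `x₁` and `x₂` are no leaves any more, so the regions
  -- that meet there merge, first at `x₁` and then at `x₂`.
  obtain ⟨b', hb', W4⟩ := W3.merge le1
  obtain rfl : b' = b := by simpa [hb'] using hb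
  have W5 : ((G₁.sum G₂).glue J).Walk (lift Sum.inr r) (((lift Sum.inr r, b') ::
      L₁.map (Prod.map (lift Sum.inl) id)) ++ (lift Sum.inl y, c') ::
        (lift Sum.inr x₂, c'') :: L₂.map (Prod.map (lift Sum.inr) id)) (lift Sum.inr r) := by
    simpa using W4
  obtain ⟨d, hd, W6⟩ := W5.merge le2
  obtain rfl : d = c := by simpa [hd] using hc
  refine ⟨W6, by simp, ?_, fun x => ?_⟩
  · rw [List.cons_append, List.map_cons, List.map_append, List.map_cons, map_fst_lift,
      map_fst_lift]
    simp only [List.map_append, List.map_cons, List.map_nil, List.nodup_append] at n6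
    rw [List.nodup_cons, List.nodup_append, List.nodup_cons]
    refine ⟨?_, n6.1.map (lift_injective Sum.inl_injective), ⟨?_, n4.map
      (lift_injective Sum.inr_injective)⟩, ?_⟩
    · simp only [List.mem_append, List.mem_map, List.mem_cons]
      rintro (⟨u, _, h⟩ | h | ⟨u, hu, h⟩)
      · exact hlr _ _ h
      · exact hrl _ _ h
      · obtain rfl := hrr h
        exact n2 (List.mem_map.2 hu)
    · rw [List.mem_map]
      rintro ⟨u, _, h⟩
      exact hrl _ _ h
    · intro u hu v hv
      rw [List.mem_map] at hu
      obtain ⟨u, hu, rfl⟩ := hu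
      rw [List.mem_cons, List.mem_map] at hv
      rcases hv with rfl | ⟨v, _, rfl⟩
      · intro h
        exact n6.2.2 u hu y (by simp) (hll h)
      · exact hlr _ _
  · rw [glue_isLeaf]
    rw [List.cons_append, List.map_cons, List.map_append, List.map_cons, map_fst_lift,
      map_fst_lift]
    simp only [List.map_append, List.map_cons, List.map_nil, List.mem_append,
      List.mem_singleton, not_or] at n5
    rcases exists_lift x with ⟨u, rfl⟩ | ⟨u, rfl⟩
    · rw [E₁.isLeaf, H₁.isLeaf_iff]
      simp only [List.cons_append, List.map_append, List.map_cons, List.map_nil, List.mem_append,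
        List.mem_cons, List.not_mem_nil, or_false,
        List.mem_map_of_injective (lift_injective Sum.inl_injective), hlr, false_or]
      have h3 : lift Sum.inl u ∉
          List.map (lift (V' := V₁ ⊕ V₂) Sum.inr) (List.map Prod.fst L₂) := by
        rw [List.mem_map]; rintro ⟨v, _, h⟩; exact hrl _ _ h
      have h4 : (lift Sum.inl u : Half N (V₁ ⊕ V₂)) = lift Sum.inl y ↔ u = y :=
        ⟨hll, fun h => h ▸ rfl⟩
      have h5 : (lift Sum.inl u : Half N (V₁ ⊕ V₂)) = lift Sum.inl x₁ ↔ u = x₁ :=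
        ⟨hll, fun h => h ▸ rfl⟩
      simp only [h3, h4, h5, or_false, ne_eq]
      constructor
      · rintro ⟨h1 | h1 | h1, h2, -⟩
        exacts [absurd h1 h2, Or.inl h1, Or.inr h1]
      · rintro (h1 | rfl)
        · exact ⟨Or.inr (Or.inl h1), fun h => n5.1 (h ▸ h1), hlr _ _⟩
        · exact ⟨Or.inr (Or.inr rfl), fun h => n5.2 h.symm, hlr _ _⟩
    · rw [E₂.isLeaf, H₂.isLeaf_iff]
      simp only [List.map_cons, List.mem_cons, List.mem_append,
        List.mem_map_of_injective (lift_injective Sum.inr_injective), hrl, false_or]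
      have h3 : lift Sum.inr u ∉
          List.map (lift (V' := V₁ ⊕ V₂) Sum.inl) (List.map Prod.fst L₁) := by
        rw [List.mem_map]; rintro ⟨v, _, h⟩; exact hlr _ _ h
      have h4 : (lift Sum.inr u : Half N (V₁ ⊕ V₂)) = lift Sum.inr r ↔ u = r :=
        ⟨hrr, fun h => h ▸ rfl⟩
      have h5 : (lift Sum.inr u : Half N (V₁ ⊕ V₂)) = lift Sum.inr x₂ ↔ u = x₂ :=
        ⟨hrr, fun h => h ▸ rfl⟩
      simp only [h3, h4, h5, false_or, ne_eq]
      constructor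
      · rintro ⟨h1 | h1 | h1, -, h2⟩
        exacts [Or.inl h1, absurd h1 h2, Or.inr h1]
      · rintro (rfl | h1)
        · exact ⟨Or.inl rfl, hrl _ _, n1⟩
        · exact ⟨Or.inr (Or.inr h1), hrl _ _, fun h => n3 (h ▸ h1)⟩

end sum
end Ribbon

end

/-! ### Cutting a graph at an internal edge -/

section

namespace Chord
variable {N : ℕ}

theorem mul_left_cancel {a b b' c : Chord N} (ha : a.Nontrivial) (hb : b.Nontrivial)
    (hb' : b'.Nontrivial) (h : a.mul b = some c) (h' : a.mul b' = some c) : b = b' := by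
  rcases a with i | ⟨i, k⟩ | ⟨i, k⟩
  · exact ha.elim
  all_goals
    rcases b with j | ⟨j, l⟩ | ⟨j, l⟩ <;> rcases b' with j' | ⟨j', l'⟩ | ⟨j', l'⟩ <;>
      simp [mul, Nontrivial] at h h' hb hb'
    obtain ⟨rfl, rfl⟩ := h
    obtain ⟨rfl, h⟩ := h'
    simp only [petal.injEq, central.injEq, true_and] at h ⊢
    omega

end Chord

namespace Ribbon

variable {N : ℕ} {V : Type} {G : Ribbon N V}

/-- A factorization of the label of a region is given by a position inside the region. -/
theorem lab_eq_mul {r : Half N V} {p : ℕ} {a₁ a₂ : Chord N} (ha₁ : a₁.Nontrivial)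
    (ha₂ : a₂.Nontrivial) (h : a₁.mul a₂ = some (lab r p)) :
    ∃ p₁ p₂, p = p₁ + p₂ + 1 ∧ a₁ = lab r p₁ := by
  obtain ⟨v, i, b⟩ := r
  rcases a₁ with j | ⟨j, k⟩ | ⟨j, k⟩
  · exact ha₁.elim
  all_goals
    rcases a₂ with j' | ⟨j', l⟩ | ⟨j', l⟩ <;> cases b <;>
      simp [Chord.mul, Chord.Nontrivial, lab] at h ha₂ ⊢
    obtain ⟨-, rfl, rfl⟩ := h
    exact ⟨⟨l, rfl⟩, rfl⟩

/-- The first region on the boundary ends at the first leaf. -/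
theorem Boundary.head_arc {r e x : Half N V} {a : Chord N} {L : List (Half N V × Chord N)} {p : ℕ}
    (H : G.Boundary r ((x, a) :: L)) (A : G.Arc r p e) (he : G.IsLeaf e) (hr : e ≠ r) :
    a = lab r p ∧ ∃ y L', L = (e, y) :: L' := by
  obtain ⟨rfl, q, h1, A1, rfl, W⟩ := H.walk
  rcases L with _ | ⟨⟨z, y⟩, L⟩
  · cases W
    exact absurd (A.unique A1 he H.root_isLeaf).2 hr
  · obtain rfl := W.head
    obtain ⟨rfl, rfl⟩ := A.unique A1 he ((H.isLeaf_iff z).2 (by simp))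
    exact ⟨rfl, y, L, rfl⟩

theorem Joinable.symm {e e' : Half N V} (J : G.Joinable e e') : G.Joinable e' e :=
  ⟨J.right, J.left, J.color.symm, by simp [J.side]⟩

theorem glue_symm {e e' : Half N V} (J : G.Joinable e e') : G.glue J = G.glue J.symm :=
  ext fun x => by simp [glue, swap_comm]

theorem IsEmbedding.joinable {V' : Type} {ι : V → V'} {G' : Ribbon N V'} (E : IsEmbedding ι G G')
    {e e' : Half N V} (J : G'.Joinable (lift ι e) (lift ι e')) : G.Joinable e e' :=
  ⟨E.isLeaf.1 J.left, E.isLeaf.1 J.right, J.color, J.side⟩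

theorem IsEmbedding.glue {V' : Type} {ι : V → V'} {G' : Ribbon N V'} (E : IsEmbedding ι G G')
    {e e' : Half N V} (J : G.Joinable e e') (J' : G'.Joinable (lift ι e) (lift ι e')) :
    IsEmbedding ι (G.glue J) (G'.glue J') := by
  refine ⟨E.injective, fun h => ?_⟩
  by_cases h1 : h = e
  · rw [h1, glue_mate_left, glue_mate_left]
  by_cases h2 : h = e'
  · rw [h2, glue_mate_right, glue_mate_right]
  rw [glue_mate_of_ne J h1 h2, glue_mate_of_ne J' ((lift_injective E.injective).ne h1)
    ((lift_injective E.injective).ne h2), E.mate]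

theorem IsEmbedding.of_glue {V' : Type} {ι : V → V'} {G' : Ribbon N V'}
    {e e' : Half N V} (J : G.Joinable e e') (J' : G'.Joinable (lift ι e) (lift ι e'))
    (E : IsEmbedding ι (G.glue J) (G'.glue J')) : IsEmbedding ι G G' := by
  refine ⟨E.injective, fun h => ?_⟩
  by_cases h1 : h = e
  · rw [h1, show G.mate e = e from J.left]; exact J'.left
  by_cases h2 : h = e'
  · rw [h2, show G.mate e' = e' from J.right]; exact J'.right
  rw [← glue_mate_of_ne J h1 h2, ← glue_mate_of_ne J' ((lift_injective E.injective).ne h1)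
    ((lift_injective E.injective).ne h2), E.mate]

theorem IsEmbedding.arc_iff {V' : Type} {ι : V → V'} {G' : Ribbon N V'} (E : IsEmbedding ι G G')
    {h x : Half N V} {p : ℕ} : G'.Arc (lift ι h) p (lift ι x) ↔ G.Arc h p x := by
  refine ⟨fun H => ⟨fun m h0 hm hl => ?_, ?_⟩, E.arc⟩
  · refine H.1 m h0 hm ?_
    rw [E.face_pow]; exact E.isLeaf.2 hl
  · have := H.2
    rw [E.face_pow] at this
    exact lift_injective E.injective this

section
variable {V' : Type} {σ : V ≃ V'} {G' : Ribbon N V'} (E : IsEmbedding σ G G')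
include E

theorem IsEmbedding.weight_eq [NeZero N] : G'.weight = G.weight := by
  ext o
  rw [weight_apply, weight_apply]
  exact (Nat.card_congr (σ.subtypeEquiv fun v => (E.isInner (h := (v, key o))).symm)).symm

theorem Good.map_iso [NeZero N] (H : G.Good) : G'.Good := by
  have hs : ∀ h : Half N V', ∃ x, h = lift σ x := fun h => ⟨(σ.symm h.1, h.2), by simp [lift]⟩
  refine ⟨fun u v => ?_, fun h hh => ?_, ?_⟩
  · have := E.conn (H.connected (σ.symm u) (σ.symm v))
    simpa using this
  · obtain ⟨x, rfl⟩ := hs h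
    rw [E.face_pow, lift_snd, H.cycle x (E.isInner.1 hh)]
  · rw [E.weight_eq, ← Nat.card_congr σ, H.planar]
    congr 1
    exact Nat.card_congr ((σ.prodCongr (Equiv.refl _)).subtypeEquiv fun h =>
      (not_congr (E.isLeaf (h := h))).symm)

end

/-- A union of components of a graph. -/
def restrict (G : Ribbon N V) (P : V → Prop) (hP : ∀ h : Half N V, P h.1 → P (G.mate h).1) :
    Ribbon N {v // P v} where
  mate :=
    { toFun := fun h => (⟨(G.mate (h.1.1, h.2)).1, hP _ h.1.2⟩, (G.mate (h.1.1, h.2)).2)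
      invFun := fun h => (⟨(G.mate (h.1.1, h.2)).1, hP _ h.1.2⟩, (G.mate (h.1.1, h.2)).2)
      left_inv := fun h => by simp [G.mate_mate]
      right_inv := fun h => by simp [G.mate_mate] }
  mate_mate h := by simp [G.mate_mate]
  coherent h hh := by
    refine G.coherent (h.1.1, h.2) fun e => hh ?_
    simp [e]

theorem isEmbedding_restrict (P : V → Prop) (hP : ∀ h : Half N V, P h.1 → P (G.mate h).1) :
    IsEmbedding Subtype.val (G.restrict P hP) G :=
  ⟨Subtype.val_injective, fun _ => rfl⟩

theorem restrict_conn {P : V → Prop} {hP : ∀ h : Half N V, P h.1 → P (G.mate h).1} {u v : V}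
    (H : G.Conn u v) (hu : P u) : ∃ hv, (G.restrict P hP).Conn ⟨u, hu⟩ ⟨v, hv⟩ := by
  induction H with
  | refl => exact ⟨hu, Conn.refl _⟩
  | tail _ k ih =>
    obtain ⟨k, rfl, rfl⟩ := k
    obtain ⟨hv, ih⟩ := ih
    exact ⟨hP _ hv, ih.trans (Conn.step (G := G.restrict P hP) (⟨k.1, hv⟩, k.2))⟩

theorem isEmbedding_sumCompl (P : V → Prop) (hP : ∀ h : Half N V, P h.1 → P (G.mate h).1)
    (hP' : ∀ h : Half N V, ¬ P h.1 → ¬ P (G.mate h).1) :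
    IsEmbedding (Equiv.sumCompl P) ((G.restrict P hP).sum (G.restrict (fun v => ¬ P v) hP')) G := by
  refine ⟨(Equiv.sumCompl P).injective, fun h => ?_⟩
  rcases exists_lift h with ⟨x, rfl⟩ | ⟨x, rfl⟩
  · rw [(isEmbedding_inl _ _).mate]; rfl
  · rw [(isEmbedding_inr _ _).mate]; rfl

section
variable [Finite V] [NeZero N] {e e' : Half N V} (J : G.Joinable e e')

/-- Closing an edge both sides of which lie on one face cycle comes from two different cycles. -/
theorem not_sameCycle_of_glue (H : (G.glue J).face.SameCycle e' e) : ¬ G.face.SameCycle e' e := by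
  -- From `e'` to the first passage `e` the face is the same before gluing, except that then it
  -- closes up at `e'`. So this is the whole cycle of `e'` before gluing, and `e` is not on it.
  have hne := J.ne
  have h0 : ∃ a, ((G.glue J).face ^ a) e' = e := H.exists_nat_pow_eq
  obtain ⟨a, ha, hmin⟩ : ∃ a, ((G.glue J).face ^ a) e' = e ∧
      ∀ m, m < a → ¬ ((G.glue J).face ^ m) e' = e :=
    ⟨Nat.find h0, Nat.find_spec h0, fun m => Nat.find_min h0⟩
  obtain ⟨p, rfl⟩ : ∃ p, a = p + 1 := by
    refine ⟨a - 1, ?_⟩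
    rcases Nat.eq_zero_or_pos a with rfl | h
    · exact absurd ha.symm hne
    · omega
  have h1 : ∀ m, m ≤ p → ((G.glue J).face ^ m) e' = (G.face ^ m) e' := fun m hm =>
    glue_pow' J fun k k0 hk => ⟨hmin k (by omega), fun hk' => by
      refine hmin (p + 1 - k) (by omega) ?_
      have h9 := ha
      rw [← Nat.sub_add_cancel (show k ≤ p + 1 by omega), pow_add, Perm.mul_apply, hk'] at h9
      exact h9⟩
  have h2 : (G.face ^ (p + 1)) e' = e' := by
    rw [pow_succ', Perm.mul_apply, h1 p le_rfl, glue_face, Perm.mul_apply, swap_apply_eq_iff,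
      swap_apply_left] at ha
    rw [pow_succ', Perm.mul_apply, ha]
  have h3 : ∀ k, ((G.face ^ (p + 1)) ^ k) e' = e' := by
    intro k
    induction k with
    | zero => rfl
    | succ k ih => rw [pow_succ, Perm.mul_apply, h2, ih]
  intro hs
  obtain ⟨n, hn⟩ := hs.exists_nat_pow_eq
  rw [← Nat.mod_add_div n (p + 1), pow_add, Perm.mul_apply, pow_mul, h3] at hn
  have h4 : n % (p + 1) < p + 1 := Nat.mod_lt _ (by omega)
  exact hmin _ h4 ((h1 _ (by omega)).trans hn)

omit [Finite V] [NeZero N] in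
/-- After the removal of an edge each vertex is connected to one of its ends. -/
theorem conn_or_of_glue {v : V} (H : (G.glue J).Conn e'.1 v) : G.Conn e'.1 v ∨ G.Conn e.1 v := by
  induction H with
  | refl => exact Or.inl (Conn.refl _)
  | tail _ k ih =>
    obtain ⟨k, rfl, rfl⟩ := k
    by_cases h1 : k = e
    · rw [h1, glue_mate_left]; exact Or.inl (Conn.refl _)
    by_cases h2 : k = e'
    · rw [h2, glue_mate_right]; exact Or.inr (Conn.refl _)
    rw [glue_mate_of_ne J h1 h2]
    exact ih.imp (fun h => h.trans (Conn.step k)) fun h => h.trans (Conn.step k)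

/-- An edge both sides of which lie on the boundary of the disk separates the graph. -/
theorem Good.not_conn_of_glue (H : (G.glue J).Good) (h1 : ¬ (G.glue J).IsInner e)
    (h2 : ¬ (G.glue J).IsInner e') (h3 : (G.glue J).face.SameCycle e' e) : ¬ G.Conn e'.1 e.1 := by
  intro hc
  have hconn : ∀ u v, G.Conn u v := fun u v => conn_of_glue J hc.symm (H.connected u v)
  have hs := not_sameCycle_of_glue J h3
  have : Nonempty V := ⟨e.1⟩
  have h4 := weight_euler_le hconn ((glue_cycle_of_boundary J h1 h2).2 H.cycle) (S := Bool)
    (fun b => if b then e else e')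
    (by rintro (_ | _); exacts [not_isInner_of_isLeaf J.right, not_isInner_of_isLeaf J.left])
    (by
      rintro (_ | _) (_ | _) k
      · rfl
      · exact absurd k hs
      · exact absurd (Perm.SameCycle.symm k) hs
      · rfl)
  have h5 := H.planar
  rw [glue_weight_of_boundary J h1 h2, glue_card_not_isLeaf] at h5
  rw [Fintype.card_bool] at h4
  omega

/-- Cutting an internal edge next to a cycle. The boundary of the cut graph exists since this graph
is again allowable; its first two entries are read off from arcs, and the others are compared with
the boundary of the graph which is glued back. -/
theorem Boundary.cut_loop {r : Half N V} {a₁ a₂ b : Chord N} {L : List (Half N V × Chord N)}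
    {p₁ : ℕ} (HG : (G.glue J).Good) (H : (G.glue J).Boundary r ((r, b) :: L))
    (ha₁ : a₁ = lab r p₁) (ha₂ : a₂.Nontrivial) (hb : a₁.mul a₂ = some b)
    (A : (G.glue J).Arc r p₁ e') (A' : G.Arc r p₁ e) (h1 : (G.glue J).IsInner e)
    (h3 : ¬ (G.glue J).IsInner e') :
    G.Good ∧ G.Boundary r ((r, a₁) :: (e, a₁.loop) :: (e', a₂) :: L) := by
  have h2 := HG.cycle e h1
  have hG : G.Good := HG.of_glue_of_cycle J h1 h2 h3
  have hr := (glue_isLeaf J).1 H.root_isLeaf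
  obtain ⟨L₀, K⟩ := hG.exists_boundary hr.1
  rcases L₀ with _ | ⟨⟨r', x⟩, L₀⟩
  · exact absurd rfl K.ne_nil
  obtain rfl := K.walk.head
  obtain ⟨rfl, y, L₀, rfl⟩ := K.head_arc A' J.left (Ne.symm hr.2.1)
  have hN := NeZero.pos N
  have hper : 0 < period N e.2.2 := by unfold period; split_ifs <;> omega
  obtain ⟨q, hq⟩ : ∃ q, q + 1 = period N e.2.2 := ⟨_, Nat.sub_add_cancel hper⟩
  have A2 : G.Arc e q e' := by
    have := Arc.of_glue J (h := e) (p := q) (x := e)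
      ⟨fun m _ _ => h1.not_isLeaf_pow m, by rw [hq, h2]⟩ (fun m h0 hm => ⟨fun hm' => ?_,
        fun hm' => h3 (h1.of_sameCycle ⟨m, by simpa using hm'⟩)⟩)
    · simpa using this
    · have hc := h1.color m
      rw [hm'] at hc
      unfold period at hq
      cases hs : e.2.2 with
      | false => rw [hs] at hq; simp at hq; omega
      | true =>
        rw [hs] at hc hq
        simp only [if_true] at hc hq
        have : (m : ZMod N) = 0 := by
          rw [← sub_eq_zero] at hc
          simpa using hc
        rw [ZMod.natCast_eq_zero_iff] at this
        have := Nat.le_of_dvd h0 this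
        omega
  have hrot := K.rotate
  rw [List.cons_append] at hrot
  obtain ⟨rfl, z, L₁, hL₁⟩ := hrot.head_arc A2 J.right J.ne.symm
  rcases L₀ with _ | ⟨⟨w, z'⟩, L₀⟩
  · simp only [List.nil_append, List.cons.injEq, Prod.mk.injEq] at hL₁
    exact absurd hL₁.1.1 hr.2.2
  simp only [List.cons_append, List.cons.injEq, Prod.mk.injEq] at hL₁
  obtain ⟨⟨rfl, rfl⟩, -⟩ := hL₁
  have he : e.2 = (a₁.target, !a₁.isCentral) := by
    rw [ha₁, lab_isCentral]
    exact Prod.ext A'.color (A'.side_leaf J.left)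
  have hlp := loop_eq_lab he hq
  rw [← ha₁, ← hlp] at K
  -- Gluing the leaves again gives the label `b` as the product of `a₁` and the third label.
  have hz : ∃ k, z' = lab w k := by
    obtain ⟨_, _, _, _, _, rfl, _, _, _, _, rfl, k, _, _, h, _⟩ := K.walk
    exact ⟨k, h⟩
  obtain ⟨k, rfl⟩ := hz
  have hm : a₁.mul (lab w k) = some (lab r' (p₁ + k + 1)) := by
    rw [ha₁]
    exact lab_mul _ _ _ _ A.color (A.side fun h => ((glue_isLeaf J).1 h).2.2 rfl)
  obtain ⟨_, -, -, -, -, K', -⟩ := K.glue_loop hm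
  have := H.unique K'
  simp only [List.cons.injEq, Prod.mk.injEq, true_and] at this
  obtain ⟨rfl, rfl⟩ := this
  obtain rfl := Chord.mul_left_cancel (ha₁ ▸ lab_nontrivial _ _) ha₂ (lab_nontrivial _ _) hb hm
  exact ⟨hG, K⟩

/-- Cutting an internal edge both sides of which lie on the boundary. The edge separates the graph;
the first piece consists of the vertices that remain connected to `e'`, and the second one contains
the root. -/
theorem Boundary.cut_sum {r : Half N V} {a₁ a₂ b : Chord N} {L : List (Half N V × Chord N)}
    {p₁ : ℕ} (HG : (G.glue J).Good) (H : (G.glue J).Boundary r ((r, b) :: L))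
    (ha₁ : a₁ = lab r p₁) (ha₂ : a₂.Nontrivial) (hb : a₁.mul a₂ = some b)
    (A : (G.glue J).Arc r p₁ e') (A' : G.Arc r p₁ e) (h1 : ¬ (G.glue J).IsInner e) :
    ∃ (V₁ V₂ : Type) (_ : Finite V₁) (_ : Finite V₂) (G₁ : Ribbon N V₁) (G₂ : Ribbon N V₂)
      (x₁ y : Half N V₁) (r₂ x₂ : Half N V₂) (c c' c'' : Chord N)
      (L₁ : List (Half N V₁ × Chord N)) (L₂ : List (Half N V₂ × Chord N))
      (J' : (G₁.sum G₂).Joinable (lift Sum.inl x₁) (lift Sum.inr x₂)) (σ : V₁ ⊕ V₂ ≃ V),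
      G₁.Good ∧ G₂.Good ∧ G₁.Boundary x₁ ((x₁, a₂) :: L₁ ++ [(y, c')]) ∧
      G₂.Boundary r₂ ((r₂, a₁) :: (x₂, c'') :: L₂) ∧ c'.mul c'' = some c ∧
      L.map Prod.snd = L₁.map Prod.snd ++ c :: L₂.map Prod.snd ∧
      (G.glue J).weight = G₁.weight + G₂.weight ∧
      IsEmbedding σ ((G₁.sum G₂).glue J') (G.glue J) ∧ lift σ (lift Sum.inr r₂) = r := by
  have hr := (glue_isLeaf J).1 H.root_isLeaf
  have h2 : ¬ (G.glue J).IsInner e' := fun h => h r A.sameCycle.symm H.root_isLeaf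
  have hs : (G.glue J).face.SameCycle e' e :=
    (HG.sameCycle H.root_isLeaf h2).symm.trans (HG.sameCycle H.root_isLeaf h1)
  have hnc := HG.not_conn_of_glue J h1 h2 hs
  -- The component of `e'` after the cut.
  set P : V → Prop := fun v => G.Conn e'.1 v with hPdef
  have hP : ∀ h : Half N V, P h.1 → P (G.mate h).1 := fun h hh => Conn.trans hh (Conn.step h)
  have hP' : ∀ h : Half N V, ¬ P h.1 → ¬ P (G.mate h).1 := fun h hh hh' => by
    apply hh
    have := hP _ hh'
    rwa [G.mate_mate] at this
  have hrP : ¬ P r.1 := fun h => hnc (Conn.trans h (conn_of_sameCycle A'.sameCycle))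
  set G₁ := G.restrict P hP with hG₁
  set G₂ := G.restrict (fun v => ¬ P v) hP' with hG₂
  set x₁ : Half N {v // P v} := (⟨e'.1, Conn.refl _⟩, e'.2) with hx₁
  set x₂ : Half N {v // ¬ P v} := (⟨e.1, hnc⟩, e.2) with hx₂
  set r₂ : Half N {v // ¬ P v} := (⟨r.1, hrP⟩, r.2) with hr₂
  have E : IsEmbedding (Equiv.sumCompl P) (G₁.sum G₂) G := isEmbedding_sumCompl P hP hP'
  have E₂ : IsEmbedding Subtype.val G₂ G := isEmbedding_restrict _ hP'
  have J' : (G₁.sum G₂).Joinable (lift Sum.inl x₁) (lift Sum.inr x₂) :=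
    E.joinable (e := lift Sum.inl x₁) (e' := lift Sum.inr x₂) J.symm
  have EJ : IsEmbedding (Equiv.sumCompl P) ((G₁.sum G₂).glue J') (G.glue J) := by
    rw [glue_symm J]
    exact E.glue J' J.symm
  have c₁ : ∀ u v, G₁.Conn u v := by
    have : ∀ v, G₁.Conn ⟨e'.1, Conn.refl _⟩ v := fun v => (restrict_conn v.2 (Conn.refl _)).2
    exact fun u v => (this u).symm.trans (this v)
  have c₂ : ∀ u v, G₂.Conn u v := by
    have : ∀ v, G₂.Conn ⟨e.1, hnc⟩ v := fun v => by
      rcases conn_or_of_glue J (HG.connected e'.1 v.1) with h | h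
      · exact absurd h v.2
      · exact (restrict_conn h hnc).2
    exact fun u v => (this u).symm.trans (this v)
  have k1 : ¬ ((G₁.sum G₂).glue J').IsInner (lift Sum.inl x₁) := fun h => h2 (EJ.isInner.2 h)
  have k2 : ¬ ((G₁.sum G₂).glue J').IsInner (lift Sum.inr x₂) := fun h => h1 (EJ.isInner.2 h)
  obtain ⟨g1, g2⟩ := Good.of_glue_sum J' k1 k2 (HG.map_iso EJ.symm) c₁ c₂
  have lx₂ : G₂.IsLeaf x₂ := E₂.isLeaf.1 J.left
  have lx₁ : G₁.IsLeaf x₁ := (isEmbedding_restrict P hP).isLeaf.1 J.right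
  have lr₂ : G₂.IsLeaf r₂ := E₂.isLeaf.1 hr.1
  obtain ⟨M₁, K₁⟩ := g1.exists_boundary lx₁
  obtain ⟨M₂, K₂⟩ := g2.exists_boundary lr₂
  rcases M₁ with _ | ⟨⟨x', z⟩, M₁⟩
  · exact absurd rfl K₁.ne_nil
  obtain rfl := K₁.walk.head
  rcases List.eq_nil_or_concat M₁ with rfl | ⟨L₁, ⟨y, c'⟩, rfl⟩
  · exact K₁.ne_singleton.elim
  rw [List.concat_eq_append] at K₁
  rcases M₂ with _ | ⟨⟨r', x⟩, M₂⟩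
  · exact absurd rfl K₂.ne_nil
  obtain rfl := K₂.walk.head
  have A₂ : G₂.Arc r₂ p₁ x₂ := E₂.arc_iff.1 A'
  obtain ⟨rfl, c'', L₂, rfl⟩ := K₂.head_arc A₂ lx₂ (fun h => hr.2.1 (by
    have := congrArg (lift Subtype.val) h
    exact this.symm))
  obtain rfl : a₁ = lab r₂ p₁ := ha₁
  obtain ⟨q, hq⟩ : ∃ q, z = lab x₁ q := by
    obtain ⟨-, q, -, -, h, -⟩ := K₁.walk
    exact ⟨q, h⟩
  have hx1 : x₁.2 = ((lab r₂ p₁).target, r₂.2.2) := by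
    have := A.side fun h => ((glue_isLeaf J).1 h).2.2 rfl
    exact Prod.ext A.color this
  have hm : (lab r₂ p₁).mul z = some (lab r₂ (p₁ + q + 1)) := by
    rw [hq]
    exact lab_mul r₂ p₁ x₁ q (by rw [hx1]) (by rw [hx1])
  obtain ⟨k, l, hk, hl, hkl⟩ : ∃ k l, c' = lab y k ∧ c'' = lab x₂ l ∧ G₁.Arc y k x₁ := by
    obtain ⟨_, _, _, _, _, rfl, l, _, _, h, _⟩ := K₂.walk
    obtain ⟨w, -, W⟩ := (walk_append (L₁ := (x₁, z) :: L₁) (L₂ := [(y, c')])).1 K₁.walk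
    obtain ⟨rfl, k, h3, h4⟩ := walk_singleton.1 W
    exact ⟨k, l, h4, h, h3⟩
  have hc : c'.mul c'' = some (lab y (k + l + 1)) := by
    rw [hk, hl]
    refine lab_mul _ _ _ _ ((show x₂.2.1 = x₁.2.1 from J'.color).trans hkl.color) ?_
    have h5 : x₂.2.2 = !x₁.2.2 := J'.side
    rw [h5, hkl.side_leaf lx₁, Bool.not_not]
  -- The boundary of the original graph is unique, so its labels are those obtained by gluing.
  obtain ⟨_, -, -, K, -⟩ := Boundary.glue_sum K₁ K₂ (lab_nontrivial _ _)
    (hq ▸ lab_nontrivial _ _) hm hc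
  have := H.unique (K.map EJ)
  simp only [List.map_cons, List.map_append, List.cons_append, Prod.map, List.cons.injEq,
    Prod.mk.injEq, id_eq] at this
  obtain ⟨⟨-, rfl⟩, hL⟩ := this
  obtain rfl := Chord.mul_left_cancel (lab_nontrivial _ _) ha₂ (hq ▸ lab_nontrivial _ _) hb hm
  refine ⟨_, _, inferInstance, inferInstance, G₁, G₂, x₁, y, r₂, x₂, _, c', c'', L₁, L₂, J',
    Equiv.sumCompl P, g1, g2, K₁, K₂, hc, ?_, ?_, EJ, rfl⟩
  · rw [hL]
    simp [Function.comp_def]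
  · rw [EJ.weight_eq, glue_weight_of_sum J' k1 k2]

end

/-- Every product decomposition of a label on the boundary comes from gluing: the region consists of
at least two sectors, and between the two factors there is an internal edge, which can be cut. -/
theorem Boundary.exists_cut [Finite V] [NeZero N] {r : Half N V} {a₁ a₂ b : Chord N}
    {L : List (Half N V × Chord N)} (HG : G.Good) (H : G.Boundary r ((r, b) :: L))
    (ha₁ : a₁.Nontrivial) (ha₂ : a₂.Nontrivial) (hb : a₁.mul a₂ = some b) :
    ∃ (G' : Ribbon N V) (e e' : Half N V) (J : G'.Joinable e e') (p₁ : ℕ), G = G'.glue J ∧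
      a₁ = lab r p₁ ∧ (G'.glue J).Arc r p₁ e' ∧ G'.Arc r p₁ e ∧ ¬ (G'.glue J).IsInner e' := by
  obtain ⟨-, p, h1, A, rfl, -⟩ := H.walk
  obtain ⟨p₁, p₂, rfl, rfl⟩ := lab_eq_mul ha₁ ha₂ hb
  obtain ⟨e', he'⟩ : ∃ e', e' = (G.face ^ (p₁ + 1)) r := ⟨_, rfl⟩
  have A1 : G.Arc r p₁ e' := ⟨fun m h0 hm => A.1 m h0 (by omega), he'.symm⟩
  have hl : ¬ G.IsLeaf e' := he' ▸ A.1 (p₁ + 1) (by omega) (by omega)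
  have hl' := not_isLeaf_mate hl
  obtain ⟨G', J, hG⟩ : ∃ (G' : Ribbon N V) (J : G'.Joinable (G.mate e') e'), G = G'.glue J := by
    have J := cut_joinable hl'
    have h := glue_cut hl'
    simp only [G.mate_mate] at J h
    exact ⟨_, J, h.symm⟩
  have hsd := (G.coherent e' hl).2
  generalize G.mate e' = e at J hG hsd
  have hrl := H.root_isLeaf
  subst hG
  refine ⟨G', e, e', J, p₁, rfl, rfl, A1, ?_, fun h => h r A1.sameCycle.symm hrl⟩
  -- The arc from `r` to `e'` does not pass through the edge before its end: not through `e`, which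
  -- lies on the other side, and not through `e'`, since the cycle of `r` would close up too early.
  have := A1.of_glue J (fun m h0 hm => ⟨fun h => ?_, fun h => ?_⟩)
  · simpa using this
  · have h3 := pow_side (G := G'.glue J) (h := r) (p := m) fun k k0 hk => A1.1 k k0 (hk.trans hm)
    rw [h, hsd, A1.side hl] at h3
    simp at h3
  · have h3 : ((G'.glue J).face ^ (p₁ + 1 - m)) r = r := by
      apply ((G'.glue J).face ^ m).injective
      rw [← Perm.mul_apply, ← pow_add, show m + (p₁ + 1 - m) = p₁ + 1 by omega]
      exact he'.symm.trans h.symm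
    exact A1.1 (p₁ + 1 - m) (by omega) (by omega) (by rw [h3]; exact hrl)

end Ribbon

end

/-! ### Factorizations of the entries of a sequence -/

section

namespace Chord
variable {N : ℕ}

/-- The factorizations of a chord into two chords that are not idempotents. -/
def factors : Chord N → Finset (Chord N × Chord N)
  | idem _ => ∅
  | petal i k => (Finset.range k).image fun m => (petal i m, petal i (k - 1 - m))
  | central i k => (Finset.range k).image fun m =>
      (central i m, central (i + (m + 1 : ℕ)) (k - 1 - m))

theorem mem_factors {c : Chord N} {x : Chord N × Chord N} :
    x ∈ c.factors ↔ x.1.Nontrivial ∧ x.2.Nontrivial ∧ x.1.mul x.2 = some c := by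
  obtain ⟨a, b⟩ := x
  rcases c with i | ⟨i, k⟩ | ⟨i, k⟩ <;> rcases a with j | ⟨j, l⟩ | ⟨j, l⟩ <;>
    rcases b with j' | ⟨j', l'⟩ | ⟨j', l'⟩ <;> simp [factors, Nontrivial, mul]
  · constructor
    · rintro ⟨h, rfl, rfl, rfl⟩
      exact ⟨rfl, rfl, by omega⟩
    · rintro ⟨rfl, rfl, rfl⟩
      exact ⟨by omega, rfl, rfl, by omega⟩
  · constructor
    · rintro ⟨h, rfl, rfl, rfl⟩
      exact ⟨rfl, rfl, by omega⟩
    · rintro ⟨rfl, rfl, rfl⟩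
      exact ⟨by omega, rfl, rfl, by omega⟩

end Chord

/-- The ways to write `l = l₁ ++ [c] ++ l₂` and `c = c' c''`, where `c'` and `c''` are not
idempotents, as quadruples `(l₁, c', c'', l₂)`. -/
def splits {N : ℕ} : List (Chord N) → Finset (List (Chord N) × Chord N × Chord N × List (Chord N))
  | [] => ∅
  | c :: l => (c.factors.image fun x => ([], x.1, x.2, l)) ∪
      (splits l).image fun s => (c :: s.1, s.2)

theorem mem_splits {N : ℕ} {l l₁ l₂ : List (Chord N)} {c' c'' : Chord N} :
    (l₁, c', c'', l₂) ∈ splits l ↔ ∃ c, (c', c'') ∈ c.factors ∧ l = l₁ ++ c :: l₂ := by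
  induction l generalizing l₁ with
  | nil => simp [splits]
  | cons d l ih =>
    simp only [splits, Finset.mem_union, Finset.mem_image, Prod.mk.injEq, Prod.exists]
    constructor
    · rintro (⟨a, b, h, rfl, rfl, rfl, rfl⟩ | ⟨m, a, b, m', h, rfl, rfl, rfl, rfl⟩)
      · exact ⟨d, h, rfl⟩
      · obtain ⟨c, hc, rfl⟩ := ih.1 h
        exact ⟨c, hc, rfl⟩
    · rintro ⟨c, hc, h⟩
      rcases l₁ with _ | ⟨x, l₁⟩
      · simp only [List.nil_append, List.cons.injEq] at h
        obtain ⟨rfl, rfl⟩ := h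
        exact Or.inl ⟨_, _, hc, rfl, rfl, rfl, rfl⟩
      · simp only [List.cons_append, List.cons.injEq] at h
        obtain ⟨rfl, rfl⟩ := h
        exact Or.inr ⟨_, _, _, _, ih.2 ⟨c, hc, rfl⟩, rfl, rfl, rfl, rfl⟩

/-! ### Isomorphism classes of rooted graphs -/

/-- A graph with a distinguished half-edge. -/
structure RootedRibbon (N : ℕ) where
  size : ℕ
  graph : Ribbon N (Fin size)
  root : Half N (Fin size)

open Ribbon

instance rootedSetoid (N : ℕ) : Setoid (RootedRibbon N) where
  r G H := ∃ σ : Fin G.size ≃ Fin H.size, IsEmbedding σ G.graph H.graph ∧ lift σ G.root = H.root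
  iseqv := by
    refine ⟨fun G => ⟨Equiv.refl _, IsEmbedding.refl _, rfl⟩, ?_, ?_⟩
    · rintro G H ⟨σ, E, h⟩
      refine ⟨σ.symm, E.symm, ?_⟩
      rw [← h]
      simp [lift]
    · rintro G H K ⟨σ, E, h⟩ ⟨τ, E', h'⟩
      exact ⟨σ.trans τ, E.trans E', by rw [← h', ← h]; rfl⟩

/-- The isomorphism classes of rooted graphs. -/
def RootedClass (N : ℕ) := Quotient (rootedSetoid N)

variable {N : ℕ}

/-- The class of a rooted graph on any finite vertex set. -/
def cls {V : Type} [Finite V] (G : Ribbon N V) (r : Half N V) : RootedClass N :=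
  Quotient.mk _ ⟨Nat.card V, G.map (Finite.equivFin V), lift (Finite.equivFin V) r⟩

theorem cls_eq_iff {V V' : Type} [Finite V] [Finite V'] {G : Ribbon N V} {G' : Ribbon N V'}
    {r : Half N V} {r' : Half N V'} :
    cls G r = cls G' r' ↔ ∃ σ : V ≃ V', IsEmbedding σ G G' ∧ lift σ r = r' := by
  have E := isEmbedding_map (Finite.equivFin V) G
  have E' := isEmbedding_map (Finite.equivFin V') G'
  refine (Quotient.eq (r := rootedSetoid N)).trans ?_
  constructor
  · rintro ⟨σ, F, h⟩
    refine ⟨((Finite.equivFin V).trans σ).trans (Finite.equivFin V').symm,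
      (E.trans F).trans E'.symm, ?_⟩
    apply lift_injective (Finite.equivFin V').injective
    refine Eq.trans ?_ h
    simp [lift]
  · rintro ⟨σ, F, rfl⟩
    refine ⟨((Finite.equivFin V).symm.trans σ).trans (Finite.equivFin V'),
      (E.symm.trans F).trans E', ?_⟩
    simp [lift]

theorem mk_eq_cls (x : RootedRibbon N) :
    (Quotient.mk _ x : RootedClass N) = cls x.graph x.root := by
  refine (Quotient.eq (r := rootedSetoid N)).2 ?_
  exact ⟨Finite.equivFin _, isEmbedding_map _ _, rfl⟩

/-- The number of vertices. -/
def RootedClass.size : RootedClass N → ℕ :=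
  Quotient.lift (fun G => G.size) (by
    rintro G H ⟨σ, -⟩
    simpa using Fintype.card_congr σ)

theorem size_cls {V : Type} [Finite V] (G : Ribbon N V) (r : Half N V) :
    (cls G r).size = Nat.card V := rfl

/-- The classes of allowable graphs of weight `w` which are rooted at a leaf and whose boundary,
read clockwise from the root, has the labels `l`. -/
def classSet [NeZero N] (w : Weight N) (l : List (Chord N)) : Set (RootedClass N) :=
  {q | ∃ (V : Type) (_ : Finite V) (G : Ribbon N V) (r : Half N V) (L : List (Half N V × Chord N)),
    G.Good ∧ G.weight = w ∧ G.Boundary r L ∧ L.map Prod.snd = l ∧ q = cls G r}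

theorem cls_mem_classSet [NeZero N] {V : Type} [Finite V] {G : Ribbon N V} {r : Half N V}
    {w : Weight N} {l : List (Chord N)} : cls G r ∈ classSet w l ↔
      G.Good ∧ G.weight = w ∧ ∃ L, G.Boundary r L ∧ L.map Prod.snd = l := by
  constructor
  · rintro ⟨V', _, G', r', L, h1, h2, h3, h4, h5⟩
    obtain ⟨σ, E, rfl⟩ := cls_eq_iff.1 h5.symm
    exact ⟨h1.map_iso E, E.weight_eq.trans h2, _, h3.map E, by rw [map_snd_lift]; exact h4⟩
  · rintro ⟨h1, h2, L, h3, h4⟩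
    exact ⟨V, inferInstance, G, r, L, h1, h2, h3, h4, rfl⟩

/-- The number of vertices is determined by the weight and the number of leaves. -/
theorem Ribbon.Good.card_eq [NeZero N] {V : Type} [Finite V] {G : Ribbon N V} (H : G.Good)
    {r : Half N V} {L : List (Half N V × Chord N)} (K : G.Boundary r L) :
    2 * Nat.card V + 2 * G.weight.degree + L.length = 2 * N * Nat.card V + 2 := by
  have h1 : Nat.card (Half N V) = 2 * N * Nat.card V := by
    rw [Nat.card_prod, Nat.card_prod, Nat.card_zmod, Nat.card_eq_fintype_card (α := Bool),
      Fintype.card_bool]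
    ring
  have h2 : Nat.card (Half N V) = Nat.card {h // G.IsLeaf h} + Nat.card {h // ¬ G.IsLeaf h} := by
    rw [← Nat.card_sum]
    exact Nat.card_congr (Equiv.sumCompl _).symm
  rw [K.card] at h2
  have h3 := H.planar
  omega

instance {V : Type} [Finite V] [NeZero N] : Finite (Ribbon N V) :=
  Finite.of_injective (fun G => G.mate) fun G G' h => Ribbon.ext fun x => by
    rw [show G.mate = G'.mate from h]

/-- By `Good.card_eq`, a valence `2 N ≥ 4` bounds the number of vertices. -/
theorem classSet_finite [NeZero N] [hN : Fact (2 ≤ N)] (w : Weight N) (l : List (Chord N)) :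
    (classSet w l).Finite := by
  have h1 : classSet w l ⊆ Set.range
      fun x : Σ j : Fin (2 * w.degree + l.length + 1), Ribbon N (Fin j) × Half N (Fin j) =>
        (Quotient.mk _ ⟨x.1, x.2.1, x.2.2⟩ : RootedClass N) := by
    rintro _ ⟨V, _, G, r, L, h1, rfl, h3, rfl, rfl⟩
    have h := h1.card_eq h3
    have h2 : Nat.card V < 2 * G.weight.degree + (L.map Prod.snd).length + 1 := by
      rw [List.length_map]
      have := Nat.mul_le_mul_right (Nat.card V) hN.out
      nlinarith
    exact ⟨⟨⟨Nat.card V, h2⟩, G.map (Finite.equivFin V), lift (Finite.equivFin V) r⟩, rfl⟩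
  exact (Set.finite_range _).subset h1

/-- The finite set of classes of graphs with given weight and labels. -/
def classes [NeZero N] [Fact (2 ≤ N)] (w : Weight N) (l : List (Chord N)) :
    Finset (RootedClass N) :=
  (classSet_finite w l).toFinset

theorem mem_classes [NeZero N] [Fact (2 ≤ N)] {w : Weight N} {l : List (Chord N)}
    {q : RootedClass N} : q ∈ classes w l ↔ q ∈ classSet w l := by simp [classes]

/-- Sums over two finite sets are equal if their terms correspond under a relation which is a
bijection. -/
theorem sum_eq_of_rel {α β M : Type*} [AddCommMonoid M] {s : Finset α} {t : Finset β}
    {f : α → M} {g : β → M} (R : α → β → Prop) (h1 : ∀ a ∈ s, ∃ b ∈ t, R a b)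
    (h2 : ∀ b ∈ t, ∃ a ∈ s, R a b) (h3 : ∀ a a' b, R a b → R a' b → a = a')
    (h4 : ∀ a b b', R a b → R a b' → b = b') (hfg : ∀ a b, R a b → f a = g b) :
    ∑ a ∈ s, f a = ∑ b ∈ t, g b := by
  choose i hi hR using h1
  refine Finset.sum_bij i hi ?_ ?_ fun a ha => hfg _ _ (hR a ha)
  · intro a ha b hb h
    exact h3 _ _ _ (hR a ha) (h ▸ hR b hb)
  · intro b hb
    obtain ⟨a, ha, h⟩ := h2 b hb
    exact ⟨a, ha, h4 _ _ _ (hR a ha) h⟩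

section bracket
variable [NeZero N] [hN : Fact (2 ≤ N)] {R : Type*} [CommRing R] (v : R)

/-- The number of graphs with given weight and labels, where a graph with `j` vertices counts
`v ^ j`. -/
def count (w : Weight N) (l : List (Chord N)) : R := ∑ q ∈ classes w l, v ^ q.size

theorem count_eq_zero {w : Weight N} {l : List (Chord N)}
    (h : ∀ (V : Type) (_ : Finite V) (G : Ribbon N V) (r : Half N V)
      (L : List (Half N V × Chord N)), G.Boundary r L → L.map Prod.snd ≠ l) : count v w l = 0 := by
  rw [count, Finset.sum_eq_zero]
  intro q hq
  obtain ⟨V, i, G, r, L, -, -, h3, h4, -⟩ := mem_classes.1 hq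
  exact absurd h4 (h V i G r L h3)

theorem count_singleton (w : Weight N) (a : Chord N) : count v w [a] = 0 :=
  count_eq_zero v fun V _ G r L h h' => by
    rcases L with _ | ⟨x, _ | ⟨y, L⟩⟩
    · simp at h'
    · exact h.ne_singleton
    · simp at h'

/-- Only sequences of chords which may follow each other on a boundary occur. -/
theorem adjacent_of_count_ne_zero {w : Weight N} {a b : Chord N} {l : List (Chord N)}
    (h : count v w (a :: b :: l) ≠ 0) :
    a.Nontrivial ∧ b.Nontrivial ∧ a.target = b.source ∧ b.isCentral = !a.isCentral := by
  by_contra hc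
  refine h (count_eq_zero v fun V _ G r L H h' => hc ?_)
  rcases L with _ | ⟨⟨x, a'⟩, _ | ⟨⟨y, b'⟩, L⟩⟩
  · simp at h'
  · simp at h'
  · simp only [List.map_cons, List.cons.injEq] at h'
    obtain ⟨rfl, rfl, rfl⟩ := h'
    exact H.adjacent

/-- The cyclic symmetry: the root may be moved to the next leaf. -/
theorem count_rotate (w : Weight N) (a : Chord N) (l : List (Chord N)) :
    count v w (l ++ [a]) = count v w (a :: l) := by
  symm
  refine sum_eq_of_rel (fun q q' => ∃ (V : Type) (_ : Finite V) (G : Ribbon N V)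
    (L : List (Half N V × Chord N)) (x y : Half N V), G.Boundary x ((x, a) :: L) ∧
    G.Boundary y (L ++ [(x, a)]) ∧ q = cls G x ∧ q' = cls G y) ?_ ?_ ?_ ?_ ?_
  · intro q hq
    obtain ⟨V, _, G, r, L, h1, h2, h3, h4, rfl⟩ := mem_classes.1 hq
    rcases L with _ | ⟨⟨x, a'⟩, _ | ⟨⟨y, b⟩, L⟩⟩
    · simp at h4
    · exact h3.ne_singleton.elim
    · simp only [List.map_cons, List.cons.injEq] at h4
      obtain ⟨rfl, rfl⟩ := h4
      obtain rfl := h3.walk.head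
      exact ⟨cls G y, mem_classes.2 (cls_mem_classSet.2 ⟨h1, h2, _, h3.rotate, by simp⟩), V,
        inferInstance, G, _, x, y, h3, h3.rotate, rfl, rfl⟩
  · intro q hq
    obtain ⟨V, _, G, r, L, h1, h2, h3, h4, rfl⟩ := mem_classes.1 hq
    rcases List.eq_nil_or_concat L with rfl | ⟨L, ⟨x, b⟩, rfl⟩
    · simp at h4
    · rw [List.concat_eq_append] at h3 h4
      simp only [List.map_append, List.map_cons, List.map_nil] at h4
      obtain ⟨rfl, h5⟩ := List.append_inj' h4 rfl
      obtain rfl : b = a := by simpa using h5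
      exact ⟨cls G x, mem_classes.2 (cls_mem_classSet.2 ⟨h1, h2, _, h3.rotate_back, by simp⟩), V,
        inferInstance, G, _, x, r, h3.rotate_back, h3, rfl, rfl⟩
  · rintro q q' s ⟨V, _, G, L, x, y, h1, h2, rfl, rfl⟩ ⟨V', _, G', L', x', y', h1', h2', rfl, h⟩
    obtain ⟨σ, E, rfl⟩ := cls_eq_iff.1 h
    have := (h2.map E).unique h2'
    rw [List.map_append] at this
    have h3 := List.append_inj_right' this rfl
    simp only [List.map_cons, List.map_nil, Prod.map, List.cons.injEq, Prod.mk.injEq] at h3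
    exact cls_eq_iff.2 ⟨σ, E, h3.1.1⟩
  · rintro s q q' ⟨V, _, G, L, x, y, h1, h2, rfl, rfl⟩ ⟨V', _, G', L', x', y', h1', h2', h, rfl⟩
    obtain ⟨σ, E, rfl⟩ := cls_eq_iff.1 h
    have := (h1.map E).unique h1'
    simp only [List.map_cons, List.cons.injEq] at this
    obtain ⟨-, rfl⟩ := this
    refine cls_eq_iff.2 ⟨σ, E, ?_⟩
    rcases L with _ | ⟨⟨z, b⟩, L⟩
    · exact h1.ne_singleton.elim
    · rw [← h2.walk.head]
      rw [List.map_cons] at h2'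
      exact h2'.walk.head
  · rintro q q' ⟨V, _, G, L, x, y, h1, h2, rfl, rfl⟩
    rfl

end bracket

end

/-! ### The cutting relation -/

section

namespace Ribbon
variable {N : ℕ}

/-- An isomorphism that preserves the root also preserves an edge given by its position in the first
region. -/
theorem IsEmbedding.map_edge {V V' : Type} {G : Ribbon N V} {G' : Ribbon N V'} {σ : V ≃ V'}
    (E : IsEmbedding σ G G') {r e : Half N V} {r' e' : Half N V'} {p p' : ℕ}
    (hr : lift σ r = r') (hp : lab r p = lab r' p') (A : G.Arc r p e) (A' : G'.Arc r' p' e') :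
    lift σ e = e' ∧ lift σ (G.mate e) = G'.mate e' := by
  subst hr
  obtain rfl : p = p' := lab_injective r p hp
  have h : lift σ e = e' := by rw [← (E.arc A).2, A'.2]
  exact ⟨h, by rw [← E.mate, h]⟩

variable {V₁ V₂ V₁' V₂' : Type} {G₁ : Ribbon N V₁} {G₂ : Ribbon N V₂} {G₁' : Ribbon N V₁'}
  {G₂' : Ribbon N V₂'}

theorem IsEmbedding.sumCongr {σ₁ : V₁ ≃ V₁'} {σ₂ : V₂ ≃ V₂'} (E₁ : IsEmbedding σ₁ G₁ G₁')
    (E₂ : IsEmbedding σ₂ G₂ G₂') :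
    IsEmbedding (Equiv.sumCongr σ₁ σ₂) (G₁.sum G₂) (G₁'.sum G₂') := by
  refine ⟨(Equiv.sumCongr σ₁ σ₂).injective, fun h => ?_⟩
  rcases exists_lift h with ⟨x, rfl⟩ | ⟨x, rfl⟩
  · rw [(isEmbedding_inl G₁ G₂).mate]
    exact ((isEmbedding_inl G₁' G₂').mate (lift σ₁ x)).trans (by rw [E₁.mate]; rfl)
  · rw [(isEmbedding_inr G₁ G₂).mate]
    exact ((isEmbedding_inr G₁' G₂').mate (lift σ₂ x)).trans (by rw [E₂.mate]; rfl)

theorem sum_conn_isLeft {u v : V₁ ⊕ V₂} (h : (G₁.sum G₂).Conn u v) : v.isLeft = u.isLeft := by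
  refine h.map_eq fun h => ?_
  rcases exists_lift h with ⟨x, rfl⟩ | ⟨x, rfl⟩
  · rw [(isEmbedding_inl G₁ G₂).mate]; rfl
  · rw [(isEmbedding_inr G₁ G₂).mate]; rfl

/-- An isomorphism of disjoint unions of two connected graphs which preserves the order of the
components consists of two isomorphisms. -/
theorem IsEmbedding.exists_of_sum {σ : V₁ ⊕ V₂ ≃ V₁' ⊕ V₂'}
    (E : IsEmbedding σ (G₁.sum G₂) (G₁'.sum G₂')) (c₁ : ∀ u v, G₁.Conn u v)
    (c₂ : ∀ u v, G₂.Conn u v) {x₁ : Half N V₁} {x₂ : Half N V₂} {x₁' : Half N V₁'}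
    {x₂' : Half N V₂'} (h₁ : lift σ (lift Sum.inl x₁) = lift Sum.inl x₁')
    (h₂ : lift σ (lift Sum.inr x₂) = lift Sum.inr x₂') :
    ∃ (σ₁ : V₁ ≃ V₁') (σ₂ : V₂ ≃ V₂'), IsEmbedding σ₁ G₁ G₁' ∧ IsEmbedding σ₂ G₂ G₂' ∧
      σ = Equiv.sumCongr σ₁ σ₂ := by
  have f₁ : ∀ v, ∃ v', σ (Sum.inl v) = Sum.inl v' := by
    intro v
    have := sum_conn_isLeft (E.conn ((isEmbedding_inl G₁ G₂).conn (c₁ x₁.1 v)))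
    rw [show σ (Sum.inl x₁.1) = Sum.inl x₁'.1 from congrArg Prod.fst h₁] at this
    exact Sum.isLeft_iff.1 this
  have f₂ : ∀ v, ∃ v', σ (Sum.inr v) = Sum.inr v' := by
    intro v
    have := sum_conn_isLeft (E.conn ((isEmbedding_inr G₁ G₂).conn (c₂ x₂.1 v)))
    rw [show σ (Sum.inr x₂.1) = Sum.inr x₂'.1 from congrArg Prod.fst h₂] at this
    exact Sum.isRight_iff.1 (by simpa using this)
  choose g₁ hg₁ using f₁
  choose g₂ hg₂ using f₂
  have b₁ : Function.Bijective g₁ := by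
    refine ⟨fun u v h => ?_, fun v => ?_⟩
    · exact Sum.inl_injective (σ.injective (by rw [hg₁, hg₁, h]))
    · rcases hv : σ.symm (Sum.inl v) with u | u
      · refine ⟨u, Sum.inl_injective (β := V₂') ?_⟩
        rw [← hg₁, ← hv, σ.apply_symm_apply]
      · have := hg₂ u
        rw [← hv, σ.apply_symm_apply] at this
        cases this
  have b₂ : Function.Bijective g₂ := by
    refine ⟨fun u v h => ?_, fun v => ?_⟩
    · exact Sum.inr_injective (σ.injective (by rw [hg₂, hg₂, h]))
    · rcases hv : σ.symm (Sum.inr v) with u | u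
      · have := hg₁ u
        rw [← hv, σ.apply_symm_apply] at this
        cases this
      · refine ⟨u, Sum.inr_injective (α := V₁') ?_⟩
        rw [← hg₂, ← hv, σ.apply_symm_apply]
  refine ⟨Equiv.ofBijective g₁ b₁, Equiv.ofBijective g₂ b₂, ⟨b₁.1, fun h => ?_⟩,
    ⟨b₂.1, fun h => ?_⟩, ?_⟩
  · apply lift_injective (Sum.inl_injective (β := V₂'))
    rw [← (isEmbedding_inl G₁' G₂').mate]
    have := E.mate (lift Sum.inl h)
    rw [(isEmbedding_inl G₁ G₂).mate] at this
    simpa only [lift, hg₁, Equiv.ofBijective_apply] using this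
  · apply lift_injective (Sum.inr_injective (α := V₁'))
    rw [← (isEmbedding_inr G₁' G₂').mate]
    have := E.mate (lift Sum.inr h)
    rw [(isEmbedding_inr G₁ G₂).mate] at this
    simpa only [lift, hg₂, Equiv.ofBijective_apply] using this
  · ext (v | v)
    · simp [hg₁]
    · simp [hg₂]

end Ribbon

open Ribbon

variable {N : ℕ}

/-- The edge after the initial part `a` of the first region has a cycle on its other side. -/
def HasCycleAfter (a : Chord N) (q : RootedClass N) : Prop :=
  ∃ (V : Type) (_ : Finite V) (G : Ribbon N V) (r x : Half N V) (p : ℕ), q = cls G r ∧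
    a = lab r p ∧ G.Arc r p x ∧ G.IsInner (G.mate x)

theorem hasCycleAfter_cls {V : Type} [Finite V] {G : Ribbon N V} {r x : Half N V} {p : ℕ}
    {a : Chord N} (ha : a = lab r p) (A : G.Arc r p x) :
    HasCycleAfter a (cls G r) ↔ G.IsInner (G.mate x) := by
  constructor
  · rintro ⟨V', _, G', r', x', p', h1, rfl, h3, h4⟩
    obtain ⟨σ, E, h⟩ := cls_eq_iff.1 h1
    rw [← E.isInner, (E.map_edge h ha.symm A h3).2]
    exact h4
  · exact fun h => ⟨V, inferInstance, G, r, x, p, rfl, ha, A, h⟩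

/-- The relation between the classes of a graph with an edge next to a cycle and of the graph that
is cut at this edge. -/
def LoopCut (a₁ a₂ : Chord N) (q q' : RootedClass N) : Prop :=
  ∃ (V : Type) (_ : Finite V) (G : Ribbon N V) (r e e' : Half N V) (J : G.Joinable e e') (p : ℕ)
    (L : List (Half N V × Chord N)), G.Boundary r ((r, a₁) :: (e, a₁.loop) :: (e', a₂) :: L) ∧
    a₁ = lab r p ∧ (G.glue J).Arc r p e' ∧ q = cls (G.glue J) r ∧ q' = cls G r

theorem LoopCut.left_unique {a₁ a₂ : Chord N} {q s q' : RootedClass N}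
    (h : LoopCut a₁ a₂ q q') (k : LoopCut a₁ a₂ s q') : q = s := by
  obtain ⟨V, _, G, r, e, e', J, p, L, B, -, -, rfl, rfl⟩ := h
  obtain ⟨V', _, G', r', f, f', J', p', L', B', -, -, rfl, h⟩ := k
  obtain ⟨σ, E, rfl⟩ := cls_eq_iff.1 h
  have := (B.map E).unique B'
  simp only [List.map_cons, Prod.map, List.cons.injEq, Prod.mk.injEq] at this
  obtain ⟨-, ⟨rfl, -⟩, ⟨rfl, -⟩, -⟩ := this
  exact cls_eq_iff.2 ⟨σ, E.glue J J', rfl⟩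

theorem LoopCut.right_unique {a₁ a₂ : Chord N} {q q' s : RootedClass N}
    (h : LoopCut a₁ a₂ q q') (k : LoopCut a₁ a₂ q s) : q' = s := by
  obtain ⟨V, _, G, r, e, e', J, p, L, -, hp, A, rfl, rfl⟩ := h
  obtain ⟨V', _, G', r', f, f', J', p', L', -, hp', A', h, rfl⟩ := k
  obtain ⟨σ, E, rfl⟩ := cls_eq_iff.1 h
  obtain ⟨h1, h2⟩ := E.map_edge rfl (hp.symm.trans hp') A A'
  rw [glue_mate_right, glue_mate_right] at h2
  subst h1 h2
  exact cls_eq_iff.2 ⟨σ, IsEmbedding.of_glue J J' E, rfl⟩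

/-- The data by which the two pieces of a graph that is cut at a separating edge are indexed: their
weights and the distribution of the labels. -/
abbrev CutIndex (N : ℕ) :=
  (Weight N × Weight N) × (List (Chord N) × Chord N × Chord N × List (Chord N))

/-- The relation between the class of a graph with a separating edge and the classes of the two
pieces that arise if the graph is cut at this edge. -/
def SumCut [NeZero N] (a₁ a₂ : Chord N) (q : RootedClass N)
    (s : Σ _ : CutIndex N, RootedClass N × RootedClass N) : Prop :=
  ∃ (V₁ V₂ : Type) (_ : Finite V₁) (_ : Finite V₂) (G₁ : Ribbon N V₁) (G₂ : Ribbon N V₂)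
    (x₁ y : Half N V₁) (r x₂ : Half N V₂) (c' c'' : Chord N) (L₁ : List (Half N V₁ × Chord N))
    (L₂ : List (Half N V₂ × Chord N))
    (J : (G₁.sum G₂).Joinable (lift Sum.inl x₁) (lift Sum.inr x₂)) (p : ℕ),
    (∀ u v, G₁.Conn u v) ∧ (∀ u v, G₂.Conn u v) ∧
    G₁.Boundary x₁ ((x₁, a₂) :: L₁ ++ [(y, c')]) ∧ G₂.Boundary r ((r, a₁) :: (x₂, c'') :: L₂) ∧
    a₁ = lab r p ∧ ((G₁.sum G₂).glue J).Arc (lift Sum.inr r) p (lift Sum.inl x₁) ∧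
    q = cls ((G₁.sum G₂).glue J) (lift Sum.inr r) ∧
    s = ⟨((G₁.weight, G₂.weight), (L₁.map Prod.snd, c', c'', L₂.map Prod.snd)),
      (cls G₁ x₁, cls G₂ r)⟩

theorem SumCut.left_unique [NeZero N] {a₁ a₂ : Chord N} {q q' : RootedClass N}
    {s : Σ _ : CutIndex N, RootedClass N × RootedClass N}
    (h : SumCut a₁ a₂ q s) (k : SumCut a₁ a₂ q' s) : q = q' := by
  obtain ⟨V₁, V₂, _, _, G₁, G₂, x₁, y, r, x₂, c', c'', L₁, L₂, J, p, -, -, B₁, B₂, -, -, rfl,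
    rfl⟩ := h
  obtain ⟨V₁', V₂', _, _, G₁', G₂', x₁', y', r', x₂', d', d'', L₁', L₂', J', p', -, -, B₁', B₂', -,
    -, rfl, h⟩ := k
  obtain ⟨-, h⟩ := Sigma.mk.inj h
  obtain ⟨h1, h2⟩ := Prod.mk.inj (eq_of_heq h)
  obtain ⟨σ₁, E₁, rfl⟩ := cls_eq_iff.1 h1
  obtain ⟨σ₂, E₂, rfl⟩ := cls_eq_iff.1 h2
  have := (B₂.map E₂).unique B₂'
  simp only [List.map_cons, Prod.map, List.cons.injEq, Prod.mk.injEq] at this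
  obtain ⟨-, ⟨rfl, -⟩, -⟩ := this
  exact cls_eq_iff.2 ⟨Equiv.sumCongr σ₁ σ₂, (E₁.sumCongr E₂).glue J J', rfl⟩

/-- An isomorphism of the glued graphs which fixes the root also fixes the edge at which they are
cut, so it restricts to the two pieces. -/
theorem SumCut.right_unique [NeZero N] {a₁ a₂ : Chord N} {q : RootedClass N}
    {s s' : Σ _ : CutIndex N, RootedClass N × RootedClass N}
    (h : SumCut a₁ a₂ q s) (k : SumCut a₁ a₂ q s') : s = s' := by
  obtain ⟨V₁, V₂, _, _, G₁, G₂, x₁, y, r, x₂, c', c'', L₁, L₂, J, p, C₁, C₂, B₁, B₂, hp, A, rfl,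
    rfl⟩ := h
  obtain ⟨V₁', V₂', _, _, G₁', G₂', x₁', y', r', x₂', d', d'', L₁', L₂', J', p', C₁', C₂', B₁', B₂',
    hp', A', h, rfl⟩ := k
  obtain ⟨σ, E, h0⟩ := cls_eq_iff.1 h
  obtain ⟨h1, h2⟩ := E.map_edge h0 (hp.symm.trans hp') A A'
  rw [glue_mate_left, glue_mate_left] at h2
  have E' : IsEmbedding σ (G₁.sum G₂) (G₁'.sum G₂') := by
    have : ∀ {y₁ : Half N (V₁' ⊕ V₂')} {y₂} (J' : (G₁'.sum G₂').Joinable y₁ y₂),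
        lift σ (lift Sum.inl x₁) = y₁ → lift σ (lift Sum.inr x₂) = y₂ →
        IsEmbedding σ ((G₁.sum G₂).glue J) ((G₁'.sum G₂').glue J') →
        IsEmbedding σ (G₁.sum G₂) (G₁'.sum G₂') := by
      rintro _ _ J' rfl rfl E
      exact IsEmbedding.of_glue J J' E
    exact this J' h1 h2 E
  obtain ⟨σ₁, σ₂, E₁, E₂, rfl⟩ := E'.exists_of_sum C₁ C₂ h1 h2
  obtain rfl : lift σ₁ x₁ = x₁' := lift_injective (Sum.inl_injective (β := V₂')) h1
  obtain rfl : lift σ₂ x₂ = x₂' := lift_injective (Sum.inr_injective (α := V₁')) h2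
  obtain rfl : lift σ₂ r = r' := lift_injective (Sum.inr_injective (α := V₁')) h0
  have k1 := congrArg (List.map Prod.snd) ((B₁.map E₁).unique B₁')
  have k2 := congrArg (List.map Prod.snd) ((B₂.map E₂).unique B₂')
  rw [map_snd_lift] at k1 k2
  simp only [List.map_cons, List.map_append, List.map_nil, List.cons_append, List.cons.injEq,
    true_and] at k1 k2
  obtain ⟨k3, k4⟩ := List.append_inj' k1 rfl
  simp only [List.cons.injEq, and_true] at k4
  rw [E₁.weight_eq, E₂.weight_eq, k3, k4, k2.1, k2.2, cls_eq_iff.2 ⟨σ₁, E₁, rfl⟩,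
    cls_eq_iff.2 ⟨σ₂, E₂, rfl⟩]

section bracket
variable [NeZero N] [hN : Fact (2 ≤ N)] {R : Type*} [CommRing R] (v : R)

/-- The graphs with a cycle on the other side of the edge are in bijection with the graphs in which
this cycle is opened up. -/
theorem sum_hasCycleAfter {w : Weight N} {a₁ a₂ b : Chord N} {l : List (Chord N)}
    (ha₁ : a₁.Nontrivial) (ha₂ : a₂.Nontrivial) (hb : a₁.mul a₂ = some b) :
    ∑ q ∈ (classes w (b :: l)).filter (HasCycleAfter a₁), v ^ q.size =
      if Finsupp.single a₁.loopKind 1 ≤ w then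
        count v (w - Finsupp.single a₁.loopKind 1) (a₁ :: a₁.loop :: a₂ :: l) else 0 := by
  trans ∑ q ∈ (classes (w - Finsupp.single a₁.loopKind 1) (a₁ :: a₁.loop :: a₂ :: l)).filter
    (fun _ => Finsupp.single a₁.loopKind 1 ≤ w), v ^ q.size
  swap
  · split_ifs with h <;> simp [h, count]
  refine sum_eq_of_rel (LoopCut a₁ a₂) ?_ ?_ (fun _ _ _ => LoopCut.left_unique)
    (fun _ _ _ => LoopCut.right_unique) ?_
  · intro q hq
    obtain ⟨hq, hc⟩ := Finset.mem_filter.1 hq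
    obtain ⟨V, _, G, r, L, HG, rfl, H, h4, rfl⟩ := mem_classes.1 hq
    rcases L with _ | ⟨⟨x, b'⟩, L⟩
    · simp at h4
    simp only [List.map_cons, List.cons.injEq] at h4
    obtain ⟨rfl, rfl⟩ := h4
    obtain rfl := H.walk.head
    obtain ⟨G', e, e', J, p, rfl, hp, A, A', h3⟩ := H.exists_cut HG ha₁ ha₂ hb
    rw [hasCycleAfter_cls hp A, glue_mate_right] at hc
    obtain ⟨HG', H'⟩ := H.cut_loop J HG hp ha₂ hb A A' hc h3
    have hk : kind e.2 = a₁.loopKind := by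
      obtain ⟨_, -, -, -, h, -⟩ := H'.glue_loop hb
      exact h
    have hw := glue_weight_of_cycle J hc (HG.cycle e hc) h3
    rw [hk] at hw
    refine ⟨cls G' x, Finset.mem_filter.2 ⟨mem_classes.2 (cls_mem_classSet.2 ⟨HG', ?_, _, H',
      by simp⟩), ?_⟩, V, inferInstance, G', x, e, e', J, p, L, H', hp, A, rfl, rfl⟩
    · rw [hw, add_tsub_cancel_right]
    · rw [hw]; exact le_add_self
  · intro q hq
    obtain ⟨hq, hc⟩ := Finset.mem_filter.1 hq
    obtain ⟨V, _, G, r, L, HG, hw, H, h4, rfl⟩ := mem_classes.1 hq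
    rcases L with _ | ⟨⟨x, _⟩, _ | ⟨⟨e, _⟩, _ | ⟨⟨e', _⟩, L⟩⟩⟩
    · simp at h4
    · simp at h4
    · simp at h4
    simp only [List.map_cons, List.cons.injEq] at h4
    obtain ⟨rfl, rfl, rfl, rfl⟩ := h4
    obtain rfl := H.walk.head
    obtain ⟨J, h1, h2, h3, hk, H', p, hp, A⟩ := H.glue_loop hb
    refine ⟨cls (G.glue J) x, Finset.mem_filter.2 ⟨mem_classes.2 (cls_mem_classSet.2
      ⟨HG.glue_of_cycle J h1 h2 h3, ?_, _, H', by simp⟩), ?_⟩, V, inferInstance, G, x, e, e', J, p,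
      L, H, hp, A, rfl, rfl⟩
    · rw [glue_weight_of_cycle J h1 h2 h3, hk, hw, tsub_add_cancel_of_le hc]
    · rw [hasCycleAfter_cls hp A, glue_mate_right]; exact h1
  · rintro q q' ⟨V, _, G, r, e, e', J, p, L, -, -, -, rfl, rfl⟩
    rfl

/-- The graphs with the boundary of the disk on the other side of the edge are in bijection with
pairs of graphs. -/
theorem sum_not_hasCycleAfter {w : Weight N} {a₁ a₂ b : Chord N} {l : List (Chord N)}
    (ha₁ : a₁.Nontrivial) (ha₂ : a₂.Nontrivial) (hb : a₁.mul a₂ = some b) :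
    ∑ q ∈ (classes w (b :: l)).filter (fun q => ¬ HasCycleAfter a₁ q), v ^ q.size =
      ∑ x ∈ Finset.HasAntidiagonal.antidiagonal w, ∑ s ∈ splits l,
        count v x.1 (a₂ :: s.1 ++ [s.2.1]) * count v x.2 (a₁ :: s.2.2.1 :: s.2.2.2) := by
  simp only [count, Finset.sum_mul_sum, ← Finset.sum_product']
  rw [Finset.sum_sigma']
  refine sum_eq_of_rel (SumCut a₁ a₂) ?_ ?_ (fun _ _ _ => SumCut.left_unique)
    (fun _ _ _ => SumCut.right_unique) ?_
  · intro q hq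
    obtain ⟨hq, hc⟩ := Finset.mem_filter.1 hq
    obtain ⟨V, _, G, r, L, HG, rfl, H, h4, rfl⟩ := mem_classes.1 hq
    rcases L with _ | ⟨⟨x, b'⟩, L⟩
    · simp at h4
    simp only [List.map_cons, List.cons.injEq] at h4
    obtain ⟨rfl, rfl⟩ := h4
    obtain rfl := H.walk.head
    obtain ⟨G', e, e', J, p, rfl, hp, A, A', h3⟩ := H.exists_cut HG ha₁ ha₂ hb
    rw [hasCycleAfter_cls hp A, glue_mate_right] at hc
    obtain ⟨V₁, V₂, _, _, G₁, G₂, x₁, y, r₂, x₂, c, c', c'', L₁, L₂, J', σ, HG₁, HG₂, H₁, H₂, hcc,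
      hL, hw, E, hσ⟩ := H.cut_sum J HG hp ha₂ hb A A' hc
    obtain ⟨J'', -, -, -, p', hp', A''⟩ := H₁.glue_sum H₂ ha₁ ha₂ hb hcc
    refine ⟨⟨((G₁.weight, G₂.weight), (L₁.map Prod.snd, c', c'', L₂.map Prod.snd)),
      (cls G₁ x₁, cls G₂ r₂)⟩, ?_, V₁, V₂, inferInstance, inferInstance, G₁, G₂, x₁, y, r₂, x₂, c',
      c'', L₁, L₂, J', p', HG₁.connected, HG₂.connected, H₁, H₂, hp', A'',
      (cls_eq_iff.2 ⟨σ, E, hσ⟩).symm, rfl⟩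
    have n' : c'.Nontrivial := by
      obtain ⟨k, hk⟩ := H₁.walk.exists_lab (x := y) (a := c') (by simp)
      exact hk ▸ lab_nontrivial _ _
    have n'' : c''.Nontrivial := by
      obtain ⟨k, hk⟩ := H₂.walk.exists_lab (x := x₂) (a := c'') (by simp)
      exact hk ▸ lab_nontrivial _ _
    simp only [Finset.mem_sigma, Finset.mem_product]
    exact ⟨⟨Finset.HasAntidiagonal.mem_antidiagonal.2 hw.symm,
      mem_splits.2 ⟨c, Chord.mem_factors.2 ⟨n', n'', hcc⟩, hL⟩⟩,
      mem_classes.2 (cls_mem_classSet.2 ⟨HG₁, rfl, _, H₁, by simp⟩),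
      mem_classes.2 (cls_mem_classSet.2 ⟨HG₂, rfl, _, H₂, by simp⟩)⟩
  · rintro ⟨⟨⟨w₁, w₂⟩, l₁, c', c'', l₂⟩, q₁, q₂⟩ hs
    simp only [Finset.mem_sigma, Finset.mem_product] at hs
    obtain ⟨⟨hw, hsp⟩, hq₁, hq₂⟩ := hs
    obtain ⟨c, hc, hl⟩ := mem_splits.1 hsp
    obtain ⟨n', n'', hcc⟩ := Chord.mem_factors.1 hc
    obtain ⟨V₁, _, G₁, x₁, L₁, HG₁, rfl, H₁, h₁, rfl⟩ := mem_classes.1 hq₁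
    obtain ⟨V₂, _, G₂, r, L₂, HG₂, rfl, H₂, h₂, rfl⟩ := mem_classes.1 hq₂
    rcases L₂ with _ | ⟨⟨z, _⟩, _ | ⟨⟨x₂, _⟩, L₂⟩⟩
    · simp at h₂
    · simp at h₂
    simp only [List.map_cons, List.cons.injEq] at h₂
    obtain ⟨rfl, rfl, rfl⟩ := h₂
    obtain rfl := H₂.walk.head
    rcases L₁ with _ | ⟨⟨z', _⟩, L₁⟩
    · simp at h₁
    obtain rfl := H₁.walk.head
    simp only [List.map_cons, List.cons_append, List.cons.injEq] at h₁
    obtain ⟨rfl, h₁⟩ := h₁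
    obtain ⟨L₁, y, rfl, rfl⟩ : ∃ L y, L₁ = L ++ [(y, c')] ∧ l₁ = L.map Prod.snd := by
      rcases List.eq_nil_or_concat L₁ with rfl | ⟨L, ⟨y, d⟩, rfl⟩
      · simp at h₁
      · rw [List.concat_eq_append, List.map_append] at h₁
        obtain ⟨h5, h6⟩ := List.append_inj' h₁ rfl
        simp only [List.map_cons, List.map_nil, List.cons.injEq, and_true] at h6
        exact ⟨L, y, by rw [List.concat_eq_append, h6], h5.symm⟩
    obtain ⟨J, h1, h2, H, p, hp, A⟩ := Boundary.glue_sum (L₁ := L₁) H₁ H₂ ha₁ ha₂ hb hcc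
    refine ⟨cls ((G₁.sum G₂).glue J) (lift Sum.inr z), Finset.mem_filter.2 ⟨mem_classes.2
      (cls_mem_classSet.2 ⟨HG₁.glue_sum J h1 h2 HG₂, ?_, _, H, ?_⟩), ?_⟩, V₁, V₂,
      inferInstance, inferInstance, G₁, G₂, z', y, z, x₂, c', _, L₁, L₂, J, p, HG₁.connected,
      HG₂.connected, H₁, H₂, hp, A, rfl, rfl⟩
    · rw [glue_weight_of_sum J h1 h2, Finset.HasAntidiagonal.mem_antidiagonal.1 hw]
    · rw [hl]
      simp [Function.comp_def]
    · rw [hasCycleAfter_cls (r := lift Sum.inr z) hp A, glue_mate_left]; exact h2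
  · rintro q s ⟨V₁, V₂, _, _, G₁, G₂, x₁, y, r, x₂, c', c'', L₁, L₂, J, p, -, -, -, -, -, -, rfl,
      rfl⟩
    rw [size_cls, Nat.card_sum, pow_add]
    rfl

/-- Cutting the graphs whose first label is a product `a₁ a₂` at the corresponding internal edge. On
its other side this edge has either a cycle, which is opened up by the cut, or the boundary of the
disk; in the second case the graph falls apart. -/
theorem count_cut {w : Weight N} {a₁ a₂ b : Chord N} {l : List (Chord N)}
    (ha₁ : a₁.Nontrivial) (ha₂ : a₂.Nontrivial) (hb : a₁.mul a₂ = some b) :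
    count v w (b :: l) = (if Finsupp.single a₁.loopKind 1 ≤ w then
        count v (w - Finsupp.single a₁.loopKind 1) (a₁ :: a₁.loop :: a₂ :: l) else 0) +
      ∑ x ∈ Finset.HasAntidiagonal.antidiagonal w, ∑ s ∈ splits l,
        count v x.1 (a₂ :: s.1 ++ [s.2.1]) * count v x.2 (a₁ :: s.2.2.1 :: s.2.2.2) := by
  rw [← sum_hasCycleAfter v ha₁ ha₂ hb, ← sum_not_hasCycleAfter v ha₁ ha₂ hb, count,
    Finset.sum_filter_add_sum_filter_not]

end bracket

end

/-! ### Sums over decompositions of sequences -/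

section

namespace Chord
variable {N : ℕ}

theorem idem_mul (i : ZMod N) (c : Chord N) :
    (idem i).mul c = if i = c.source then some c else none := by cases c <;> rfl

theorem mul_idem (c : Chord N) (i : ZMod N) :
    c.mul (idem i) = if c.target = i then some c else none := by
  rcases c with j | ⟨j, k⟩ | ⟨j, k⟩
  · rw [idem_mul]
    change (if j = i then _ else _) = if j = i then _ else _
    split_ifs with h
    · rw [h]
    · rfl
  · rfl
  · rfl

theorem petal_mul_petal (i j : ZMod N) (k l : ℕ) :
    (petal i k).mul (petal j l) = if i = j then some (petal i (k + l + 1)) else none := rfl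

theorem central_mul_central (i j : ZMod N) (k l : ℕ) : (central i k).mul (central j l) =
    if i + (k + 1 : ℕ) = j then some (central i (k + l + 1)) else none := rfl

theorem petal_mul_central (i j : ZMod N) (k l : ℕ) : (petal i k).mul (central j l) = none := rfl

theorem central_mul_petal (i j : ZMod N) (k l : ℕ) : (central i k).mul (petal j l) = none := rfl

theorem mul_assoc_bind (a b c : Chord N) :
    ((a.mul b).bind fun d => d.mul c) = (b.mul c).bind fun d => a.mul d := by
  rcases a with i | ⟨i, k⟩ | ⟨i, k⟩ <;> rcases b with j | ⟨j, l⟩ | ⟨j, l⟩ <;>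
    rcases c with m | ⟨m, n⟩ | ⟨m, n⟩ <;>
    simp only [idem_mul, mul_idem, petal_mul_petal, central_mul_central, petal_mul_central,
      central_mul_petal, source, target, Option.bind_none] <;> split_ifs <;>
    (try subst_vars) <;> simp_all only [Option.bind_none, Option.bind_some, idem_mul,
      petal_mul_petal, central_mul_central, petal_mul_central, central_mul_petal, source,
      if_true, if_false] <;>
    (try split_ifs) <;> simp_all [mul_idem, petal_mul_petal, central_mul_central,
      petal_mul_central, central_mul_petal, target, add_assoc, add_comm, add_left_comm,
      one_add_one_eq_two]

theorem exists_mul {a b : Chord N} (ha : a.Nontrivial) (hb : b.Nontrivial)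
    (h : a.target = b.source) (h' : b.isCentral = a.isCentral) : ∃ c, a.mul b = some c := by
  rcases a with i | ⟨i, k⟩ | ⟨i, k⟩ <;> rcases b with j | ⟨j, l⟩ | ⟨j, l⟩ <;>
    simp_all [mul, Nontrivial, target, source, isCentral]

variable {S : Type*} [AddCommMonoid S]

theorem sum_factors_petal (i : ZMod N) (k : ℕ) (f : Chord N → Chord N → S) :
    ∑ x ∈ (petal i k).factors, f x.1 x.2 =
      ∑ m ∈ Finset.range k, f (petal i m) (petal i (k - 1 - m)) := by
  rw [factors, Finset.sum_image]
  intro x _ y _ h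
  simp only [Prod.mk.injEq, petal.injEq, true_and] at h
  exact h.1

theorem sum_factors_central (i : ZMod N) (k : ℕ) (f : Chord N → Chord N → S) :
    ∑ x ∈ (central i k).factors, f x.1 x.2 =
      ∑ m ∈ Finset.range k, f (central i m) (central (i + (m + 1 : ℕ)) (k - 1 - m)) := by
  rw [factors, Finset.sum_image]
  intro x _ y _ h
  simp only [Prod.mk.injEq, central.injEq, true_and] at h
  exact h.1

/-- Coassociativity of the factorization of chords. -/
theorem sum_factors_assoc (a : Chord N) (f : Chord N → Chord N → Chord N → S) :
    ∑ x ∈ a.factors, ∑ y ∈ x.1.factors, f y.1 y.2 x.2 =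
      ∑ x ∈ a.factors, ∑ y ∈ x.2.factors, f x.1 y.1 y.2 := by
  rw [Finset.sum_sigma', Finset.sum_sigma']
  refine sum_eq_of_rel (fun s s' => s.2.1 = s'.1.1 ∧ s.2.2 = s'.2.1 ∧ s.1.2 = s'.2.2 ∧
    s.2.1.mul s.2.2 = some s.1.1 ∧ s'.2.1.mul s'.2.2 = some s'.1.2) ?_ ?_ ?_ ?_ ?_
  · rintro ⟨⟨x, y⟩, u, v⟩ h
    simp only [Finset.mem_sigma, mem_factors] at h
    obtain ⟨⟨hx, hy, h1⟩, hu, hv, h2⟩ := h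
    have h3 := mul_assoc_bind u v y
    rw [h2, Option.bind_some, h1] at h3
    obtain ⟨d, hd, h4⟩ := Option.bind_eq_some_iff.1 h3.symm
    refine ⟨⟨(u, d), (v, y)⟩, ?_, rfl, rfl, rfl, h2, hd⟩
    simp only [Finset.mem_sigma, mem_factors]
    exact ⟨⟨hu, (mul_eq_some hv hy hd).2.2.1, h4⟩, hv, hy, hd⟩
  · rintro ⟨⟨x, y⟩, u, v⟩ h
    simp only [Finset.mem_sigma, mem_factors] at h
    obtain ⟨⟨hx, hy, h1⟩, hu, hv, h2⟩ := h
    have h3 := mul_assoc_bind x u v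
    rw [h2, Option.bind_some, h1] at h3
    obtain ⟨d, hd, h4⟩ := Option.bind_eq_some_iff.1 h3
    refine ⟨⟨(d, v), (x, u)⟩, ?_, rfl, rfl, rfl, hd, h2⟩
    simp only [Finset.mem_sigma, mem_factors]
    exact ⟨⟨(mul_eq_some hx hu hd).2.2.1, hv, h4⟩, hx, hu, hd⟩
  · rintro ⟨⟨x, y⟩, u, v⟩ ⟨⟨x', y'⟩, u', v'⟩ ⟨⟨p, q⟩, r, s⟩ ⟨h1, h2, h3, h4, -⟩
      ⟨k1, k2, k3, k4, -⟩
    simp only at h1 h2 h3 h4 k1 k2 k3 k4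
    subst h1 h2 h3 k1 k2 k3
    obtain rfl := Option.some.inj (h4.symm.trans k4)
    rfl
  · rintro ⟨⟨p, q⟩, r, s⟩ ⟨⟨x, y⟩, u, v⟩ ⟨⟨x', y'⟩, u', v'⟩ ⟨h1, h2, h3, -, h4⟩
      ⟨k1, k2, k3, -, k4⟩
    simp only at h1 h2 h3 h4 k1 k2 k3 k4
    subst h1 h2 h3 k1 k2 k3
    obtain rfl := Option.some.inj (h4.symm.trans k4)
    rfl
  · rintro ⟨⟨p, q⟩, r, s⟩ ⟨⟨x, y⟩, u, v⟩ ⟨h1, h2, h3, -⟩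
    simp only at h1 h2 h3
    rw [h1, h2, h3]

end Chord

section sums
variable {A S : Type*} [AddCommMonoid S]

/-- The sum over all ways to write a list as `u ++ v`. -/
def cutSum (f : List A → List A → S) : List A → S
  | [] => f [] []
  | a :: l => f [] (a :: l) + cutSum (fun u v => f (a :: u) v) l

theorem cutSum_congr {f g : List A → List A → S} {l : List A}
    (h : ∀ u v, u ++ v = l → f u v = g u v) : cutSum f l = cutSum g l := by
  induction l generalizing f g with
  | nil => exact h [] [] rfl
  | cons a l ih =>
    rw [cutSum, cutSum, h [] _ rfl, ih fun u v huv => h _ _ (by rw [List.cons_append, huv])]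

theorem cutSum_add (f g : List A → List A → S) (l : List A) :
    cutSum (fun u v => f u v + g u v) l = cutSum f l + cutSum g l := by
  induction l generalizing f g with
  | nil => rfl
  | cons a l ih =>
    change _ + cutSum _ l = (_ + cutSum _ l) + (_ + cutSum _ l)
    rw [ih]
    exact add_add_add_comm _ _ _ _

theorem cutSum_zero (l : List A) : cutSum (fun _ _ => (0 : S)) l = 0 := by
  induction l with
  | nil => rfl
  | cons a l ih =>
    change 0 + cutSum (fun _ _ => (0 : S)) l = 0
    rw [ih, add_zero]

theorem cutSum_eq_zero {f : List A → List A → S} {l : List A}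
    (h : ∀ u v, u ++ v = l → f u v = 0) : cutSum f l = 0 := by
  rw [cutSum_congr h, cutSum_zero]

theorem cutSum_eq_left {f : List A → List A → S} {l : List A}
    (h : ∀ a u v, a :: u ++ v = l → f (a :: u) v = 0) : cutSum f l = f [] l := by
  cases l with
  | nil => rfl
  | cons a l =>
    change _ + cutSum _ l = _
    rw [cutSum_eq_zero, add_zero]
    intro u v huv
    exact h a u v (by rw [List.cons_append, huv])

theorem cutSum_concat (f : List A → List A → S) (l : List A) (b : A) :
    cutSum f (l ++ [b]) = cutSum (fun u v => f u (v ++ [b])) l + f (l ++ [b]) [] := by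
  induction l generalizing f with
  | nil => rfl
  | cons a l ih =>
    change _ + cutSum _ (l ++ [b]) = (_ + cutSum _ l) + _
    rw [ih, add_assoc]
    rfl

theorem cutSum_eq_right {f : List A → List A → S} {l : List A}
    (h : ∀ u v b, u ++ (v ++ [b]) = l → f u (v ++ [b]) = 0) : cutSum f l = f l [] := by
  rcases List.eq_nil_or_concat l with rfl | ⟨m, b, rfl⟩
  · rfl
  · rw [List.concat_eq_append] at h ⊢
    rw [cutSum_concat, cutSum_eq_zero, zero_add]
    intro u v huv
    exact h u v b (by rw [← huv, List.append_assoc])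

variable {N : ℕ}

/-- The sum over all ways to write a sequence of chords as `u ++ [c] ++ v`, and `c` as a product
`c' c''` of chords that are not idempotents. -/
def splitSum (f : List (Chord N) → Chord N → Chord N → List (Chord N) → S) :
    List (Chord N) → S
  | [] => 0
  | c :: l => ∑ x ∈ c.factors, f [] x.1 x.2 l + splitSum (fun u => f (c :: u)) l

theorem sum_splits (f : List (Chord N) → Chord N → Chord N → List (Chord N) → S)
    (l : List (Chord N)) : ∑ s ∈ splits l, f s.1 s.2.1 s.2.2.1 s.2.2.2 = splitSum f l := by
  induction l generalizing f with
  | nil => rfl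
  | cons c l ih =>
    rw [splits, Finset.sum_union, Finset.sum_image, Finset.sum_image, splitSum, ← ih]
    · rintro ⟨u, x⟩ _ ⟨u', x'⟩ _ h
      simp only [Prod.mk.injEq, List.cons.injEq, true_and] at h
      rw [h.1, h.2]
    · rintro ⟨u, x⟩ _ ⟨u', x'⟩ _ h
      simp only [Prod.mk.injEq, and_true, true_and] at h
      rw [h.1, h.2]
    · rw [Finset.disjoint_left]
      intro s hs hs'
      obtain ⟨x, _, rfl⟩ := Finset.mem_image.1 hs
      obtain ⟨y, _, h⟩ := Finset.mem_image.1 hs'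
      simp at h

theorem splitSum_congr {f g : List (Chord N) → Chord N → Chord N → List (Chord N) → S}
    {l : List (Chord N)} (h : ∀ u c c' c'' v, u ++ c :: v = l → (c', c'') ∈ c.factors →
      f u c' c'' v = g u c' c'' v) : splitSum f l = splitSum g l := by
  induction l generalizing f g with
  | nil => rfl
  | cons a l ih =>
    refine congrArg₂ (· + ·) (Finset.sum_congr rfl fun x hx => h [] a _ _ l rfl hx) (ih ?_)
    intro u c c' c'' v huv hc
    exact h _ _ _ _ _ (by rw [List.cons_append, huv]) hc

theorem splitSum_zero (l : List (Chord N)) :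
    splitSum (fun _ _ _ _ => (0 : S)) l = 0 := by
  induction l with
  | nil => rfl
  | cons a l ih => simp [splitSum, ih]

theorem splitSum_eq_zero {f : List (Chord N) → Chord N → Chord N → List (Chord N) → S}
    {l : List (Chord N)} (h : ∀ u c c' c'' v, u ++ c :: v = l → (c', c'') ∈ c.factors →
      f u c' c'' v = 0) : splitSum f l = 0 := by
  rw [splitSum_congr h, splitSum_zero]

theorem splitSum_append (f : List (Chord N) → Chord N → Chord N → List (Chord N) → S)
    (l m : List (Chord N)) : splitSum f (l ++ m) =
      splitSum (fun u c' c'' v => f u c' c'' (v ++ m)) l +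
        splitSum (fun u c' c'' v => f (l ++ u) c' c'' v) m := by
  induction l generalizing f with
  | nil => simp [splitSum]
  | cons a l ih =>
    rw [List.cons_append, splitSum, splitSum, ih, add_assoc]
    rfl

theorem splitSum_sum {ι : Type*} (s : Finset ι)
    (f : ι → List (Chord N) → Chord N → Chord N → List (Chord N) → S) (l : List (Chord N)) :
    splitSum (fun u c' c'' v => ∑ i ∈ s, f i u c' c'' v) l = ∑ i ∈ s, splitSum (f i) l := by
  induction l generalizing f with
  | nil => simp [splitSum]
  | cons a l ih =>
    simp only [splitSum]
    rw [ih, Finset.sum_add_distrib, Finset.sum_comm]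

theorem splitSum_add (f g : List (Chord N) → Chord N → Chord N → List (Chord N) → S)
    (l : List (Chord N)) : splitSum (fun u c' c'' v => f u c' c'' v + g u c' c'' v) l =
      splitSum f l + splitSum g l := by
  induction l generalizing f g with
  | nil => simp [splitSum]
  | cons a l ih =>
    simp only [splitSum]
    rw [ih, Finset.sum_add_distrib]
    exact add_add_add_comm _ _ _ _

end sums

end

/-! ### Cyclic brackets with a cutting relation -/

section

variable {N : ℕ} {S : Type*} [CommRing S]

/-- Two chords may follow each other on the boundary of a graph. -/
def Adj (a b : Chord N) : Prop :=
  a.Nontrivial ∧ b.Nontrivial ∧ a.target = b.source ∧ b.isCentral = !a.isCentral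

/-- The properties of the generating function `br l` of the allowable graphs with boundary `l` from
which the A-infinity relations follow formally; `t o` is the variable of the basic weight `o`. -/
structure IsBracket (br : List (Chord N) → S) (t : Option (ZMod N) → S) : Prop where
  single : ∀ a, br [a] = 0
  rotate : ∀ a l, br (l ++ [a]) = br (a :: l)
  adj : ∀ a b l, br (a :: b :: l) ≠ 0 → Adj a b
  cut : ∀ a b c l, a.Nontrivial → b.Nontrivial → a.mul b = some c →
    br (c :: l) = t a.loopKind * br (a :: a.loop :: b :: l) +
      splitSum (fun u c' c'' v => br (b :: u ++ [c']) * br (a :: c'' :: v)) l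

namespace IsBracket

variable {br : List (Chord N) → S} {t : Option (ZMod N) → S} (H : IsBracket br t)
include H

theorem append_comm (u v : List (Chord N)) : br (u ++ v) = br (v ++ u) := by
  induction v generalizing u with
  | nil => simp
  | cons a v ih =>
    have := ih (u ++ [a])
    rw [List.append_assoc, List.singleton_append] at this
    rw [this, ← List.append_assoc, H.rotate, List.cons_append]

theorem adj_append {u v : List (Chord N)} {a b : Chord N} (h : br (u ++ a :: b :: v) ≠ 0) :
    Adj a b := by
  rw [H.append_comm] at h
  exact H.adj _ _ _ h

theorem adj_last {l : List (Chord N)} {a b : Chord N} (h : br (a :: (l ++ [b])) ≠ 0) :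
    Adj b a := by
  rw [← List.cons_append, H.rotate] at h
  exact H.adj _ _ _ h

theorem eq_zero_of_idem (u v : List (Chord N)) (i : ZMod N) :
    br (u ++ Chord.idem i :: v) = 0 := by
  by_contra h
  rw [H.append_comm, List.cons_append] at h
  rcases hl : v ++ u with _ | ⟨b, l⟩
  · rw [hl] at h
    exact h (H.single _)
  · rw [hl] at h
    exact (H.adj _ _ _ h).1

end IsBracket

section merge
variable (br : List (Chord N) → S)

/-- The value of `Φ` on the list in which the last entry of `u` and the first entry of `v` are
multiplied. -/
def merge (Φ : List (Chord N) → S) : List (Chord N) → List (Chord N) → S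
  | [], _ => 0
  | [_], [] => 0
  | [a], b :: v => (a.mul b).elim 0 fun c => Φ (c :: v)
  | a :: b :: u, v => merge (fun l => Φ (a :: l)) (b :: u) v

theorem merge_nil (Φ : List (Chord N) → S) (u : List (Chord N)) : merge Φ u [] = 0 := by
  induction u generalizing Φ with
  | nil => rfl
  | cons a u ih =>
    cases u with
    | nil => rfl
    | cons b u => exact ih _

theorem merge_concat (Φ : List (Chord N) → S) (u v : List (Chord N)) (a b : Chord N) :
    merge Φ (u ++ [a]) (b :: v) = (a.mul b).elim 0 fun c => Φ (u ++ c :: v) := by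
  induction u generalizing Φ with
  | nil => rfl
  | cons d u ih =>
    cases u with
    | nil => rfl
    | cons e u => exact ih _

theorem merge_cons {Φ : List (Chord N) → S} (a : Chord N) {u : List (Chord N)} (hu : u ≠ [])
    (v : List (Chord N)) : merge Φ (a :: u) v = merge (fun l => Φ (a :: l)) u v := by
  cases u with
  | nil => exact absurd rfl hu
  | cons b u => rfl

/-- The splittings of an entry of `v`, where the first part goes to the inner bracket. -/
def splitRight (Φ : List (Chord N) → S) (u v : List (Chord N)) : S :=
  splitSum (fun v₁ c' c'' v₂ => br (v₁ ++ [c']) * Φ (u ++ c'' :: v₂)) v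

/-- The splittings of an entry of `u`, where the second part goes to the inner bracket. -/
def splitLeft (Φ : List (Chord N) → S) (u v : List (Chord N)) : S :=
  splitSum (fun u₁ c' c'' u₂ => br (c'' :: u₂) * Φ (u₁ ++ c' :: v)) u

end merge

section terms
variable [NeZero N] (br : List (Chord N) → S) (t : Option (ZMod N) → S)

/-- The linear functional `φ` applied to `∑ o, t o • U_o`, where `U_o` is the element of weight
`o`. -/
def orb (φ : Chord N → S) : S :=
  ∑ i : ZMod N, (t (some i) * φ (.petal i 0) + t none * φ (.central i (N - 1)))

theorem orb_add (φ ψ : Chord N → S) : orb t (fun c => φ c + ψ c) = orb t φ + orb t ψ := by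
  rw [orb, orb, orb, ← Finset.sum_add_distrib]
  exact Finset.sum_congr rfl fun i _ => by ring

theorem orb_sum {ι : Type*} (s : Finset ι) (φ : ι → Chord N → S) :
    orb t (fun c => ∑ i ∈ s, φ i c) = ∑ i ∈ s, orb t (φ i) := by
  simp only [orb, Finset.mul_sum, Finset.sum_add_distrib]
  rw [Finset.sum_comm]
  congr 1
  rw [Finset.sum_comm]

theorem orb_mul (φ : Chord N → S) (x : S) : orb t (fun c => φ c * x) = orb t φ * x := by
  simp only [orb, Finset.sum_mul]
  exact Finset.sum_congr rfl fun i _ => by ring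

/-- If `φ` vanishes on all chords that cannot follow `a` on a boundary, then only one `U_o`
contributes. -/
theorem orb_eq_loop {φ : Chord N → S} {a : Chord N}
    (h : ∀ d, φ d ≠ 0 → d.source = a.target ∧ d.isCentral = !a.isCentral) :
    orb t φ = t a.loopKind * φ a.loop := by
  rw [orb, Finset.sum_eq_single a.target]
  · cases hc : a.isCentral
    · rw [Chord.loopKind, Chord.loop, hc, if_neg (by simp), if_neg (by simp)]
      have : φ (.petal a.target 0) = 0 := by
        by_contra h'
        have := (h _ h').2
        rw [hc] at this
        cases this
      rw [this]; ring
    · rw [Chord.loopKind, Chord.loop, hc, if_pos rfl, if_pos rfl]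
      have : φ (.central a.target (N - 1)) = 0 := by
        by_contra h'
        have := (h _ h').2
        rw [hc] at this
        cases this
      rw [this]; ring
  · intro i _ hi
    have h1 : φ (.petal i 0) = 0 := by
      by_contra h'
      exact hi (h _ h').1
    have h2 : φ (.central i (N - 1)) = 0 := by
      by_contra h'
      exact hi (h _ h').1
    rw [h1, h2]; ring
  · intro h'
    exact absurd (Finset.mem_univ _) h'

/-- The contributions to the A-infinity relation which belong to a place between two inputs, if the
outer operation has the values `Φ`: an element `U_o` is inserted there, the two neighbours are
multiplied, or the inner operation belongs to a right extended graph whose inputs begin there or to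
a left extended graph whose inputs end there. -/
def place (Φ : List (Chord N) → S) (u v : List (Chord N)) : S :=
  orb t (fun c => Φ (u ++ c :: v)) + merge Φ u v + splitRight br Φ u v + splitLeft br Φ u v

variable {br t} [CharP S 2] (H : IsBracket br t)
include H

omit [CharP S 2] in
theorem IsBracket.orb_eq {u v : List (Chord N)} {a : Chord N} :
    orb t (fun d => br (u ++ a :: d :: v)) = t a.loopKind * br (u ++ a :: a.loop :: v) := by
  refine orb_eq_loop t fun d hd => ?_
  obtain ⟨-, -, h1, h2⟩ := H.adj_append hd
  exact ⟨h1.symm, h2⟩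

omit [NeZero N] [CharP S 2] in
theorem IsBracket.splitRight_eq (u v : List (Chord N)) (a b : Chord N) :
    splitRight br br (u ++ [a]) (b :: v) =
      splitSum (fun v₁ c' c'' v₂ => br (b :: v₁ ++ [c']) * br (a :: c'' :: (v₂ ++ u))) v := by
  rw [splitRight, splitSum]
  simp only [List.nil_append, H.single, zero_mul, Finset.sum_const_zero, zero_add]
  refine splitSum_congr fun v₁ c c' c'' v₂ _ _ => ?_
  rw [List.append_assoc, H.append_comm u]
  simp

omit [NeZero N] [CharP S 2] in
theorem IsBracket.splitLeft_eq (u v : List (Chord N)) (a b : Chord N) :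
    splitLeft br br (u ++ [a]) (b :: v) =
      splitSum (fun u₁ c' c'' u₂ => br (b :: (v ++ u₁) ++ [c']) * br (a :: c'' :: u₂)) u := by
  rw [splitLeft, splitSum_append]
  have : splitSum (fun u_1 c' c'' u₂ => br (c'' :: u₂) * br (u ++ u_1 ++ c' :: b :: v)) [a] =
      0 := by
    simp [splitSum, H.single]
  rw [this, add_zero]
  refine splitSum_congr fun u₁ c c' c'' u₂ _ _ => ?_
  have h1 : br (c'' :: (u₂ ++ [a])) = br (a :: c'' :: u₂) := by
    rw [← List.cons_append, H.rotate]
  have h2 : br (u₁ ++ c' :: b :: v) = br (b :: (v ++ u₁) ++ [c']) := by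
    rw [H.rotate, H.append_comm]
    simp
  rw [h1, h2, mul_comm]

/-- The contributions to a place between two chords that are not idempotents cancel. If the two
neighbours are multipliable, this is the cutting relation for their product; otherwise all terms
vanish, because the chords next to the place cannot be adjacent. -/
theorem IsBracket.place_eq_zero {a b : Chord N} (ha : a.Nontrivial) (hb : b.Nontrivial)
    (u v : List (Chord N)) : place br t br (u ++ [a]) (b :: v) = 0 := by
  have h0 : orb t (fun d => br (u ++ [a] ++ d :: b :: v)) =
      t a.loopKind * br (u ++ a :: a.loop :: b :: v) := by
    simpa using H.orb_eq (u := u) (v := b :: v) (a := a)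
  rw [place, merge_concat, h0, H.splitRight_eq, H.splitLeft_eq]
  rcases hc : a.mul b with _ | c
  · have h1 : br (u ++ a :: a.loop :: b :: v) = 0 := by
      by_contra h
      obtain ⟨-, -, h1, h2⟩ := H.adj_append h
      have h' : br ((u ++ [a]) ++ a.loop :: b :: v) ≠ 0 := by simpa using h
      obtain ⟨-, -, h3, h4⟩ := H.adj_append h'
      have h5 : a.loop.target = a.target := by
        have := NeZero.pos N
        unfold Chord.loop
        split_ifs <;> simp [Chord.target, Nat.sub_add_cancel this]
      obtain ⟨c, h6⟩ := Chord.exists_mul ha hb (h5 ▸ h3) (by rw [h4, h2, Bool.not_not])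
      rw [hc] at h6
      cases h6
    have h2 : ∀ (l m : List (Chord N)) (c c' c'' : Chord N), (c', c'') ∈ c.factors →
        br (b :: l ++ [c']) * br (a :: c'' :: m) = 0 := by
      intro l m c c' c'' hf
      by_contra h
      obtain ⟨-, -, h1, h2⟩ := H.adj_last (left_ne_zero_of_mul h)
      obtain ⟨-, -, h3, h4⟩ := H.adj _ _ _ (right_ne_zero_of_mul h)
      obtain ⟨n', n'', hm⟩ := Chord.mem_factors.1 hf
      obtain ⟨k1, k2, -⟩ := Chord.mul_eq_some n' n'' hm
      obtain ⟨d, h6⟩ := Chord.exists_mul ha hb (h3.trans (k1.symm.trans h1))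
        (by rw [h2, ← k2, h4, Bool.not_not])
      rw [hc] at h6
      cases h6
    rw [h1, splitSum_eq_zero, splitSum_eq_zero]
    · simp
    · exact fun _ _ _ _ _ _ hf => h2 _ _ _ _ _ hf
    · exact fun _ _ _ _ _ _ hf => h2 _ _ _ _ _ hf
  · have h1 : br (u ++ c :: v) = br (c :: (v ++ u)) := by rw [H.append_comm]; rfl
    have h2 : br (u ++ a :: a.loop :: b :: v) = br (a :: a.loop :: b :: (v ++ u)) := by
      rw [H.append_comm]; rfl
    rw [Option.elim_some, h1, H.cut a b c _ ha hb hc, splitSum_append, h2]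
    simp only [List.cons_append, List.append_assoc]
    generalize t a.loopKind * br (a :: a.loop :: b :: (v ++ u)) = x
    generalize splitSum (S := S) _ v = y
    generalize splitSum (S := S) _ u = z
    have h := fun x : S => CharTwo.add_self_eq_zero x
    linear_combination h x + h y + h z

end terms

end

/-! ### Factorizations of products -/

section

section range
variable {S : Type*} [AddCommMonoid S]

theorem sum_range_three (k l : ℕ) (g : ℕ → S) : ∑ c ∈ Finset.range (k + l + 1), g c =
    ∑ m ∈ Finset.range k, g m + g k + ∑ m ∈ Finset.range l, g (k + 1 + m) := by
  rw [add_right_comm k l 1, Finset.sum_range_add, Finset.sum_range_succ]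

/-- The pairs of exponents with a given sum, enumerated by the second one. -/
theorem sum_range_left (k l : ℕ) (g : ℕ → ℕ → S) :
    ∑ m ∈ Finset.range k, g (l + k - m) m + g l k + ∑ m ∈ Finset.range l, g m (k + l - m) =
      ∑ c ∈ Finset.range (k + l + 1), g (k + l - c) c := by
  rw [sum_range_three, ← Finset.sum_range_reflect fun m => g m (k + l - m)]
  refine congrArg₂ _ (congrArg₂ _ (Finset.sum_congr rfl fun m hm => ?_) ?_)
    (Finset.sum_congr rfl fun m hm => ?_)
  · rw [add_comm l k]
  · rw [Nat.add_sub_cancel_left]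
  · rw [Finset.mem_range] at hm
    congr 1 <;> omega

/-- The pairs of exponents with a given sum, enumerated in the opposite direction. -/
theorem sum_range_right (k l : ℕ) (g : ℕ → ℕ → S) :
    ∑ m ∈ Finset.range l, g (m + k + 1) (l - 1 - m) + g k l +
      ∑ m ∈ Finset.range k, g (k - 1 - m) (m + l + 1) =
      ∑ c ∈ Finset.range (k + l + 1), g (k + l - c) c := by
  rw [add_comm k l, sum_range_three, ← Finset.sum_range_reflect fun m => g (l + k - m) m]
  refine congrArg₂ _ (congrArg₂ _ (Finset.sum_congr rfl fun m hm => ?_) ?_)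
    (Finset.sum_congr rfl fun m hm => ?_)
  · rw [Finset.mem_range] at hm
    congr 1; omega
  · rw [Nat.add_sub_cancel_left]
  · rw [Finset.mem_range] at hm
    congr 1 <;> omega

end range

namespace Chord
variable {N : ℕ} {S : Type*} [AddCommMonoid S]

theorem elim_ite (p : Prop) [Decidable p] (c : Chord N) (f : Chord N → S) :
    (if p then some c else none).elim 0 f = if p then f c else 0 := by
  split_ifs <;> rfl

/-- The factorizations of a product `ab`: they cut `a`, or between `a` and `b`, or they cut `b`. -/
theorem sum_factors_mul {a b : Chord N} (ha : a.Nontrivial) (hb : b.Nontrivial)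
    (f : Chord N → Chord N → S) :
    ((a.mul b).elim 0 fun c => ∑ x ∈ c.factors, f x.1 x.2) =
      ∑ x ∈ a.factors, (x.2.mul b).elim 0 (f x.1) + ((a.mul b).elim 0 fun _ => f a b) +
        ∑ x ∈ b.factors, (a.mul x.1).elim 0 fun d => f d x.2 := by
  rcases a with i | ⟨i, k⟩ | ⟨i, k⟩
  · exact ha.elim
  · rcases b with j | ⟨j, l⟩ | ⟨j, l⟩
    · exact hb.elim
    · rw [sum_factors_petal _ _ fun x y => (y.mul (petal j l)).elim 0 (f x),
        sum_factors_petal _ _ fun x y => ((petal i k).mul x).elim 0 fun d => f d y]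
      simp only [petal_mul_petal]
      by_cases h : i = j
      · subst h
        simp only [if_true, Option.elim_some]
        rw [sum_factors_petal, sum_range_three]
        refine congrArg₂ _ (congrArg₂ _ (Finset.sum_congr rfl fun m hm => ?_) ?_)
          (Finset.sum_congr rfl fun m hm => ?_)
        · rw [Finset.mem_range] at hm
          congr 2; omega
        · congr 2; omega
        · rw [Finset.mem_range] at hm
          congr 2 <;> omega
      · simp [h]
    · rw [sum_factors_petal _ _ fun x y => (y.mul (central j l)).elim 0 (f x),
        sum_factors_central _ _ fun x y => ((petal i k).mul x).elim 0 fun d => f d y]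
      simp [petal_mul_central]
  · rcases b with j | ⟨j, l⟩ | ⟨j, l⟩
    · exact hb.elim
    · rw [sum_factors_central _ _ fun x y => (y.mul (petal j l)).elim 0 (f x),
        sum_factors_petal _ _ fun x y => ((central i k).mul x).elim 0 fun d => f d y]
      simp [central_mul_petal]
    · rw [sum_factors_central _ _ fun x y => (y.mul (central j l)).elim 0 (f x),
        sum_factors_central _ _ fun x y => ((central i k).mul x).elim 0 fun d => f d y]
      simp only [central_mul_central]
      have h1 : ∀ m ∈ Finset.range k, i + ((m + 1 : ℕ) : ZMod N) + ((k - 1 - m + 1 : ℕ) : ZMod N) =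
          i + ((k + 1 : ℕ) : ZMod N) := by
        intro m hm
        rw [Finset.mem_range] at hm
        rw [add_assoc, ← Nat.cast_add, show m + 1 + (k - 1 - m + 1) = k + 1 by omega]
      rw [Finset.sum_congr rfl fun m hm => by rw [h1 m hm]]
      by_cases h : i + ((k + 1 : ℕ) : ZMod N) = j
      · subst h
        simp only [if_true, Option.elim_some]
        rw [sum_factors_central, sum_range_three]
        refine congrArg₂ _ (congrArg₂ _ (Finset.sum_congr rfl fun m hm => ?_) ?_)
          (Finset.sum_congr rfl fun m hm => ?_)
        · rw [Finset.mem_range] at hm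
          congr 2; omega
        · congr 2; omega
        · rw [Finset.mem_range] at hm
          congr 2
          · omega
          · push_cast; ring
          · omega
      · simp only [if_neg h, Option.elim_none, Finset.sum_const_zero, add_zero]

/-- Two descriptions of the chord that remains if `γ` is removed from the closed path of `b` and
`a`. -/
theorem sum_factors_cyclic {a b : Chord N} (ha : a.Nontrivial) (hb : b.Nontrivial)
    (f : Chord N → Chord N → S) :
    ∑ x ∈ a.factors, ((b.mul x.2).elim 0 fun z => f z x.1) +
        (if b.target = a.target ∧ b.isCentral = a.isCentral then f b a else 0) +
        ∑ x ∈ b.factors, (a.mul x.2).elim 0 (f x.1) =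
      ∑ x ∈ b.factors, ((x.1.mul a).elim 0 fun z => f z x.2) +
        (if b.source = a.source ∧ b.isCentral = a.isCentral then f a b else 0) +
        ∑ x ∈ a.factors, (x.1.mul b).elim 0 (f x.2) := by
  rcases a with i | ⟨i, k⟩ | ⟨i, k⟩
  · exact ha.elim
  · rcases b with j | ⟨j, l⟩ | ⟨j, l⟩
    · exact hb.elim
    · rw [sum_factors_petal _ _ fun x y => ((petal j l).mul y).elim 0 fun z => f z x,
        sum_factors_petal _ _ fun x y => ((petal i k).mul y).elim 0 (f x),
        sum_factors_petal _ _ fun x y => (x.mul (petal i k)).elim 0 fun z => f z y,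
        sum_factors_petal _ _ fun x y => (x.mul (petal j l)).elim 0 (f y)]
      simp only [petal_mul_petal, source, target, isCentral, and_true]
      by_cases h : i = j
      · subst h
        simp only [if_true, Option.elim_some]
        refine Eq.trans ?_ ((sum_range_left k l fun z g => f (petal i z) (petal i g)).trans
          (sum_range_right k l fun z g => f (petal i z) (petal i g)).symm)
        refine congrArg₂ _ (congrArg₂ _ (Finset.sum_congr rfl fun m hm => ?_) rfl)
          (Finset.sum_congr rfl fun m hm => ?_)
        · rw [Finset.mem_range] at hm
          congr 2; omega
        · rw [Finset.mem_range] at hm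
          congr 2; omega
      · simp [h, Ne.symm h]
    · rw [sum_factors_petal _ _ fun x y => ((central j l).mul y).elim 0 fun z => f z x,
        sum_factors_central _ _ fun x y => ((petal i k).mul y).elim 0 (f x),
        sum_factors_central _ _ fun x y => (x.mul (petal i k)).elim 0 fun z => f z y,
        sum_factors_petal _ _ fun x y => (x.mul (central j l)).elim 0 (f y)]
      simp [petal_mul_central, central_mul_petal, isCentral]
  · rcases b with j | ⟨j, l⟩ | ⟨j, l⟩
    · exact hb.elim
    · rw [sum_factors_central _ _ fun x y => ((petal j l).mul y).elim 0 fun z => f z x,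
        sum_factors_petal _ _ fun x y => ((central i k).mul y).elim 0 (f x),
        sum_factors_petal _ _ fun x y => (x.mul (central i k)).elim 0 fun z => f z y,
        sum_factors_central _ _ fun x y => (x.mul (petal j l)).elim 0 (f y)]
      simp [petal_mul_central, central_mul_petal, isCentral]
    · rw [sum_factors_central _ _ fun x y => ((central j l).mul y).elim 0 fun z => f z x,
        sum_factors_central _ _ fun x y => ((central i k).mul y).elim 0 (f x),
        sum_factors_central _ _ fun x y => (x.mul (central i k)).elim 0 fun z => f z y,
        sum_factors_central _ _ fun x y => (x.mul (central j l)).elim 0 (f y)]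
      simp only [central_mul_central, source, target, isCentral, and_true, elim_ite]
      have key := (sum_range_left k l fun z g => if j + ((z + 1 : ℕ) : ZMod N) = i + ((k + 1 : ℕ) :
          ZMod N) then f (central j z) (central i g) else 0).trans
        (sum_range_right k l fun z g => if j + ((z + 1 : ℕ) : ZMod N) = i + ((k + 1 : ℕ) :
          ZMod N) then f (central j z) (central i g) else 0).symm
      refine Eq.trans ?_ (key.trans ?_)
      · refine congrArg₂ _ (congrArg₂ _ (Finset.sum_congr rfl fun m hm => ?_) rfl)
          (Finset.sum_congr rfl fun m hm => ?_)
        · rw [Finset.mem_range] at hm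
          obtain ⟨q, rfl⟩ := Nat.exists_eq_add_of_lt hm
          rw [show m + q + 1 - 1 - m = q by omega, show l + (m + q + 1) - m = l + q + 1 by omega]
          refine if_congr ⟨fun h => ?_, fun h => ?_⟩ rfl rfl
          · push_cast at h ⊢; linear_combination h
          · push_cast at h ⊢; linear_combination h
        · rw [Finset.mem_range] at hm
          obtain ⟨q, rfl⟩ := Nat.exists_eq_add_of_lt hm
          rw [show m + q + 1 - 1 - m = q by omega, show k + (m + q + 1) - m = k + q + 1 by omega]
          exact if_congr eq_comm rfl rfl
      · refine congrArg₂ _ (congrArg₂ _ (Finset.sum_congr rfl fun m hm => ?_) ?_)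
          (Finset.sum_congr rfl fun m hm => ?_)
        · by_cases h : j + ((m + 1 : ℕ) : ZMod N) = i
          · rw [if_pos h, if_pos, h]
            rw [← h]; push_cast; ring
          · rw [if_neg h, if_neg]
            intro h'
            apply h
            push_cast at h' ⊢; linear_combination h'
        · by_cases h : j = i
          · rw [if_pos h, if_pos (by rw [h]), h]
          · rw [if_neg h, if_neg]
            exact fun h' => h (add_right_cancel h')
        · rw [Finset.mem_range] at hm
          obtain ⟨q, rfl⟩ := Nat.exists_eq_add_of_lt hm
          rw [show m + q + 1 - 1 - m = q by omega]
          by_cases h : i + ((m + 1 : ℕ) : ZMod N) = j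
          · rw [if_pos h, if_pos, h]
            rw [← h]; push_cast; ring
          · rw [if_neg h, if_neg]
            intro h'
            apply h
            push_cast at h' ⊢; linear_combination -h'

end Chord

end

/-! ### Centered and extended graphs -/

section

variable {N : ℕ} {S : Type*} [CommRing S]

theorem splitSum_mul (f : List (Chord N) → Chord N → Chord N → List (Chord N) → S)
    (l : List (Chord N)) (x : S) :
    splitSum (fun u c' c'' v => f u c' c'' v * x) l = splitSum f l * x := by
  induction l generalizing f with
  | nil => simp [splitSum]
  | cons a l ih => simp only [splitSum]; rw [ih, add_mul, Finset.sum_mul]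

theorem splitSum_factors (f : List (Chord N) → Chord N → Chord N → Chord N → List (Chord N) → S)
    (l : List (Chord N)) :
    splitSum (fun u c' c'' v => ∑ y ∈ c'.factors, f u y.1 y.2 c'' v) l =
      splitSum (fun u c' c'' v => ∑ y ∈ c''.factors, f u c' y.1 y.2 v) l := by
  induction l generalizing f with
  | nil => rfl
  | cons a l ih =>
    simp only [splitSum]
    rw [ih fun u => f (a :: u), Chord.sum_factors_assoc a fun x y z => f [] x y z l]

theorem cutSum_mul {A : Type*} (f : List A → List A → S) (l : List A) (x : S) :
    cutSum (fun u v => f u v * x) l = cutSum f l * x := by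
  induction l generalizing f with
  | nil => rfl
  | cons a l ih =>
    change _ + cutSum _ l = (_ + cutSum _ l) * x
    rw [ih, add_mul]

theorem merge_sum {ι : Type*} (s : Finset ι) (Φ : ι → List (Chord N) → S) (u v : List (Chord N)) :
    merge (fun l => ∑ i ∈ s, Φ i l) u v = ∑ i ∈ s, merge (Φ i) u v := by
  rcases List.eq_nil_or_concat u with rfl | ⟨u, a, rfl⟩
  · simp [merge]
  · rw [List.concat_eq_append]
    rcases v with _ | ⟨b, v⟩
    · simp [merge_nil]
    · simp only [merge_concat]
      cases a.mul b <;> simp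

theorem merge_mul (Φ : List (Chord N) → S) (u v : List (Chord N)) (x : S) :
    merge (fun l => Φ l * x) u v = merge Φ u v * x := by
  rcases List.eq_nil_or_concat u with rfl | ⟨u, a, rfl⟩
  · simp [merge]
  · rw [List.concat_eq_append]
    rcases v with _ | ⟨b, v⟩
    · simp [merge_nil]
    · simp only [merge_concat]
      cases a.mul b <;> simp

theorem merge_add (Φ Ψ : List (Chord N) → S) (u v : List (Chord N)) :
    merge (fun l => Φ l + Ψ l) u v = merge Φ u v + merge Ψ u v := by
  rcases List.eq_nil_or_concat u with rfl | ⟨u, a, rfl⟩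
  · simp [merge]
  · rw [List.concat_eq_append]
    rcases v with _ | ⟨b, v⟩
    · simp [merge_nil]
    · simp only [merge_concat]
      cases a.mul b <;> simp

/-- The sum over the factorizations of the last entry of a list. -/
def lastSum (f : List (Chord N) → Chord N → S) : List (Chord N) → S
  | [] => 0
  | [b] => ∑ x ∈ b.factors, f [x.1] x.2
  | a :: b :: m => lastSum (fun u => f (a :: u)) (b :: m)

theorem lastSum_concat (f : List (Chord N) → Chord N → S) (u : List (Chord N)) (b : Chord N) :
    lastSum f (u ++ [b]) = ∑ x ∈ b.factors, f (u ++ [x.1]) x.2 := by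
  induction u generalizing f with
  | nil => rfl
  | cons a u ih =>
    cases u with
    | nil => rfl
    | cons e u => exact ih fun u => f (a :: u)

section functionals
variable (br : List (Chord N) → S) (φ : Chord N → S)

/-- The value of `φ` on the sum of the outputs of centered graphs. -/
def centered : List (Chord N) → S
  | [] => 0
  | b :: m => br (b :: m) * φ (.idem b.source)

/-- The value of `φ` on the sum of the outputs of left extended graphs. -/
def leftExt : List (Chord N) → S
  | [] => 0
  | b :: m => ∑ x ∈ b.factors, br (x.2 :: m) * φ x.1

/-- The value of `φ` on the sum of the outputs of right extended graphs. -/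
def rightExt (l : List (Chord N)) : S := lastSum (fun u c => br u * φ c) l

theorem rightExt_concat (u : List (Chord N)) (b : Chord N) :
    rightExt br φ (u ++ [b]) = ∑ x ∈ b.factors, br (u ++ [x.1]) * φ x.2 :=
  lastSum_concat _ _ _

end functionals

theorem Chord.mul_source {a b c : Chord N} (h : a.mul b = some c) : c.source = a.source := by
  rcases a with i | ⟨i, k⟩ | ⟨i, k⟩ <;> rcases b with j | ⟨j, l⟩ | ⟨j, l⟩ <;>
    simp only [Chord.mul, Chord.source] at h ⊢ <;> (try split_ifs at h) <;> simp_all <;>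
    simp [← h]

variable [NeZero N] {br : List (Chord N) → S} {t : Option (ZMod N) → S} {φ : Chord N → S}

/-- The output of a centered graph depends only on its first input, so a place after that input sees
only the graph. -/
theorem place_centered (a : Chord N) (u v : List (Chord N)) :
    place br t (centered br φ) (a :: u) v = place br t br (a :: u) v * φ (.idem a.source) := by
  have h1 : orb t (fun c => centered br φ (a :: u ++ c :: v)) =
      orb t (fun c => br (a :: u ++ c :: v)) * φ (.idem a.source) := by rw [← orb_mul]; rfl
  have h2 : merge (centered br φ) (a :: u) v = merge br (a :: u) v * φ (.idem a.source) := by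
    rcases v with _ | ⟨b, v⟩
    · simp [merge_nil]
    rcases u with _ | ⟨e, u⟩
    · rw [merge, merge]
      rcases h : a.mul b with _ | c
      · simp
      · simp [centered, Chord.mul_source h]
    · rw [merge_cons a (by simp), merge_cons a (by simp), ← merge_mul]
      rfl
  have h3 : splitRight br (centered br φ) (a :: u) v =
      splitRight br br (a :: u) v * φ (.idem a.source) := by
    rw [splitRight, splitRight, ← splitSum_mul]
    exact splitSum_congr fun _ _ _ _ _ _ _ => by simp [centered, mul_assoc]
  have h4 : splitLeft br (centered br φ) (a :: u) v =
      splitLeft br br (a :: u) v * φ (.idem a.source) := by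
    rw [splitLeft, splitLeft, splitSum, splitSum, add_mul, Finset.sum_mul, ← splitSum_mul]
    congr 1
    · refine Finset.sum_congr rfl fun x hx => ?_
      have := Chord.mul_source (Chord.mem_factors.1 hx).2.2
      simp [centered, this, mul_assoc]
    · exact splitSum_congr fun _ _ _ _ _ _ _ => by simp [centered, mul_assoc]
  rw [place, place, h1, h2, h3, h4]
  ring

/-- The products of the first two inputs which are not accounted for by `leftExt`. -/
def mergeLeft (br : List (Chord N) → S) (φ : Chord N → S) (a : Chord N) : List (Chord N) → S
  | [] => 0
  | b :: m => ((a.mul b).elim 0 fun _ => br (b :: m) * φ a) +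
      ∑ x ∈ b.factors, (a.mul x.1).elim 0 fun d => br (x.2 :: m) * φ d

/-- A place after the first input of a left extended graph: the graph sees only the second factor
`x.2` of that input. The products `a b` whose factorization cuts `b` are the correction `mergeLeft`.
-/
theorem place_leftExt {a : Chord N} (ha : a.Nontrivial) (u : List (Chord N)) {v : List (Chord N)}
    (hv : ∀ c ∈ v, c.Nontrivial) :
    place br t (leftExt br φ) (a :: u) v =
      ∑ x ∈ a.factors, place br t br (x.2 :: u) v * φ x.1 +
        if u = [] then mergeLeft br φ a v else 0 := by
  have h1 : orb t (fun c => leftExt br φ (a :: u ++ c :: v)) =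
      ∑ x ∈ a.factors, orb t (fun c => br (x.2 :: u ++ c :: v)) * φ x.1 := by
    simp only [← orb_mul]
    rw [← orb_sum]
    rfl
  have h2 : merge (leftExt br φ) (a :: u) v = ∑ x ∈ a.factors, merge br (x.2 :: u) v * φ x.1 +
        if u = [] then mergeLeft br φ a v else 0 := by
    rcases v with _ | ⟨b, v⟩
    · simp [merge_nil, mergeLeft]
    rcases u with _ | ⟨e, u⟩
    · rw [if_pos rfl]
      simp only [merge, mergeLeft]
      rw [← add_assoc]
      refine (Chord.sum_factors_mul ha (hv b (by simp)) fun x y => br (y :: v) * φ x).trans ?_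
      congr 2
      refine Finset.sum_congr rfl fun x _ => ?_
      cases x.2.mul b <;> simp
    · rw [merge_cons a (by simp), if_neg (by simp), add_zero]
      have : ∀ x, merge br (x :: e :: u) (b :: v) =
          merge (fun l => br (x :: l)) (e :: u) (b :: v) := fun x => merge_cons x (by simp) _
      simp only [this, ← merge_mul]
      rw [← merge_sum]
      rfl
  have h3 : splitRight br (leftExt br φ) (a :: u) v =
      ∑ x ∈ a.factors, splitRight br br (x.2 :: u) v * φ x.1 := by
    simp only [splitRight, ← splitSum_mul]
    rw [← splitSum_sum]
    refine splitSum_congr fun _ _ _ _ _ _ _ => ?_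
    simp [leftExt, mul_assoc, Finset.mul_sum]
  have h4 : splitLeft br (leftExt br φ) (a :: u) v =
      ∑ x ∈ a.factors, splitLeft br br (x.2 :: u) v * φ x.1 := by
    simp only [splitLeft, splitSum, add_mul, ← splitSum_mul, Finset.sum_add_distrib]
    rw [← splitSum_sum]
    congr 1
    · simp only [List.nil_append, leftExt, Finset.mul_sum, Finset.sum_mul]
      rw [Chord.sum_factors_assoc a fun x y z => br (z :: u) * (br (y :: v) * φ x)]
      simp only [mul_assoc]
    · refine splitSum_congr fun _ _ _ _ _ _ _ => ?_
      simp [leftExt, mul_assoc, Finset.mul_sum]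
  simp only [place, add_mul, Finset.sum_add_distrib]
  rw [h1, h2, h3, h4]
  ring

/-- The products of the last two inputs which are not accounted for by `rightExt`. -/
def mergeRight (br : List (Chord N) → S) (φ : Chord N → S) (l : List (Chord N)) (b : Chord N) : S :=
  merge (fun _ => br l * φ b) l [b] +
    lastSum (fun u y => (y.mul b).elim 0 fun d => br u * φ d) l

/-- The mirror image of `place_leftExt`. -/
theorem place_rightExt {b : Chord N} (hb : b.Nontrivial) {u : List (Chord N)} (v : List (Chord N))
    (hu : ∀ c ∈ u, c.Nontrivial) :
    place br t (rightExt br φ) u (v ++ [b]) =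
      ∑ x ∈ b.factors, place br t br u (v ++ [x.1]) * φ x.2 +
        if v = [] then mergeRight br φ u b else 0 := by
  have h0 : ∀ w c v, rightExt br φ (w ++ c :: (v ++ [b])) =
      ∑ x ∈ b.factors, br (w ++ c :: (v ++ [x.1])) * φ x.2 := by
    intro w c v
    simpa using rightExt_concat br φ (w ++ c :: v) b
  have h1 : orb t (fun c => rightExt br φ (u ++ c :: (v ++ [b]))) =
      ∑ x ∈ b.factors, orb t (fun c => br (u ++ c :: (v ++ [x.1]))) * φ x.2 := by
    simp only [← orb_mul]
    rw [← orb_sum]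
    simp only [h0]
  have h2 : merge (rightExt br φ) u (v ++ [b]) = ∑ x ∈ b.factors, merge br u (v ++ [x.1]) * φ x.2 +
        if v = [] then mergeRight br φ u b else 0 := by
    rcases List.eq_nil_or_concat u with rfl | ⟨u, a, rfl⟩
    · simp [merge, mergeRight, lastSum]
    rw [List.concat_eq_append] at hu ⊢
    rcases v with _ | ⟨e, v⟩
    · rw [if_pos rfl]
      simp only [List.nil_append, merge_concat, mergeRight, lastSum_concat]
      refine Eq.trans ?_ ((Chord.sum_factors_mul (hu a (by simp)) hb
        fun x y => br (u ++ [x]) * φ y).trans ?_)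
      · cases a.mul b <;> simp [rightExt_concat]
      · have : ∀ x : Chord N × Chord N, (Option.elim (a.mul x.1) 0 fun c => br (u ++ [c])) * φ x.2 =
          Option.elim (a.mul x.1) 0 fun c => br (u ++ [c]) * φ x.2 := by
          intro x
          cases a.mul x.1 <;> simp
        simp only [this]
        ring
    · rw [if_neg (by simp), add_zero]
      simp only [List.cons_append, merge_concat]
      cases a.mul e <;> simp [h0]
  have h3 : splitRight br (rightExt br φ) u (v ++ [b]) =
      ∑ x ∈ b.factors, splitRight br br u (v ++ [x.1]) * φ x.2 := by
    simp only [splitRight, splitSum_append, add_mul, ← splitSum_mul, Finset.sum_add_distrib]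
    rw [← splitSum_sum]
    congr 1
    · refine splitSum_congr fun _ _ _ _ _ _ _ => ?_
      simp only [h0, Finset.mul_sum, mul_assoc]
    · simp only [splitSum, add_zero, rightExt_concat, Finset.mul_sum, List.append_nil]
      rw [← Chord.sum_factors_assoc b fun x y z => br (v ++ [x]) * (br (u ++ [y]) * φ z)]
      simp only [mul_assoc]
  have h4 : splitLeft br (rightExt br φ) u (v ++ [b]) =
      ∑ x ∈ b.factors, splitLeft br br u (v ++ [x.1]) * φ x.2 := by
    simp only [splitLeft, ← splitSum_mul]
    rw [← splitSum_sum]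
    refine splitSum_congr fun _ _ _ _ _ _ _ => ?_
    simp only [h0, Finset.mul_sum, mul_assoc]
  simp only [place, add_mul, Finset.sum_add_distrib]
  rw [h1, h2, h3, h4]
  ring

end

/-! ### Cancellation for inputs that are not idempotents -/

section

variable {N : ℕ} {S : Type*} [CommRing S]

theorem cutSum_ends {A : Type*} {f : List A → List A → S} {l : List A} (hl : l ≠ [])
    (h : ∀ u v, u ≠ [] → v ≠ [] → u ++ v = l → f u v = 0) : cutSum f l = f [] l + f l [] := by
  rcases l with _ | ⟨a, l⟩
  · exact absurd rfl hl
  change f [] (a :: l) + cutSum (fun u v => f (a :: u) v) l = _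
  rw [cutSum_eq_right]
  intro u v b huv
  exact h _ _ (by simp) (by simp) (by rw [List.cons_append, huv])

theorem cutSum_cons_concat {A : Type*} (f : List A → List A → S) (a b : A) (m : List A) :
    cutSum f (a :: (m ++ [b])) = f [] (a :: (m ++ [b])) +
      cutSum (fun u v => f (a :: u) (v ++ [b])) m + f (a :: (m ++ [b])) [] := by
  rw [cutSum, cutSum_concat, add_assoc]

/-- The value of `φ` on the sum of the outputs of the graphs with given inputs. -/
def graphOp (br : List (Chord N) → S) (φ : Chord N → S) (l : List (Chord N)) : S :=
  centered br φ l + leftExt br φ l + rightExt br φ l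

variable [NeZero N] {br : List (Chord N) → S} {t : Option (ZMod N) → S} {φ : Chord N → S}

theorem place_add (Φ Ψ : List (Chord N) → S) (u v : List (Chord N)) :
    place br t (fun l => Φ l + Ψ l) u v = place br t Φ u v + place br t Ψ u v := by
  simp only [place, orb_add, merge_add, splitRight, splitLeft, mul_add, splitSum_add]
  ring

theorem cutSum_place_graphOp (l : List (Chord N)) : cutSum (place br t (graphOp br φ)) l =
    cutSum (place br t (centered br φ)) l + cutSum (place br t (leftExt br φ)) l +
      cutSum (place br t (rightExt br φ)) l := by
  rw [← cutSum_add, ← cutSum_add]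
  refine cutSum_congr fun u v _ => ?_
  rw [← place_add, ← place_add]
  rfl

theorem place_nil_left (Φ : List (Chord N) → S) (l : List (Chord N)) :
    place br t Φ [] l = orb t (fun c => Φ (c :: l)) + splitRight br Φ [] l := by
  simp [place, merge, splitLeft, splitSum]

theorem place_nil_right (Φ : List (Chord N) → S) (l : List (Chord N)) :
    place br t Φ l [] = orb t (fun c => Φ (l ++ [c])) + splitLeft br Φ l [] := by
  simp [place, merge_nil, splitRight, splitSum]

variable [CharP S 2] (H : IsBracket br t)
include H

theorem IsBracket.place_eq_zero_of_ne_nil {u v : List (Chord N)} (hu : u ≠ []) (hv : v ≠ [])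
    (nu : ∀ c ∈ u, c.Nontrivial) (nv : ∀ c ∈ v, c.Nontrivial) : place br t br u v = 0 := by
  rcases List.eq_nil_or_concat u with rfl | ⟨u, a, rfl⟩
  · exact absurd rfl hu
  rcases v with _ | ⟨b, v⟩
  · exact absurd rfl hv
  rw [List.concat_eq_append] at nu ⊢
  exact H.place_eq_zero (nu a (by simp)) (nv b (by simp)) u v

/-- Also the contributions of the first and the last place cancel each other, by cyclic symmetry. -/
theorem IsBracket.cutSum_place {l : List (Chord N)} (hl : l ≠ []) (nl : ∀ c ∈ l, c.Nontrivial) :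
    cutSum (place br t br) l = 0 := by
  rw [cutSum_ends hl, place_nil_left, place_nil_right]
  · have h1 : orb t (fun c => br (l ++ [c])) = orb t (fun c => br (c :: l)) := by
      simp only [H.rotate]
    have h2 : splitLeft br br l [] = splitRight br br [] l := by
      simp only [splitLeft, splitRight, List.nil_append]
      exact splitSum_congr fun _ _ _ _ _ _ _ => mul_comm _ _
    rw [h1, h2]
    exact CharTwo.add_self_eq_zero _
  · intro u v hu hv huv
    subst huv
    exact H.place_eq_zero_of_ne_nil hu hv (fun c hc => nl c (by simp [hc]))
      fun c hc => nl c (by simp [hc])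

omit [CharP S 2] in
theorem IsBracket.place_centered_nil (a : Chord N) (m : List (Chord N)) :
    place br t (centered br φ) [] (a :: m) = place br t br [] (a :: m) * φ (.idem a.source) := by
  rw [place_nil_left, place_nil_left, add_mul, ← orb_mul, splitRight, splitRight, ← splitSum_mul]
  congr 1
  · unfold orb
    refine Finset.sum_congr rfl fun i _ => ?_
    have h1 : ∀ c : Chord N, c.source = c.target →
        centered br φ (c :: a :: m) = br (c :: a :: m) * φ (.idem a.source) := by
      intro c hc
      by_cases h : br (c :: a :: m) = 0
      · simp [centered, h]
      · rw [centered, hc, (H.adj _ _ _ h).2.2.1]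
    beta_reduce
    rw [h1, h1]
    · have := NeZero.pos N
      simp [Chord.source, Chord.target, Nat.sub_add_cancel this]
    · rfl
  · refine splitSum_congr fun u c c' c'' v huv hc => ?_
    rcases u with _ | ⟨e, u⟩
    · simp [H.single]
    · simp only [List.cons_append, List.cons.injEq] at huv
      obtain ⟨rfl, -⟩ := huv
      by_cases h : br (e :: (u ++ [c'])) = 0
      · simp [h]
      · obtain ⟨n', n'', hm⟩ := Chord.mem_factors.1 hc
        rw [List.nil_append, centered, ← (Chord.mul_eq_some n' n'' hm).1, (H.adj_last h).2.2.1,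
          mul_assoc]

theorem IsBracket.cutSum_place_centered {l : List (Chord N)} (nl : ∀ c ∈ l, c.Nontrivial) :
    cutSum (place br t (centered br φ)) l =
      if l = [] then orb t (fun c => centered br φ [c]) else 0 := by
  rcases l with _ | ⟨a, m⟩
  · simp [cutSum, place, merge, splitLeft, splitRight, splitSum]
  rw [if_neg (by simp), ← zero_mul (φ (.idem a.source)), ← H.cutSum_place (List.cons_ne_nil a m) nl,
    ← cutSum_mul]
  refine cutSum_congr fun u v huv => ?_
  rcases u with _ | ⟨e, u⟩
  · rw [List.nil_append] at huv
    subst huv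
    exact H.place_centered_nil a m
  · simp only [List.cons_append, List.cons.injEq] at huv
    obtain ⟨rfl, -⟩ := huv
    exact place_centered _ _ _

omit [CharP S 2] in
/-- The insertion of an element `U_o` before the first input of a left extended graph contributes
the same as the insertion after the last input of a right extended graph. -/
theorem IsBracket.orb_leftExt (l : List (Chord N)) :
    orb t (fun c => leftExt br φ (c :: l)) = orb t (fun c => rightExt br φ (l ++ [c])) := by
  have h : ∀ i k, leftExt br φ (.petal i k :: l) = rightExt br φ (l ++ [.petal i k]) := by
    intro i k
    simp only [leftExt, rightExt_concat, H.rotate]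
    rw [Chord.sum_factors_petal i k fun x y => br (y :: l) * φ x,
      Chord.sum_factors_petal i k fun x y => br (x :: l) * φ y, ← Finset.sum_range_reflect]
    refine Finset.sum_congr rfl fun m hm => ?_
    rw [Finset.mem_range] at hm
    rw [show k - 1 - (k - 1 - m) = m by omega]
  simp only [orb, Finset.sum_add_distrib, h]
  congr 1
  simp only [leftExt, rightExt_concat, H.rotate]
  have h1 := fun i : ZMod N => Chord.sum_factors_central i (N - 1) fun x y => br (y :: l) * φ x
  have h2 := fun i : ZMod N => Chord.sum_factors_central i (N - 1) fun x y => br (x :: l) * φ y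
  simp only [h1, h2, Finset.mul_sum]
  rw [Finset.sum_comm, Finset.sum_comm (s := Finset.univ), ← Finset.sum_range_reflect]
  refine Finset.sum_congr rfl fun m hm => ?_
  rw [Finset.mem_range] at hm
  rw [show N - 1 - 1 - (N - 1 - 1 - m) = m by omega]
  refine Fintype.sum_equiv (Equiv.addRight ((N - 1 - 1 - m + 1 : ℕ) : ZMod N)) _ _ fun i => ?_
  have : i + ((N - 1 - 1 - m + 1 : ℕ) : ZMod N) + ((m + 1 : ℕ) : ZMod N) = i := by
    rw [add_assoc, ← Nat.cast_add, show N - 1 - 1 - m + 1 + (m + 1) = N by omega]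
    simp
  rw [Equiv.coe_addRight, this]

omit H [CharP S 2] in
omit [NeZero N] in
/-- An outer left extended graph with an inner right extended graph in front cuts a chord into three
parts, and so does an outer right extended graph with an inner left extended graph at the end. The
two splittings agree by coassociativity. -/
theorem splitRight_leftExt (l : List (Chord N)) :
    splitRight br (leftExt br φ) [] l = splitLeft br (rightExt br φ) l [] := by
  simp only [splitRight, splitLeft, rightExt_concat, List.nil_append, leftExt, Finset.mul_sum]
  rw [splitSum_factors fun u x y z v => br (z :: v) * (br (u ++ [x]) * φ y)]
  refine splitSum_congr fun _ _ _ _ _ _ _ => Finset.sum_congr rfl fun x _ => ?_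
  ring

/-- By cyclic symmetry the last place looks like the place between the last and the first chord,
except that the product of these two is missing. -/
theorem IsBracket.place_last {b x : Chord N} (hb : b.Nontrivial) (hx : x.Nontrivial)
    (m : List (Chord N)) :
    place br t br (x :: (m ++ [b])) [] = (b.mul x).elim 0 fun z => br (z :: m) := by
  have h := H.place_eq_zero hb hx m []
  rw [place, merge_concat] at h
  have h1 : splitRight br br (m ++ [b]) [x] = 0 := by simp [splitRight, splitSum, H.single]
  have h2 : splitLeft br br (x :: (m ++ [b])) [] = splitLeft br br (m ++ [b]) [x] := by
    simp only [splitLeft, splitSum, List.nil_append, H.single, mul_zero, Finset.sum_const_zero,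
      zero_add]
    refine splitSum_congr fun u _ c' c'' v _ _ => ?_
    have : br (x :: (u ++ [c'])) = br (u ++ c' :: [x]) := by
      rw [← H.rotate, List.append_assoc]
      rfl
    exact congrArg (br (c'' :: v) * ·) this
  have h3 : orb t (fun c => br (x :: (m ++ [b]) ++ [c])) =
      orb t (fun c => br (m ++ [b] ++ c :: [x])) := by
    congr 1; funext c
    rw [List.cons_append, ← H.rotate, List.append_assoc]
    rfl
  have h4 : (b.mul x).elim 0 (fun c => br (m ++ [c])) = (b.mul x).elim 0 fun z => br (z :: m) := by
    congr 1; funext c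
    exact H.rotate _ _
  rw [place_nil_right, h2, h3]
  rw [h4] at h
  linear_combination h - h1 - CharTwo.add_self_eq_zero
    (Option.elim (b.mul x) 0 fun z => br (z :: m))

/-- The mirror image of `place_last`. -/
theorem IsBracket.place_first {a x : Chord N} (ha : a.Nontrivial) (hx : x.Nontrivial)
    (m : List (Chord N)) :
    place br t br [] (a :: (m ++ [x])) = (x.mul a).elim 0 fun z => br (z :: m) := by
  have h := H.place_eq_zero hx ha [] m
  rw [place, merge_concat] at h
  simp only [List.nil_append] at h
  have h1 : splitLeft br br [x] (a :: m) = 0 := by simp [splitLeft, splitSum, H.single]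
  have h2 : splitRight br br [] (a :: (m ++ [x])) = splitRight br br [x] (a :: m) := by
    rw [← List.cons_append, splitRight]
    refine (splitSum_append _ _ _).trans ?_
    refine Eq.trans (congrArg₂ (· + ·) (splitSum_congr fun u _ c' c'' v _ _ => ?_) ?_)
      (add_zero (splitRight br br [x] (a :: m)))
    · have : br (c'' :: (v ++ [x])) = br (x :: c'' :: v) := by
        rw [← List.cons_append, H.rotate]
      exact congrArg (br (u ++ [c']) * ·) this
    · simp [splitSum, H.single]
  have h3 : orb t (fun c => br (c :: a :: (m ++ [x]))) =
      orb t (fun c => br ([x] ++ c :: a :: m)) := by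
    congr 1; funext c
    rw [← List.cons_append, ← List.cons_append, H.rotate]
    rfl
  rw [place_nil_left, h2, h3]
  linear_combination h - h1 - CharTwo.add_self_eq_zero
    (Option.elim (x.mul a) 0 fun z => br (z :: m))

omit [NeZero N] in
/-- The first input `a`, multiplied from the left to the output of a graph with the inputs `m ++
[b]`, together with `mergeLeft`. What remains are the terms whose output consists of `a` and a
(possibly empty) final part of `b`. -/
theorem IsBracket.mergeLeft_add {a b : Chord N} (ha : a.Nontrivial) (m : List (Chord N)) :
    mergeLeft br φ a (m ++ [b]) + graphOp br (fun c => (a.mul c).elim 0 φ) (m ++ [b]) =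
      (if b.target = a.target ∧ b.isCentral = a.isCentral then br (b :: m) * φ a else 0) +
        ∑ x ∈ b.factors, (a.mul x.2).elim 0 fun d => br (x.1 :: m) * φ d := by
  have h1 : rightExt br (fun c => (a.mul c).elim 0 φ) (m ++ [b]) =
      ∑ x ∈ b.factors, (a.mul x.2).elim 0 fun d => br (x.1 :: m) * φ d := by
    rw [rightExt_concat]
    refine Finset.sum_congr rfl fun x _ => ?_
    rw [H.rotate]
    cases a.mul x.2 <;> simp
  rw [graphOp, h1, ← add_assoc, ← H.rotate]
  congr 1
  obtain ⟨e, w, hw⟩ : ∃ e w, m ++ [b] = e :: w := by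
    cases m with
    | nil => exact ⟨_, _, rfl⟩
    | cons e m => exact ⟨e, m ++ [b], rfl⟩
  have h2 : leftExt br (fun c => (a.mul c).elim 0 φ) (e :: w) =
      ∑ x ∈ e.factors, (a.mul x.1).elim 0 fun d => br (x.2 :: w) * φ d := by
    refine Finset.sum_congr rfl fun x _ => ?_
    dsimp only
    cases a.mul x.1 <;> simp
  rw [hw, h2, mergeLeft, centered]
  generalize (∑ x ∈ e.factors, (a.mul x.1).elim 0 fun d => br (x.2 :: w) * φ d) = y
  have h3 : ((a.mul e).elim 0 fun _ => br (e :: w) * φ a) +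
      br (e :: w) * ((a.mul (.idem e.source)).elim 0 φ) =
      if b.target = a.target ∧ b.isCentral = a.isCentral then br (e :: w) * φ a else 0 := by
    by_cases h0 : br (e :: w) = 0
    · rw [h0]
      cases a.mul e <;> simp
    have hbe : Adj b e := by
      rcases m with _ | ⟨e', m⟩
      · rw [← hw] at h0
        exact absurd (H.single _) h0
      · simp only [List.cons_append, List.cons.injEq] at hw
        obtain ⟨rfl, rfl⟩ := hw
        exact H.adj_last h0
    obtain ⟨nb, ne, h4, h5⟩ := hbe
    rw [Chord.mul_idem]
    by_cases h6 : a.target = e.source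
    · rw [if_pos h6, h4, h6]
      by_cases h7 : e.isCentral = a.isCentral
      · obtain ⟨c, hc⟩ := Chord.exists_mul ha ne h6 h7
        rw [hc, if_neg]
        · exact CharTwo.add_self_eq_zero _
        · rw [← h7, h5]; simp
      · have : a.mul e = none := by
          rcases hc : a.mul e with _ | c
          · rfl
          · exact absurd (Chord.mul_eq_some ha ne hc).2.1 h7
        rw [this, if_pos, Option.elim_none, Option.elim_some, zero_add]
        refine ⟨rfl, ?_⟩
        revert h5 h7
        cases e.isCentral <;> cases a.isCentral <;> cases b.isCentral <;> simp
    · have : a.mul e = none := by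
        rcases hc : a.mul e with _ | c
        · rfl
        · exact absurd (Chord.mul_eq_some ha ne hc).1 h6
      rw [this, if_neg h6, if_neg]
      · simp
      · rw [h4]; exact fun h => h6 h.1.symm
  linear_combination h3 + CharTwo.add_self_eq_zero y

omit [NeZero N] in
/-- The mirror image of `mergeLeft_add`. -/
theorem IsBracket.mergeRight_add {a b : Chord N} (hb : b.Nontrivial) (m : List (Chord N)) :
    mergeRight br φ (a :: m) b + graphOp br (fun c => (c.mul b).elim 0 φ) (a :: m) =
      (if b.source = a.source ∧ b.isCentral = a.isCentral then br (a :: m) * φ b else 0) +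
        ∑ x ∈ a.factors, (x.1.mul b).elim 0 fun d => br (x.2 :: m) * φ d := by
  have h1 : leftExt br (fun c => (c.mul b).elim 0 φ) (a :: m) =
      ∑ x ∈ a.factors, (x.1.mul b).elim 0 fun d => br (x.2 :: m) * φ d := by
    refine Finset.sum_congr rfl fun x _ => ?_
    dsimp only
    cases x.1.mul b <;> simp
  have h2 : lastSum (fun u y => (y.mul b).elim 0 fun d => br u * φ d) (a :: m) =
      rightExt br (fun c => (c.mul b).elim 0 φ) (a :: m) := by
    rw [rightExt]
    congr 1; funext u y
    cases y.mul b <;> simp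
  obtain ⟨e, w, hw⟩ : ∃ e w, a :: m = w ++ [e] := by
    rcases List.eq_nil_or_concat (a :: m) with h | ⟨w, e, h⟩
    · cases h
    · exact ⟨e, w, by rw [h, List.concat_eq_append]⟩
  have h3 : merge (fun _ => br (a :: m) * φ b) (a :: m) [b] +
      br (a :: m) * (((Chord.idem a.source).mul b).elim 0 φ) =
      if b.source = a.source ∧ b.isCentral = a.isCentral then br (a :: m) * φ b else 0 := by
    by_cases h0 : br (a :: m) = 0
    · rw [h0]
      conv_lhs => rw [hw, merge_concat]
      cases e.mul b <;> simp
    have hbe : Adj e a := by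
      rcases w with _ | ⟨e', w⟩
      · rw [hw] at h0
        exact absurd (H.single _) h0
      · simp only [List.cons_append, List.cons.injEq] at hw
        obtain ⟨rfl, rfl⟩ := hw
        exact H.adj_last h0
    obtain ⟨ne, na, h4, h5⟩ := hbe
    have hm : ∀ X : S, merge (fun _ => X) (a :: m) [b] = (e.mul b).elim 0 fun _ => X := by
      intro X
      rw [hw, merge_concat]
    rw [Chord.idem_mul, hm]
    by_cases h6 : a.source = b.source
    · rw [if_pos h6, h6]
      by_cases h7 : b.isCentral = e.isCentral
      · obtain ⟨c, hc⟩ := Chord.exists_mul ne hb (h4.trans h6) h7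
        rw [hc, if_neg]
        · exact CharTwo.add_self_eq_zero _
        · rw [h7, h5]; simp
      · have : e.mul b = none := by
          rcases hc : e.mul b with _ | c
          · rfl
          · exact absurd (Chord.mul_eq_some ne hb hc).2.1 h7
        rw [this, if_pos, Option.elim_none, Option.elim_some, zero_add]
        refine ⟨rfl, ?_⟩
        revert h5 h7
        cases e.isCentral <;> cases a.isCentral <;> cases b.isCentral <;> simp
    · have : e.mul b = none := by
        rcases hc : e.mul b with _ | c
        · rfl
        · exact absurd (h4.symm.trans (Chord.mul_eq_some ne hb hc).1) h6
      rw [this, if_neg h6, if_neg]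
      · simp
      · exact fun h => h6 h.1.symm
  rw [mergeRight, graphOp, h1, h2, centered]
  linear_combination h3 + CharTwo.add_self_eq_zero
    (rightExt br (fun c => (c.mul b).elim 0 φ) (a :: m))

/-- The cancellation for at least two inputs, none of them an idempotent. -/
theorem IsBracket.relation_of_two {a b : Chord N} {m : List (Chord N)} (ha : a.Nontrivial)
    (hb : b.Nontrivial) (hm : ∀ c ∈ m, c.Nontrivial) :
    cutSum (place br t (graphOp br φ)) (a :: (m ++ [b])) +
      graphOp br (fun c => (c.mul b).elim 0 φ) (a :: m) +
      graphOp br (fun c => (a.mul c).elim 0 φ) (m ++ [b]) = 0 := by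
  have hl : ∀ c ∈ a :: (m ++ [b]), c.Nontrivial := by
    intro c hc
    simp only [List.mem_cons, List.mem_append, List.not_mem_nil, or_false] at hc
    rcases hc with rfl | hc | rfl
    exacts [ha, hm c hc, hb]
  rw [cutSum_place_graphOp, H.cutSum_place_centered hl, if_neg (by simp), cutSum_cons_concat,
    cutSum_cons_concat]
  -- In the interior only the place next to the first input leaves something over.
  have h1 : cutSum (fun u v => place br t (leftExt br φ) (a :: u) (v ++ [b])) m =
      mergeLeft br φ a (m ++ [b]) := by
    rw [cutSum_congr (g := fun u v => if u = [] then mergeLeft br φ a (v ++ [b]) else 0),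
      cutSum_eq_left, if_pos rfl]
    · intro x u v _
      rw [if_neg (by simp)]
    · intro u v huv
      have hu : ∀ c ∈ u, c.Nontrivial := fun c hc => hm c (by rw [← huv]; simp [hc])
      have hv : ∀ c ∈ v ++ [b], c.Nontrivial := fun c hc => hl c (by
        rw [← huv]; simp at hc ⊢; tauto)
      rw [place_leftExt ha _ hv, Finset.sum_eq_zero, zero_add]
      intro x hx
      rw [H.place_eq_zero_of_ne_nil (by simp) (by simp) _ hv, zero_mul]
      intro c hc
      rcases List.mem_cons.1 hc with rfl | hc
      exacts [(Chord.mem_factors.1 hx).2.1, hu c hc]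
  have h2 : cutSum (fun u v => place br t (rightExt br φ) (a :: u) (v ++ [b])) m =
      mergeRight br φ (a :: m) b := by
    rw [cutSum_congr (g := fun u v => if v = [] then mergeRight br φ (a :: u) b else 0),
      cutSum_eq_right, if_pos rfl]
    · intro u v x _
      rw [if_neg (by simp)]
    · intro u v huv
      have hv : ∀ c ∈ v, c.Nontrivial := fun c hc => hm c (by rw [← huv]; simp [hc])
      have hu : ∀ c ∈ a :: u, c.Nontrivial := fun c hc => hl c (by
        rw [← huv]; simp at hc ⊢; tauto)
      rw [place_rightExt hb _ hu, Finset.sum_eq_zero, zero_add]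
      intro x hx
      rw [H.place_eq_zero_of_ne_nil (by simp) (by simp) hu, zero_mul]
      intro c hc
      rcases List.mem_append.1 hc with hc | hc
      · exact hv c hc
      · rw [List.mem_singleton.1 hc]; exact (Chord.mem_factors.1 hx).1
  -- At the two ends, products with the part of an extended input remain that the graph sees.
  have h3 : place br t (leftExt br φ) (a :: (m ++ [b])) [] =
      ∑ x ∈ a.factors, (b.mul x.2).elim 0 fun z => br (z :: m) * φ x.1 := by
    rw [place_leftExt ha _ (by simp), if_neg (by simp), add_zero]
    refine Finset.sum_congr rfl fun x hx => ?_
    rw [H.place_last hb (Chord.mem_factors.1 hx).2.1]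
    cases b.mul x.2 <;> simp
  have h4 : place br t (rightExt br φ) [] (a :: (m ++ [b])) =
      ∑ x ∈ b.factors, (x.1.mul a).elim 0 fun z => br (z :: m) * φ x.2 := by
    rw [← List.cons_append, place_rightExt hb _ (by simp), if_neg (by simp), add_zero]
    refine Finset.sum_congr rfl fun x hx => ?_
    rw [List.cons_append, H.place_first ha (Chord.mem_factors.1 hx).1]
    cases x.1.mul a <;> simp
  have h5 : place br t (leftExt br φ) [] (a :: (m ++ [b])) =
      place br t (rightExt br φ) (a :: (m ++ [b])) [] := by
    rw [place_nil_left, place_nil_right, splitRight_leftExt, H.orb_leftExt]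
  have h6 := Chord.sum_factors_cyclic ha hb fun z γ => br (z :: m) * φ γ
  have h7 := H.mergeLeft_add (φ := φ) (b := b) ha m
  have h8 := H.mergeRight_add (φ := φ) (a := a) hb m
  rw [h1, h2, h3, h4, h5]
  have c2 := fun x : S => CharTwo.add_self_eq_zero x
  linear_combination h7 + h8 + h6 + c2 (place br t (rightExt br φ) (a :: (m ++ [b])) []) +
    c2 (∑ x ∈ b.factors, (x.1.mul a).elim 0 fun z => br (z :: m) * φ x.2) +
    c2 (if b.source = a.source ∧ b.isCentral = a.isCentral then br (a :: m) * φ b else 0) +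
    c2 (∑ x ∈ a.factors, (x.1.mul b).elim 0 fun d => br (x.2 :: m) * φ d)

end

section

variable {N : ℕ} {S : Type*} [CommRing S]

/-! ### Cancellation for one input -/

section single
variable [NeZero N] {br : List (Chord N) → S} {t : Option (ZMod N) → S} {φ : Chord N → S}
variable (H : IsBracket br t)
include H

theorem IsBracket.orb_pair (x : Chord N) :
    orb t (fun c => br [x, c]) = t x.loopKind * br [x, x.loop] :=
  H.orb_eq (u := []) (v := [])

/-- A closed central chord followed by the element `U_o` at its end does not depend on the base
point. The two closed chords are the products of `s_{i,i+1}` with the same chord from `i + 1` to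
`i`, in the two possible orders; cutting both leads to the same cyclic word. -/
theorem IsBracket.orb_pair_succ [Fact (2 ≤ N)] (i : ZMod N) (k : ℕ)
    (hk : ((k + 1 : ℕ) : ZMod N) = 0) :
    orb t (fun c => br [.central (i + 1) k, c]) = orb t (fun c => br [.central i k, c]) := by
  have hN : 2 ≤ N := Fact.out
  obtain ⟨k, rfl⟩ : ∃ m, k = m + 1 := by
    refine Nat.exists_eq_succ_of_ne_zero ?_
    rintro rfl
    rw [ZMod.natCast_eq_zero_iff] at hk
    have := Nat.le_of_dvd one_pos hk
    omega
  have e1 : (Chord.central (i + 1) k).mul (.central i 0) = some (.central (i + 1) (k + 1)) := by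
    rw [Chord.central_mul_central, if_pos]
    push_cast at hk ⊢; linear_combination hk
  have e2 : (Chord.central i 0).mul (.central (i + 1) k) = some (.central i (k + 1)) := by
    rw [Chord.central_mul_central, if_pos (by push_cast; ring)]
    congr 2; omega
  have h1 := H.cut (.central (i + 1) k) (.central i 0) _ [.petal (i + 1) 0] trivial trivial e1
  have h2 := H.cut (.central i 0) (.central (i + 1) k) _ [.petal i 0] trivial trivial e2
  rw [splitSum_eq_zero, add_zero] at h1 h2
  · have t1 : i + 1 + ((k + 1 : ℕ) : ZMod N) = i := by push_cast at hk ⊢; linear_combination hk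
    have t2 : i + 1 + ((k + 1 + 1 : ℕ) : ZMod N) = i + 1 := by rw [hk, add_zero]
    have t3 : i + ((k + 1 + 1 : ℕ) : ZMod N) = i := by rw [hk, add_zero]
    have t4 : i + ((0 + 1 : ℕ) : ZMod N) = i + 1 := by push_cast; ring
    rw [H.orb_pair, H.orb_pair]
    simp only [Chord.loop, Chord.loopKind, Chord.isCentral, if_true, Chord.target, t1, t2, t3, t4]
      at h1 h2 ⊢
    rw [h1, h2]
    have := H.append_comm [.central (i + 1) k, .petal i 0] [.central i 0, .petal (i + 1) 0]
    simp only [List.cons_append, List.nil_append] at this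
    rw [this]
    ring
  · intro u c c' c'' v huv hc
    rcases u with _ | ⟨e, u⟩
    · simp only [List.nil_append, List.cons.injEq] at huv
      obtain ⟨rfl, -⟩ := huv
      simp [Chord.factors] at hc
    · simp at huv
  · intro u c c' c'' v huv hc
    rcases u with _ | ⟨e, u⟩
    · simp only [List.nil_append, List.cons.injEq] at huv
      obtain ⟨rfl, -⟩ := huv
      simp [Chord.factors] at hc
    · simp at huv

theorem IsBracket.orb_pair_add [Fact (2 ≤ N)] (i : ZMod N) (k m : ℕ)
    (hk : ((k + 1 : ℕ) : ZMod N) = 0) :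
    orb t (fun c => br [.central (i + m) k, c]) = orb t (fun c => br [.central i k, c]) := by
  induction m with
  | zero => simp
  | succ m ih =>
    have e : i + ((m + 1 : ℕ) : ZMod N) = i + m + 1 := by push_cast; ring
    rw [← ih, ← H.orb_pair_succ (i + m) k hk, e]

/-- A central chord on a graph with two leaves is closed. -/
theorem IsBracket.orb_pair_eq_zero {i : ZMod N} {k : ℕ} (hk : ((k + 1 : ℕ) : ZMod N) ≠ 0) :
    orb t (fun c => br [.central i k, c]) = 0 := by
  rw [H.orb_pair]
  by_contra h
  obtain ⟨-, -, h1, -⟩ := H.adj _ _ _ (right_ne_zero_of_mul h)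
  obtain ⟨-, -, h2, -⟩ := H.adj_last (l := []) (right_ne_zero_of_mul h)
  simp only [Chord.loop, Chord.isCentral, if_true, Chord.target, Chord.source] at h2
  exact hk (add_eq_left.1 h2)

/-- The cancellation for a single input. -/
theorem IsBracket.sum_orb_pair [Fact (2 ≤ N)] (a : Chord N) :
    ∑ x ∈ a.factors, orb t (fun c => br [x.2, c]) * φ x.1 =
      ∑ x ∈ a.factors, orb t (fun c => br [x.1, c]) * φ x.2 := by
  rcases a with i | ⟨i, k⟩ | ⟨i, k⟩
  · rfl
  · rw [Chord.sum_factors_petal i k fun x y => orb t (fun c => br [y, c]) * φ x,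
      Chord.sum_factors_petal i k fun x y => orb t (fun c => br [x, c]) * φ y,
      ← Finset.sum_range_reflect]
    refine Finset.sum_congr rfl fun m hm => ?_
    rw [Finset.mem_range] at hm
    rw [show k - 1 - (k - 1 - m) = m by omega]
  · rw [Chord.sum_factors_central i k fun x y => orb t (fun c => br [y, c]) * φ x,
      Chord.sum_factors_central i k fun x y => orb t (fun c => br [x, c]) * φ y,
      ← Finset.sum_range_reflect]
    refine Finset.sum_congr rfl fun m hm => ?_
    rw [Finset.mem_range] at hm
    rw [show k - 1 - (k - 1 - m) = m by omega]
    by_cases h : ((m + 1 : ℕ) : ZMod N) = 0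
    · rw [h, add_zero, H.orb_pair_add i m _ h]
    · rw [H.orb_pair_eq_zero h, H.orb_pair_eq_zero h, zero_mul, zero_mul]

/-- The cancellation for one input that is not an idempotent. The extended graphs with two leaves,
one of whose labels is a `U_o`, cancel in pairs by `sum_orb_pair`. -/
theorem IsBracket.relation_of_one [CharP S 2] [Fact (2 ≤ N)] {a : Chord N} (ha : a.Nontrivial) :
    cutSum (place br t (graphOp br φ)) [a] = 0 := by
  rw [cutSum_place_graphOp, H.cutSum_place_centered (by simpa using ha), if_neg (by simp)]
  have h0 : ∀ f : List (Chord N) → List (Chord N) → S, cutSum f [a] = f [] [a] + f [a] [] :=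
    fun _ => rfl
  rw [h0, h0]
  have h1 : place br t (leftExt br φ) [a] [] =
      ∑ x ∈ a.factors, orb t (fun c => br [x.2, c]) * φ x.1 := by
    rw [place_leftExt ha _ (by simp), mergeLeft, ite_self, add_zero]
    refine Finset.sum_congr rfl fun x _ => ?_
    rw [place_nil_right]
    simp [splitLeft, splitSum, H.single]
  have h2 : place br t (rightExt br φ) [] [a] =
      ∑ x ∈ a.factors, orb t (fun c => br [x.1, c]) * φ x.2 := by
    have := place_rightExt (br := br) (t := t) (φ := φ) ha (u := []) [] (by simp)
    rw [List.nil_append] at this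
    rw [this, mergeRight, if_pos rfl, merge, lastSum, add_zero, add_zero]
    refine Finset.sum_congr rfl fun x _ => ?_
    rw [List.nil_append, place_nil_left]
    have h3 : ∀ c, br [c, x.1] = br [x.1, c] := fun c => H.rotate x.1 [c]
    simp [splitRight, splitSum, H.single, h3]
  have h5 : place br t (leftExt br φ) [] [a] = place br t (rightExt br φ) [a] [] := by
    rw [place_nil_left, place_nil_right, splitRight_leftExt, H.orb_leftExt]
  have c2 := fun x : S => CharTwo.add_self_eq_zero x
  rw [h1, h2, h5, H.sum_orb_pair]
  linear_combination c2 (place br t (rightExt br φ) [a] []) +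
    c2 (∑ x ∈ a.factors, orb t (fun c => br [x.1, c]) * φ x.2)

end single

/-! ### Idempotent inputs -/

theorem cutSum_append_cons {A : Type*} (f : List A → List A → S) (u v : List A) (x : A) :
    cutSum f (u ++ x :: v) = cutSum (fun u₁ u₂ => f u₁ (u₂ ++ x :: v)) u +
      cutSum (fun v₁ v₂ => f (u ++ x :: v₁) v₂) v := by
  induction u generalizing f with
  | nil => rfl
  | cons a u ih =>
    rw [List.cons_append, cutSum, cutSum, ih, add_assoc]
    rfl

section idem
variable {br : List (Chord N) → S} {t : Option (ZMod N) → S} {φ : Chord N → S}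
variable (H : IsBracket br t)
include H

theorem IsBracket.eq_zero_of_mem {l : List (Chord N)} {i : ZMod N} (h : Chord.idem i ∈ l) :
    br l = 0 := by
  obtain ⟨u, v, rfl⟩ := List.append_of_mem h
  exact H.eq_zero_of_idem u v i

theorem IsBracket.graphOp_eq_zero {l : List (Chord N)} {i : ZMod N} (h : Chord.idem i ∈ l) :
    graphOp br φ l = 0 := by
  have h1 : centered br φ l = 0 := by
    rcases l with _ | ⟨a, l⟩
    · rfl
    · rw [centered, H.eq_zero_of_mem h, zero_mul]
  have h2 : leftExt br φ l = 0 := by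
    rcases l with _ | ⟨a, l⟩
    · rfl
    · rcases List.mem_cons.1 h with rfl | h
      · rfl
      · exact Finset.sum_eq_zero fun x _ => by
          rw [H.eq_zero_of_mem (List.mem_cons_of_mem _ h), zero_mul]
  have h3 : rightExt br φ l = 0 := by
    rcases List.eq_nil_or_concat l with rfl | ⟨l, a, rfl⟩
    · rfl
    · rw [List.concat_eq_append] at h ⊢
      rw [rightExt_concat]
      rcases List.mem_append.1 h with h | h
      · exact Finset.sum_eq_zero fun x _ => by
          rw [H.eq_zero_of_mem (List.mem_append_left _ h), zero_mul]
      · rw [← List.mem_singleton.1 h]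
        rfl
  rw [graphOp, h1, h2, h3]
  simp

/-- The operations of graphs vanish unless consecutive inputs are composable. -/
theorem IsBracket.graphOp_adj {u v : List (Chord N)} {a b : Chord N}
    (h : graphOp br φ (u ++ a :: b :: v) ≠ 0) : a.target = b.source := by
  by_contra hab
  have h0 : ∀ u v, br (u ++ a :: b :: v) = 0 := by
    intro u v
    by_contra h'
    exact hab (H.adj_append h').2.2.1
  apply h
  have h1 : centered br φ (u ++ a :: b :: v) = 0 := by
    rcases u with _ | ⟨e, u⟩
    · have := h0 [] v
      rw [List.nil_append] at this ⊢
      rw [centered, this, zero_mul]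
    · have := h0 (e :: u) v
      rw [List.cons_append] at this ⊢
      rw [centered, this, zero_mul]
  have h2 : leftExt br φ (u ++ a :: b :: v) = 0 := by
    rcases u with _ | ⟨e, u⟩
    · refine Finset.sum_eq_zero fun x hx => ?_
      have : br (x.2 :: b :: v) = 0 := by
        by_contra h'
        obtain ⟨n1, n2, n3⟩ := Chord.mem_factors.1 hx
        exact hab ((Chord.mul_eq_some n1 n2 n3).2.2.2.2.2.trans (H.adj _ _ _ h').2.2.1)
      rw [this, zero_mul]
    · refine Finset.sum_eq_zero fun x hx => ?_
      have := h0 (x.2 :: u) v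
      rw [List.cons_append] at this
      change br (x.2 :: (u ++ a :: b :: v)) * _ = 0
      rw [this, zero_mul]
  have h3 : rightExt br φ (u ++ a :: b :: v) = 0 := by
    rcases List.eq_nil_or_concat v with rfl | ⟨v, e, rfl⟩
    · have := rightExt_concat br φ (u ++ [a]) b
      simp only [List.append_assoc, List.cons_append, List.nil_append] at this
      rw [this]
      refine Finset.sum_eq_zero fun x hx => ?_
      have : br (u ++ [a, x.1]) = 0 := by
        by_contra h'
        obtain ⟨n1, n2, n3⟩ := Chord.mem_factors.1 hx
        exact hab ((H.adj_append h').2.2.1.trans (Chord.mul_eq_some n1 n2 n3).2.2.2.2.1.symm)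
      rw [this, zero_mul]
    · have := rightExt_concat br φ (u ++ a :: b :: v) e
      simp only [List.append_assoc, List.cons_append] at this
      rw [List.concat_eq_append, this]
      refine Finset.sum_eq_zero fun x hx => ?_
      rw [h0, zero_mul]
  rw [graphOp, h1, h2, h3]
  simp

/-- The output of a graph begins where its first input begins. -/
theorem IsBracket.graphOp_idem_mul (i : ZMod N) (a : Chord N) (l : List (Chord N)) :
    graphOp br (fun c => ((Chord.idem i).mul c).elim 0 φ) (a :: l) =
      if i = a.source then graphOp br φ (a :: l) else 0 := by
  have h0 : ∀ c, ((Chord.idem i).mul c).elim 0 φ = if i = c.source then φ c else 0 := by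
    intro c
    rw [Chord.idem_mul, Chord.elim_ite]
  have h1 : centered br (fun c => ((Chord.idem i).mul c).elim 0 φ) (a :: l) =
      if i = a.source then centered br φ (a :: l) else 0 := by
    have h4 : ((Chord.idem i).mul (.idem a.source)).elim 0 φ =
        if i = a.source then φ (.idem a.source) else 0 := h0 _
    rw [centered, centered, h4]
    by_cases hi : i = a.source
    · rw [if_pos hi, if_pos hi]
    · rw [if_neg hi, if_neg hi, mul_zero]
  have h2 : leftExt br (fun c => ((Chord.idem i).mul c).elim 0 φ) (a :: l) =
      if i = a.source then leftExt br φ (a :: l) else 0 := by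
    have h4 : ∀ x ∈ a.factors, ((Chord.idem i).mul x.1).elim 0 φ =
        if i = a.source then φ x.1 else 0 := by
      intro x hx
      rw [h0, Chord.mul_source (Chord.mem_factors.1 hx).2.2]
    by_cases hi : i = a.source
    · rw [if_pos hi]
      exact Finset.sum_congr rfl fun x hx => by
        beta_reduce; rw [h4 x hx, if_pos hi]
    · rw [if_neg hi]
      exact Finset.sum_eq_zero fun x hx => by
        beta_reduce; rw [h4 x hx, if_neg hi, mul_zero]
  have h3 : rightExt br (fun c => ((Chord.idem i).mul c).elim 0 φ) (a :: l) =
      if i = a.source then rightExt br φ (a :: l) else 0 := by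
    rcases List.eq_nil_or_concat l with rfl | ⟨l, b, rfl⟩
    · simp [rightExt, lastSum, H.single]
    · rw [List.concat_eq_append, ← List.cons_append, rightExt_concat, rightExt_concat]
      have h4 : ∀ x ∈ b.factors, br (a :: l ++ [x.1]) * ((Chord.idem i).mul x.2).elim 0 φ =
          if i = a.source then br (a :: l ++ [x.1]) * φ x.2 else 0 := by
        intro x hx
        obtain ⟨n1, n2, n3⟩ := Chord.mem_factors.1 hx
        by_cases h : br (a :: l ++ [x.1]) = 0
        · rw [h, zero_mul, zero_mul, ite_self]
        · rw [h0, ← (Chord.mul_eq_some n1 n2 n3).1, (H.adj_last h).2.2.1, mul_ite, mul_zero]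
      by_cases hi : i = a.source
      · rw [if_pos hi]
        exact Finset.sum_congr rfl fun x hx => by rw [h4 x hx, if_pos hi]
      · rw [if_neg hi]
        exact Finset.sum_eq_zero fun x hx => by rw [h4 x hx, if_neg hi]
  rw [graphOp, h1, h2, h3]
  split_ifs <;> simp [graphOp]

/-- The output of a graph ends where its last input ends. -/
theorem IsBracket.graphOp_mul_idem (i : ZMod N) (a : Chord N) (l : List (Chord N)) :
    graphOp br (fun c => (c.mul (.idem i)).elim 0 φ) (l ++ [a]) =
      if a.target = i then graphOp br φ (l ++ [a]) else 0 := by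
  have h0 : ∀ c, (c.mul (.idem i)).elim 0 φ = if c.target = i then φ c else 0 := by
    intro c
    rw [Chord.mul_idem, Chord.elim_ite]
  have h1 : centered br (fun c => (c.mul (.idem i)).elim 0 φ) (l ++ [a]) =
      if a.target = i then centered br φ (l ++ [a]) else 0 := by
    rcases l with _ | ⟨e, l⟩
    · simp [centered, H.single]
    · have h4 : ((Chord.idem e.source).mul (.idem i)).elim 0 φ =
          if e.source = i then φ (.idem e.source) else 0 := h0 _
      rw [List.cons_append, centered, centered, h4]
      by_cases h : br (e :: (l ++ [a])) = 0
      · rw [h, zero_mul, zero_mul, ite_self]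
      · rw [(H.adj_last h).2.2.1, mul_ite, mul_zero]
  have h2 : leftExt br (fun c => (c.mul (.idem i)).elim 0 φ) (l ++ [a]) =
      if a.target = i then leftExt br φ (l ++ [a]) else 0 := by
    rcases l with _ | ⟨e, l⟩
    · simp [leftExt, H.single]
    · have h4 : ∀ x ∈ e.factors, br (x.2 :: (l ++ [a])) * (x.1.mul (.idem i)).elim 0 φ =
          if a.target = i then br (x.2 :: (l ++ [a])) * φ x.1 else 0 := by
        intro x hx
        obtain ⟨n1, n2, n3⟩ := Chord.mem_factors.1 hx
        by_cases h : br (x.2 :: (l ++ [a])) = 0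
        · rw [h, zero_mul, zero_mul, ite_self]
        · rw [h0, (Chord.mul_eq_some n1 n2 n3).1, (H.adj_last h).2.2.1, mul_ite, mul_zero]
      by_cases hi : a.target = i
      · rw [if_pos hi]
        exact Finset.sum_congr rfl fun x hx => (h4 x hx).trans (if_pos hi)
      · rw [if_neg hi]
        exact Finset.sum_eq_zero fun x hx => (h4 x hx).trans (if_neg hi)
  have h3 : rightExt br (fun c => (c.mul (.idem i)).elim 0 φ) (l ++ [a]) =
      if a.target = i then rightExt br φ (l ++ [a]) else 0 := by
    rw [rightExt_concat, rightExt_concat]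
    have h4 : ∀ x ∈ a.factors, (x.2.mul (.idem i)).elim 0 φ =
        if a.target = i then φ x.2 else 0 := by
      intro x hx
      obtain ⟨n1, n2, n3⟩ := Chord.mem_factors.1 hx
      rw [h0, ← (Chord.mul_eq_some n1 n2 n3).2.2.2.2.2]
    by_cases hi : a.target = i
    · rw [if_pos hi]
      exact Finset.sum_congr rfl fun x hx => by rw [h4 x hx, if_pos hi]
    · rw [if_neg hi]
      exact Finset.sum_eq_zero fun x hx => by rw [h4 x hx, if_neg hi, mul_zero]
  rw [graphOp, h1, h2, h3]
  split_ifs <;> simp [graphOp]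

variable [NeZero N]

/-- If an input is an idempotent, then only products contribute, since no graph has such an input.
-/
theorem IsBracket.place_of_mem {u v : List (Chord N)} {i : ZMod N} (h : Chord.idem i ∈ u ++ v) :
    place br t (graphOp br φ) u v = merge (graphOp br φ) u v := by
  have h1 : orb t (fun c => graphOp br φ (u ++ c :: v)) = 0 := by
    refine Finset.sum_eq_zero fun j _ => ?_
    have : ∀ c, graphOp br φ (u ++ c :: v) = 0 := fun c => H.graphOp_eq_zero (i := i) (by
      simp only [List.mem_append, List.mem_cons] at h ⊢; tauto)
    beta_reduce
    rw [this, this]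
    ring
  have h2 : splitRight br (graphOp br φ) u v = 0 := by
    refine splitSum_eq_zero fun v₁ c c' c'' v₂ hv hc => ?_
    subst hv
    have hci : Chord.idem i ≠ c := by rintro rfl; simp [Chord.factors] at hc
    simp only [List.mem_append, List.mem_cons, hci, false_or] at h
    rcases h with h | h | h
    · rw [H.graphOp_eq_zero (List.mem_append_left _ h), mul_zero]
    · rw [H.eq_zero_of_mem (List.mem_append_left _ h), zero_mul]
    · rw [H.graphOp_eq_zero (List.mem_append_right _ (List.mem_cons_of_mem _ h)), mul_zero]
  have h3 : splitLeft br (graphOp br φ) u v = 0 := by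
    refine splitSum_eq_zero fun v₁ c c' c'' v₂ hv hc => ?_
    subst hv
    have hci : Chord.idem i ≠ c := by rintro rfl; simp [Chord.factors] at hc
    simp only [List.mem_append, List.mem_cons, hci, false_or] at h
    rcases h with (h | h) | h
    · rw [H.graphOp_eq_zero (List.mem_append_left _ h), mul_zero]
    · rw [H.eq_zero_of_mem (List.mem_cons_of_mem _ h), zero_mul]
    · rw [H.graphOp_eq_zero (List.mem_append_right _ (List.mem_cons_of_mem _ h)), mul_zero]
  rw [place, h1, h2, h3]
  ring

/-- Only the products of an idempotent with its two neighbours remain. -/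
theorem IsBracket.cutSum_place_idem (u v : List (Chord N)) (i : ZMod N) :
    cutSum (place br t (graphOp br φ)) (u ++ .idem i :: v) =
      merge (graphOp br φ) u (.idem i :: v) + merge (graphOp br φ) (u ++ [.idem i]) v := by
  rw [cutSum_congr (g := merge (graphOp br φ)) fun x y hxy =>
    H.place_of_mem (i := i) (by rw [hxy]; simp), cutSum_append_cons, cutSum_eq_right,
    cutSum_eq_left, List.nil_append]
  · intro e v₁ v₂ hv
    rcases v₂ with _ | ⟨b, v₂⟩
    · exact merge_nil _ _
    · obtain ⟨w, a, hw⟩ : ∃ w a, e :: v₁ = w ++ [a] := by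
        rcases List.eq_nil_or_concat (e :: v₁) with h | ⟨w, a, h⟩
        · cases h
        · exact ⟨w, a, by rw [h, List.concat_eq_append]⟩
      have : u ++ Chord.idem i :: e :: v₁ = (u ++ Chord.idem i :: w) ++ [a] := by
        rw [hw, List.append_assoc]; rfl
      rw [this, merge_concat]
      cases a.mul b with
      | none => rfl
      | some c => exact H.graphOp_eq_zero (i := i) (by simp)
  · intro u₁ u₂ b hu
    obtain ⟨e, w, hw⟩ : ∃ e w, u₂ ++ [b] = e :: w := by
      cases u₂ with
      | nil => exact ⟨_, _, rfl⟩
      | cons e m => exact ⟨e, m ++ [b], rfl⟩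
    rw [hw]
    rcases List.eq_nil_or_concat u₁ with rfl | ⟨u₁, a, rfl⟩
    · rfl
    · rw [List.concat_eq_append, List.cons_append, merge_concat]
      cases a.mul e with
      | none => rfl
      | some c => exact H.graphOp_eq_zero (i := i) (by simp)

variable [CharP S 2]

omit [CharP S 2] in
theorem IsBracket.relation_of_idem (i : ZMod N) :
    cutSum (place br t (graphOp br φ)) [.idem i] = 0 := by
  have := H.cutSum_place_idem (φ := φ) [] [] i
  rw [List.nil_append] at this
  rw [this]
  simp [merge]

/-- The cancellation for at least two inputs, one of which is an idempotent. -/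
theorem IsBracket.relation_of_two_of_mem {a b : Chord N} {m : List (Chord N)} {i : ZMod N}
    (h : Chord.idem i ∈ a :: (m ++ [b])) :
    cutSum (place br t (graphOp br φ)) (a :: (m ++ [b])) +
      graphOp br (fun c => (c.mul b).elim 0 φ) (a :: m) +
      graphOp br (fun c => (a.mul c).elim 0 φ) (m ++ [b]) = 0 := by
  have c2 := fun x : S => CharTwo.add_self_eq_zero x
  rcases List.mem_cons.1 h with rfl | h
  · have h1 := H.cutSum_place_idem (φ := φ) [] (m ++ [b]) i
    rw [List.nil_append] at h1
    obtain ⟨e, w, hw⟩ : ∃ e w, m ++ [b] = e :: w := by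
      cases m with
      | nil => exact ⟨_, _, rfl⟩
      | cons e m => exact ⟨e, m ++ [b], rfl⟩
    rw [h1, H.graphOp_eq_zero (l := .idem i :: m) (i := i) (by simp), hw, H.graphOp_idem_mul,
      List.nil_append, merge, merge, Chord.idem_mul, Chord.elim_ite, zero_add, add_zero]
    exact c2 _
  rcases List.mem_append.1 h with h | h
  · obtain ⟨u, v, rfl⟩ := List.append_of_mem h
    have h1 := H.cutSum_place_idem (φ := φ) (a :: u) (v ++ [b]) i
    rw [List.cons_append] at h1
    rw [H.graphOp_eq_zero (l := a :: (u ++ .idem i :: v)) (i := i) (by simp),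
      H.graphOp_eq_zero (l := u ++ .idem i :: v ++ [b]) (i := i) (by simp), List.append_assoc,
      List.cons_append, h1]
    obtain ⟨e, w, hw⟩ : ∃ e w, v ++ [b] = e :: w := by
      cases v with
      | nil => exact ⟨_, _, rfl⟩
      | cons e v => exact ⟨e, v ++ [b], rfl⟩
    obtain ⟨w', e', hw'⟩ : ∃ w e, a :: u = w ++ [e] := by
      rcases List.eq_nil_or_concat (a :: u) with h | ⟨w, e, h⟩
      · cases h
      · exact ⟨w, e, by rw [h, List.concat_eq_append]⟩
    rw [hw, hw', merge_concat, merge_concat, Chord.mul_idem, Chord.idem_mul,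
      Chord.elim_ite, Chord.elim_ite, List.append_assoc, List.singleton_append]
    by_cases h0 : graphOp br φ (w' ++ e' :: e :: w) = 0
    · simp [h0]
    · have h2 := H.graphOp_adj h0
      rw [h2]
      by_cases h3 : e.source = i
      · rw [if_pos h3, if_pos h3.symm]
        linear_combination c2 (graphOp br φ (w' ++ e' :: e :: w))
      · rw [if_neg h3, if_neg (Ne.symm h3)]
        ring
  · obtain rfl := List.mem_singleton.1 h
    have h1 := H.cutSum_place_idem (φ := φ) (a :: m) [] i
    rw [List.cons_append] at h1
    obtain ⟨w', e', hw'⟩ : ∃ w e, a :: m = w ++ [e] := by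
      rcases List.eq_nil_or_concat (a :: m) with h | ⟨w, e, h⟩
      · cases h
      · exact ⟨w, e, by rw [h, List.concat_eq_append]⟩
    rw [h1, H.graphOp_eq_zero (l := m ++ [Chord.idem i]) (i := i) (by simp), merge_nil, hw',
      H.graphOp_mul_idem, merge_concat, Chord.mul_idem, Chord.elim_ite, add_zero, add_zero]
    exact c2 _

end idem

end

/-! ### The A-infinity relation for generating functions -/

section

variable {N : ℕ} {S : Type*} [CommRing S]

/-- The sum over all ways to write a list as `u ++ m ++ v` of the values of `Φ` on `u ++ [x] ++ v`,
where `x` is the output of an operation on `m`. The output is encoded by the values `E ψ m` on it of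
all linear functionals, a functional being given by its values `ψ` on the chords. -/
def compSum (E : (Chord N → S) → List (Chord N) → S) (Φ : List (Chord N) → S)
    (l : List (Chord N)) : S :=
  cutSum (fun u r => cutSum (fun m v => E (fun c => Φ (u ++ c :: v)) m) r) l

/-- The value of `φ` on the product of two chords. -/
def prodOp (φ : Chord N → S) : List (Chord N) → S
  | [a, b] => (a.mul b).elim 0 φ
  | _ => 0

theorem compSum_add_left (E E' : (Chord N → S) → List (Chord N) → S) (Φ : List (Chord N) → S)
    (l : List (Chord N)) :
    compSum (fun ψ m => E ψ m + E' ψ m) Φ l = compSum E Φ l + compSum E' Φ l := by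
  rw [compSum, compSum, compSum, ← cutSum_add]
  exact cutSum_congr fun u v _ => by rw [← cutSum_add]

theorem compSum_cons (E : (Chord N → S) → List (Chord N) → S) (Φ : List (Chord N) → S)
    (a : Chord N) (l : List (Chord N)) :
    compSum E Φ (a :: l) = cutSum (fun m v => E (fun c => Φ (c :: v)) m) (a :: l) +
      compSum E (fun m => Φ (a :: m)) l := rfl

theorem compSum_prodOp (Φ : List (Chord N) → S) (l : List (Chord N)) :
    compSum prodOp Φ l = cutSum (merge Φ) l := by
  induction l generalizing Φ with
  | nil => rfl
  | cons a l ih =>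
    rw [compSum_cons, ih]
    cases l with
    | nil => simp [cutSum, merge, prodOp]
    | cons b l =>
      have h1 : cutSum (fun m v => prodOp (fun c => Φ (c :: v)) m) (a :: b :: l) =
          (a.mul b).elim 0 fun c => Φ (c :: l) := by
        change 0 + (0 + cutSum (fun m v => prodOp (fun c => Φ (c :: v)) (a :: b :: m)) l) = _
        rw [cutSum_eq_left, zero_add, zero_add]
        · rfl
        · intro _ _ _ _
          rfl
      rw [h1]
      change _ + (0 + _) = 0 + ((a.mul b).elim 0 (fun c => Φ (c :: l)) + _)
      rw [zero_add, zero_add]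
      rfl

theorem cutSum_lastSum (F : List (Chord N) → Chord N → List (Chord N) → S)
    (l : List (Chord N)) : cutSum (fun m v => lastSum (fun u c => F u c v) m) l =
      splitSum (fun u c' c'' v => F (u ++ [c']) c'' v) l := by
  induction l generalizing F with
  | nil => rfl
  | cons a l ih =>
    have h : ∀ (f : List (Chord N) → Chord N → S) (m : List (Chord N)), lastSum f (a :: m) =
        (if m = [] then ∑ x ∈ a.factors, f [x.1] x.2 else 0) +
          lastSum (fun u => f (a :: u)) m := by
      intro f m
      cases m <;> simp [lastSum]
    rw [cutSum, lastSum, zero_add, cutSum_congr fun m v _ => h _ _, cutSum_add,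
      ih fun u => F (a :: u), cutSum_eq_left, if_pos rfl, splitSum]
    · rfl
    · intro _ _ _ _
      exact if_neg (by simp)

theorem compSum_rightExt (br Φ : List (Chord N) → S) (l : List (Chord N)) :
    compSum (rightExt br) Φ l = cutSum (splitRight br Φ) l :=
  cutSum_congr fun u v _ => cutSum_lastSum (fun m c v => br m * Φ (u ++ c :: v)) v

theorem compSum_leftExt (br Φ : List (Chord N) → S) (l : List (Chord N)) :
    compSum (leftExt br) Φ l = cutSum (splitLeft br Φ) l := by
  induction l generalizing Φ with
  | nil => rfl
  | cons a l ih =>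
    rw [compSum_cons, ih]
    change 0 + cutSum (fun m v => leftExt br (fun c => Φ (c :: v)) (a :: m)) l + _ =
      0 + cutSum (fun u v => splitLeft br Φ (a :: u) v) l
    rw [zero_add, zero_add, ← cutSum_add]
    exact cutSum_congr fun u v _ => rfl

theorem compSum_centered {br Φ : List (Chord N) → S}
    (h : ∀ u v i, Φ (u ++ Chord.idem i :: v) = 0) (l : List (Chord N)) :
    compSum (centered br) Φ l = 0 :=
  cutSum_eq_zero fun u v _ => cutSum_eq_zero fun m w _ => by
    cases m with
    | nil => rfl
    | cons a m => rw [centered, h, mul_zero]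

theorem prodOp_add (φ ψ : Chord N → S) (l : List (Chord N)) :
    prodOp (fun c => φ c + ψ c) l = prodOp φ l + prodOp ψ l := by
  unfold prodOp
  split
  · rename_i a b
    cases a.mul b <;> simp
  · simp

theorem graphOp_add (br : List (Chord N) → S) (φ ψ : Chord N → S) (l : List (Chord N)) :
    graphOp br (fun c => φ c + ψ c) l = graphOp br φ l + graphOp br ψ l := by
  have h1 : centered br (fun c => φ c + ψ c) l = centered br φ l + centered br ψ l := by
    cases l <;> simp [centered, mul_add]
  have h2 : leftExt br (fun c => φ c + ψ c) l = leftExt br φ l + leftExt br ψ l := by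
    cases l <;> simp [leftExt, mul_add, Finset.sum_add_distrib]
  have h3 : rightExt br (fun c => φ c + ψ c) l = rightExt br φ l + rightExt br ψ l := by
    rcases List.eq_nil_or_concat l with rfl | ⟨l, a, rfl⟩
    · simp [rightExt, lastSum]
    · simp [rightExt_concat, mul_add, Finset.sum_add_distrib]
  rw [graphOp, h1, h2, h3, graphOp, graphOp]
  ring

section total
variable [NeZero N] (br : List (Chord N) → S) (t : Option (ZMod N) → S)

/-- The value of `φ` on `∑ o, t o • U_o`, as an operation without inputs. -/
def orbOp (φ : Chord N → S) : List (Chord N) → S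
  | [] => orb t φ
  | _ => 0

/-- The value of `φ` on the output of all operations. -/
def fullOp (φ : Chord N → S) (l : List (Chord N)) : S :=
  graphOp br φ l + prodOp φ l + orbOp t φ l

theorem compSum_orbOp (Φ : List (Chord N) → S) (l : List (Chord N)) :
    compSum (orbOp t) Φ l = cutSum (fun u v => orb t fun c => Φ (u ++ c :: v)) l :=
  cutSum_congr fun u v _ => by
    rw [cutSum_eq_left]
    · rfl
    · intro _ _ _ _
      rfl

variable {br t}

theorem orb_zero : orb t (fun _ : Chord N => (0 : S)) = 0 := by
  simp [orb]

theorem fullOp_add (φ ψ : Chord N → S) (l : List (Chord N)) :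
    fullOp br t (fun c => φ c + ψ c) l = fullOp br t φ l + fullOp br t ψ l := by
  have h : orbOp t (fun c => φ c + ψ c) l = orbOp t φ l + orbOp t ψ l := by
    cases l with
    | nil => exact orb_add t φ ψ
    | cons a l => exact (add_zero 0).symm
  rw [fullOp, graphOp_add, prodOp_add, h, fullOp, fullOp]
  ring

theorem fullOp_zero (l : List (Chord N)) : fullOp br t (fun _ => (0 : S)) l = 0 := by
  have := fullOp_add (br := br) (t := t) (fun _ => 0) (fun _ => 0) l
  simpa using this

theorem compSum_fullOp_add (Φ Ψ : List (Chord N) → S) (l : List (Chord N)) :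
    compSum (fullOp br t) (fun m => Φ m + Ψ m) l =
      compSum (fullOp br t) Φ l + compSum (fullOp br t) Ψ l := by
  rw [compSum, compSum, compSum, ← cutSum_add]
  refine cutSum_congr fun u v _ => ?_
  rw [← cutSum_add]
  exact cutSum_congr fun m w _ => fullOp_add _ _ _

/-- If the outer operation vanishes on idempotents, then the compositions are the contributions to
the places between inputs, and inner centered graphs do not contribute. -/
theorem compSum_fullOp {Φ : List (Chord N) → S} (h : ∀ u v i, Φ (u ++ Chord.idem i :: v) = 0)
    (l : List (Chord N)) : compSum (fullOp br t) Φ l = cutSum (place br t Φ) l := by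
  have h1 : fullOp br t = fun φ l => (((centered br φ l + leftExt br φ l) + rightExt br φ l) +
    prodOp φ l) + orbOp t φ l := rfl
  rw [h1, compSum_add_left, compSum_add_left, compSum_add_left, compSum_add_left,
    compSum_centered h, compSum_leftExt, compSum_rightExt, compSum_prodOp, compSum_orbOp,
    zero_add, ← cutSum_add, ← cutSum_add, ← cutSum_add]
  refine cutSum_congr fun u v _ => ?_
  rw [place]
  ring

theorem compSum_fullOp_orbOp (φ : Chord N → S) (l : List (Chord N)) :
    compSum (fullOp br t) (orbOp t φ) l = 0 :=
  cutSum_eq_zero fun u v _ => cutSum_eq_zero fun m w _ => by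
    cases u <;> exact fullOp_zero _

theorem compSum_fullOp_prodOp_nil (φ : Chord N → S) :
    compSum (fullOp br t) (prodOp φ) [] = 0 :=
  fullOp_zero _

theorem compSum_fullOp_prodOp_singleton (φ : Chord N → S) (a : Chord N) :
    compSum (fullOp br t) (prodOp φ) [a] =
      orb t (fun c => (c.mul a).elim 0 φ) + orb t (fun c => (a.mul c).elim 0 φ) := by
  have h : ∀ ψ : Chord N → S, fullOp br t ψ [] = orb t ψ := by
    intro ψ
    simp [fullOp, graphOp, centered, leftExt, rightExt, lastSum, prodOp, orbOp]
  change fullOp br t _ [] + fullOp br t (fun _ => 0) [a] + fullOp br t _ [] = _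
  rw [fullOp_zero, h, h, add_zero]
  rfl

/-- The terms in which the outer operation is the product of the output of an operation with the
last or the first input. -/
theorem compSum_fullOp_prodOp (φ : Chord N → S) (a b : Chord N) (m : List (Chord N)) :
    compSum (fullOp br t) (prodOp φ) (a :: (m ++ [b])) =
      fullOp br t (fun c => (c.mul b).elim 0 φ) (a :: m) +
        fullOp br t (fun c => (a.mul c).elim 0 φ) (m ++ [b]) := by
  have h1 : ∀ u v : List (Chord N), 2 ≤ u.length + v.length →
      (fun c => prodOp φ (u ++ c :: v)) = fun _ => 0 := by
    intro u v huv
    funext c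
    rcases u with _ | ⟨x, _ | ⟨y, u⟩⟩
    · rcases v with _ | ⟨x, _ | ⟨y, v⟩⟩ <;> simp at huv ⊢; rfl
    · rcases v with _ | ⟨y, v⟩ <;> simp at huv ⊢; rfl
    · rcases u with _ | ⟨z, u⟩ <;> rfl
  rw [compSum_cons]
  congr 1
  · rw [← List.cons_append, cutSum_concat, cutSum_eq_right]
    · change _ + fullOp br t (fun _ => 0) _ = _
      rw [fullOp_zero, add_zero]
      rfl
    · intro u v x _
      exact (congrArg (fun ψ => fullOp br t ψ u) (h1 [] (v ++ [x] ++ [b]) (by simp))).trans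
        (fullOp_zero _)
  · rw [compSum, cutSum_eq_left, cutSum_eq_right]
    · rfl
    · intro u v x _
      exact (congrArg (fun ψ => fullOp br t ψ u) (h1 [a] (v ++ [x]) (by simp; omega))).trans
        (fullOp_zero _)
    · intro x u v _
      refine cutSum_eq_zero fun m w _ => ?_
      exact (congrArg (fun ψ => fullOp br t ψ m) (h1 (a :: x :: u) w (by simp; omega))).trans
        (fullOp_zero _)

/-- The elements `U_o` are central up to a sum over all `o`. -/
theorem orb_mul_comm (φ : Chord N → S) (a : Chord N) :
    orb t (fun c => (c.mul a).elim 0 φ) = orb t (fun c => (a.mul c).elim 0 φ) := by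
  have hN : N - 1 + 1 = N := Nat.sub_add_cancel (NeZero.pos N)
  rcases a with i | ⟨i, k⟩ | ⟨i, k⟩
  · have h : ∀ c : Chord N, c.target = c.source →
        (c.mul (.idem i)).elim 0 φ = ((Chord.idem i).mul c).elim 0 φ := by
      intro c hc
      rw [Chord.mul_idem, Chord.idem_mul, Chord.elim_ite, Chord.elim_ite, hc]
      by_cases h : c.source = i
      · rw [if_pos h, if_pos h.symm]
      · rw [if_neg h, if_neg (Ne.symm h)]
    refine Finset.sum_congr rfl fun j _ => ?_
    beta_reduce
    rw [h _ rfl, h (.central j (N - 1)) (by simp [Chord.target, Chord.source, hN])]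
  · refine Finset.sum_congr rfl fun j _ => ?_
    simp only [Chord.petal_mul_petal, Chord.petal_mul_central, Chord.central_mul_petal,
      Chord.elim_ite, Option.elim_none, mul_zero, add_zero, eq_comm (a := i)]
    by_cases h : j = i
    · rw [h, Nat.zero_add]
    · rw [if_neg h, if_neg h]
  · simp only [orb, Chord.central_mul_central, Chord.petal_mul_central, Chord.central_mul_petal,
      Chord.elim_ite, Option.elim_none, mul_zero, zero_add, hN, CharP.cast_eq_zero, add_zero,
      mul_ite, Finset.sum_ite_eq, Finset.sum_ite_eq', Finset.mem_univ, if_true]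
    rw [add_comm k (N - 1)]

variable [CharP S 2] (H : IsBracket br t)
include H

/-- The weighted A-infinity relations, for the generating functions of the operations on basis
chords. The terms in which the outer operation comes from a graph are grouped by places between
inputs; those in which it is the product account for what is left over at the two ends. -/
theorem IsBracket.compSum_fullOp_eq_zero [Fact (2 ≤ N)] (φ : Chord N → S) (l : List (Chord N)) :
    compSum (fullOp br t) (fullOp br t φ) l = 0 := by
  have c2 := fun x : S => CharTwo.add_self_eq_zero x
  have h0 : fullOp br t φ = fun m => (graphOp br φ m + prodOp φ m) + orbOp t φ m := rfl
  rw [h0, compSum_fullOp_add, compSum_fullOp_orbOp, add_zero, compSum_fullOp_add,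
    compSum_fullOp fun u v i => H.graphOp_eq_zero (i := i) (by simp)]
  rcases l with _ | ⟨a, l⟩
  · have h1 : ∀ c, graphOp br φ [c] = 0 := by
      intro c
      simp [graphOp, centered, leftExt, rightExt, lastSum, H.single]
    rw [compSum_fullOp_prodOp_nil, add_zero]
    change place br t (graphOp br φ) [] [] = 0
    rw [place_nil_left]
    simp [h1, orb_zero, splitRight, splitSum]
  rcases List.eq_nil_or_concat l with rfl | ⟨m, b, rfl⟩
  · rw [compSum_fullOp_prodOp_singleton, orb_mul_comm, c2, add_zero]
    by_cases ha : a.Nontrivial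
    · exact H.relation_of_one ha
    · rcases a with i | ⟨i, k⟩ | ⟨i, k⟩
      exacts [H.relation_of_idem i, absurd trivial ha, absurd trivial ha]
  rw [List.concat_eq_append, compSum_fullOp_prodOp]
  have h2 : cutSum (place br t (graphOp br φ)) (a :: (m ++ [b])) +
      graphOp br (fun c => (c.mul b).elim 0 φ) (a :: m) +
      graphOp br (fun c => (a.mul c).elim 0 φ) (m ++ [b]) = 0 := by
    by_cases hl : ∀ c ∈ a :: (m ++ [b]), c.Nontrivial
    · exact H.relation_of_two (hl a (by simp)) (hl b (by simp)) fun c hc => hl c (by simp [hc])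
    · push Not at hl
      obtain ⟨c, hc, hn⟩ := hl
      rcases c with i | ⟨i, k⟩ | ⟨i, k⟩
      exacts [H.relation_of_two_of_mem hc, absurd trivial hn, absurd trivial hn]
  have h3 : prodOp (fun c => (c.mul b).elim 0 φ) (a :: m) +
      prodOp (fun c => (a.mul c).elim 0 φ) (m ++ [b]) = 0 := by
    rcases m with _ | ⟨x, _ | ⟨y, m⟩⟩
    · exact add_zero _
    · have h4 := Chord.mul_assoc_bind a x b
      have h5 : (a.mul x).elim 0 (fun c => (c.mul b).elim 0 φ) =
          (x.mul b).elim 0 (fun c => (a.mul c).elim 0 φ) := by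
        have h6 := congrArg (fun o => Option.elim o (0 : S) φ) h4
        revert h6
        cases a.mul x <;> cases x.mul b <;> simp
      change (a.mul x).elim 0 (fun c => (c.mul b).elim 0 φ) +
        (x.mul b).elim 0 (fun c => (a.mul c).elim 0 φ) = 0
      rw [h5]
      exact c2 _
    · rcases m with _ | ⟨z, m⟩ <;> exact add_zero _
  have h4 : orbOp t (fun c => (a.mul c).elim 0 φ) (m ++ [b]) = 0 := by
    cases m <;> rfl
  rw [fullOp, fullOp, h4]
  change _ + (_ + (0 : S) + _) = 0
  linear_combination h2 + h3

end total

end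

/-! ### Star graphs as ribbon graphs -/

section

namespace StarGraph
variable {N j : ℕ}

theorem next_eq_rot (h : HalfEdge N j) : next h = rot h := by
  rcases h with ⟨v, i, _ | _⟩ <;> rfl

/-- A star graph as a ribbon graph on the vertex set `Fin j`. -/
def toRibbon (G : StarGraph N j) : Ribbon N (Fin j) where
  mate := ⟨G.mate, G.mate, G.mate_mate, G.mate_mate⟩
  mate_mate := G.mate_mate
  coherent := G.coherent

theorem exists_toRibbon (G : Ribbon N (Fin j)) : ∃ H : StarGraph N j, H.toRibbon = G :=
  ⟨⟨G.mate, G.mate_mate, G.coherent⟩, Ribbon.ext fun _ => rfl⟩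

variable (G : StarGraph N j)

theorem iterate_face (m : ℕ) (h : HalfEdge N j) : G.face^[m] h = (G.toRibbon.face ^ m) h := by
  rw [← Perm.iterate_eq_pow]
  congr 2
  funext x
  rw [face, next_eq_rot]
  rfl

theorem isLeaf_iff (h : HalfEdge N j) : G.IsLeaf h ↔ G.toRibbon.IsLeaf h := Iff.rfl

variable [NeZero N]

theorem isInner_iff (h : HalfEdge N j) : G.IsInner h ↔ G.toRibbon.IsInner h := by
  constructor
  · intro H x hx
    obtain ⟨m, rfl⟩ := hx.exists_nat_pow_eq
    rw [← iterate_face]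
    exact H m
  · intro H m
    rw [iterate_face]
    exact H.not_isLeaf_pow m

theorem isAllowable_iff (w : Weight N) :
    G.IsAllowable w ↔ G.toRibbon.Good ∧ G.toRibbon.weight = w := by
  have hw : (∀ i : ZMod N, w (some i) = Nat.card {v : Fin j // G.IsInner (v, i, false)}) ∧
      w none = Nat.card {v : Fin j // G.IsInner (v, 0, true)} ↔ G.toRibbon.weight = w := by
    simp only [isInner_iff]
    constructor
    · rintro ⟨h1, h2⟩
      ext o
      rcases o with _ | i
      exacts [h2.symm, (h1 i).symm]
    · rintro rfl
      exact ⟨fun _ => rfl, rfl⟩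
  have hc : ((∀ v i, G.IsInner (v, i, false) → G.face (v, i, false) = (v, i, false)) ∧
      ∀ v i, G.IsInner (v, i, true) → G.face^[N] (v, i, true) = (v, i, true)) ↔
      ∀ h, G.toRibbon.IsInner h → (G.toRibbon.face ^ Ribbon.period N h.2.2) h = h := by
    have h1 : ∀ h, G.face h = (G.toRibbon.face ^ 1) h := fun h => G.iterate_face 1 h
    simp only [isInner_iff, iterate_face, h1]
    constructor
    · rintro ⟨h1, h2⟩ ⟨v, i, _ | _⟩
      exacts [h1 v i, h2 v i]
    · exact fun h => ⟨fun v i => h (v, i, false), fun v i => h (v, i, true)⟩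
  constructor
  · intro H
    have h := hw.1 ⟨H.petal_weight, H.internal_weight⟩
    refine ⟨⟨H.connected, hc.1 ⟨H.petal_cycle, H.internal_cycle⟩, ?_⟩, h⟩
    rw [h, Nat.card_fin]
    exact H.planar
  · rintro ⟨H, h⟩
    refine ⟨H.connected, (hc.2 H.cycle).1, (hc.2 H.cycle).2, (hw.2 h).1, (hw.2 h).2, ?_⟩
    have := H.planar
    rw [h, Nat.card_fin] at this
    exact this

omit [NeZero N] in
theorem region_iff {h h' : HalfEdge N j} {a : Chord N} : G.Region h a h' ↔
    G.IsLeaf h ∧ G.IsLeaf h' ∧ ∃ p, G.toRibbon.Arc h p h' ∧ a = lab h p := by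
  simp only [Region, iterate_face, Ribbon.Arc, isLeaf_iff, Nat.lt_succ_iff]
  constructor
  · rintro ⟨p, h1, h2, h3, h4, h5⟩
    exact ⟨h1, h4, p, ⟨h2, h3⟩, h5⟩
  · rintro ⟨h1, h4, p, ⟨h2, h3⟩, h5⟩
    exact ⟨p, h1, h2, h3, h4, h5⟩

omit [NeZero N] in
/-- `Reads` passes from leaf to leaf, so it is a walk all of whose entries begin at leaves. -/
theorem reads_iff {h h' : HalfEdge N j} {l : List (Chord N)} (hh : G.IsLeaf h) :
    G.Reads h l h' ↔ G.IsLeaf h' ∧ ∃ L, G.toRibbon.Walk h L h' ∧ L.map Prod.snd = l ∧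
      ∀ x ∈ L.map Prod.fst, G.IsLeaf x := by
  induction l generalizing h with
  | nil =>
    constructor
    · rintro rfl
      exact ⟨hh, [], rfl, rfl, by simp⟩
    · rintro ⟨-, L, h1, h2, -⟩
      obtain rfl := List.map_eq_nil_iff.1 h2
      exact h1
  | cons a l ih =>
    constructor
    · rintro ⟨h₁, hr, H⟩
      obtain ⟨-, hl, p, A, ha⟩ := G.region_iff.1 hr
      obtain ⟨h2, L, W, h3, h4⟩ := (ih hl).1 H
      refine ⟨h2, (h, a) :: L, ⟨rfl, p, h₁, A, ha, W⟩, by rw [List.map_cons, h3], ?_⟩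
      intro x hx
      rcases List.mem_cons.1 hx with rfl | hx
      exacts [hh, h4 x hx]
    · rintro ⟨h2, L, W, h3, h4⟩
      rcases L with _ | ⟨⟨x, b⟩, L⟩
      · simp at h3
      simp only [List.map_cons, List.cons.injEq] at h3
      obtain ⟨rfl, h3⟩ := h3
      obtain ⟨rfl, p, h₁, A, ha, W⟩ := W
      have hl : G.IsLeaf h₁ := by
        rcases L with _ | ⟨⟨y, c⟩, L⟩
        · obtain rfl := W
          exact h2
        · obtain rfl := W.head
          exact h4 _ (by simp)
      exact ⟨h₁, G.region_iff.2 ⟨hh, hl, p, A, ha⟩, (ih hl).2 ⟨h2, L, W, h3, fun x hx =>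
        h4 x (List.mem_cons_of_mem _ hx)⟩⟩

/-- The descriptions of the boundary agree. -/
theorem boundary_iff {w : Weight N} (H : G.IsAllowable w) {r : HalfEdge N j}
    {l : List (Chord N)} : (G.IsLeaf r ∧ G.Reads r l r ∧
      l.length = Nat.card {h : HalfEdge N j // G.IsLeaf h}) ↔
      ∃ L, G.toRibbon.Boundary r L ∧ L.map Prod.snd = l := by
  constructor
  · rintro ⟨hr, h1, h2⟩
    obtain ⟨L, K⟩ := ((G.isAllowable_iff w).1 H).1.exists_boundary hr
    obtain ⟨-, L', W, h3, h4⟩ := (G.reads_iff hr).1 h1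
    refine ⟨L, K, ?_⟩
    have h5 : L'.length = L.length := by
      rw [← K.card, ← List.length_map (f := Prod.snd), h3, h2]
      rfl
    rw [← h3, (W.unique K.walk h4 (fun z hz => (K.isLeaf_iff z).2 hz) hr hr h5).1]
  · rintro ⟨L, K, rfl⟩
    refine ⟨K.root_isLeaf, (G.reads_iff K.root_isLeaf).2 ⟨K.root_isLeaf, L, K.walk, rfl,
      fun z hz => (K.isLeaf_iff z).2 hz⟩, ?_⟩
    rw [List.length_map, ← K.card]
    rfl

end StarGraph

/-! ### The operations from graphs -/

namespace OperationGraph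
variable {N : ℕ} {w : Weight N} {l : List (Chord N)}

/-- The isomorphism class of the rooted graph together with the extension. -/
def toClass (G : OperationGraph N w l) : RootedClass N × Chord N :=
  (cls G.graph.toRibbon G.root, G.extension)

theorem toClass_eq_iff (G H : OperationGraph N w l) : G.toClass = H.toClass ↔ G ≈ H := by
  rw [toClass, toClass, Prod.mk.injEq, cls_eq_iff]
  constructor
  · rintro ⟨⟨σ, E, h⟩, h'⟩
    exact ⟨σ, E.mate, h.symm, h'.symm⟩
  · rintro ⟨σ, E, h, h'⟩
    exact ⟨⟨σ, ⟨σ.injective, E⟩, h.symm⟩, h'.symm⟩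

theorem exists_toClass [NeZero N] (x : RootedClass N × Chord N) :
    (∃ G : OperationGraph N w l, G.toClass = x) ↔
      ∃ l', Extends l' x.2 l ∧ x.1 ∈ classSet w l' := by
  constructor
  · rintro ⟨G, rfl⟩
    have h := (G.graph.isAllowable_iff w).1 G.allowable
    exact ⟨G.labels, G.extends_labels, cls_mem_classSet.2 ⟨h.1, h.2,
      (G.graph.boundary_iff G.allowable).1 ⟨G.root_leaf, G.reads, G.length_labels⟩⟩⟩
  · obtain ⟨q, α⟩ := x
    rintro ⟨l', h1, h2⟩
    obtain ⟨⟨n, G, r⟩, rfl⟩ := Quotient.exists_rep q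
    obtain ⟨H, rfl⟩ := StarGraph.exists_toRibbon G
    rw [mk_eq_cls] at h2
    obtain ⟨h3, h4, h5⟩ := cls_mem_classSet.1 h2
    have h6 := (H.isAllowable_iff w).2 ⟨h3, h4⟩
    obtain ⟨h7, h8, h9⟩ := (H.boundary_iff h6).2 h5
    exact ⟨⟨n, H, h6, r, h7, l', h8, h9, α, h1⟩, Prod.ext (mk_eq_cls ⟨n, H.toRibbon, r⟩).symm rfl⟩

/-- The output of a class of rooted graphs with an extension. -/
theorem graphOperation_eq [NeZero N] (F : Type*) [Field F] (s : Finset (RootedClass N × Chord N))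
    (hs : ∀ x, x ∈ s ↔ ∃ l', Extends l' x.2 l ∧ x.1 ∈ classSet w l') :
    graphOperation N F w l =
      ∑ x ∈ s, Finsupp.single x.2 (MvPolynomial.X 0 ^ x.1.size : Ground N F) := by
  let f : Quotient (isoSetoid N w l) → RootedClass N × Chord N :=
    Quotient.lift toClass fun G H h => (toClass_eq_iff G H).2 h
  have hf : Function.Injective f := by
    intro p q
    induction p, q using Quotient.inductionOn₂ with
    | _ G H => exact fun h => Quotient.sound ((toClass_eq_iff G H).1 h)
  have hr : Set.range f = s := by
    ext x
    rw [Finset.mem_coe, hs, ← exists_toClass]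
    constructor
    · rintro ⟨q, rfl⟩
      induction q using Quotient.inductionOn with
      | _ G => exact ⟨G, rfl⟩
    · rintro ⟨G, rfl⟩
      exact ⟨Quotient.mk _ G, rfl⟩
  rw [← finsum_mem_coe_finset, ← hr, finsum_mem_range hf]
  refine finsum_congr fun q => ?_
  induction q using Quotient.inductionOn with
  | _ G =>
    change Finsupp.single _ _ = Finsupp.single _ (_ ^ (cls G.graph.toRibbon G.root).size)
    rw [size_cls, Nat.card_fin]
    rfl

end OperationGraph

end

/-! ### Evaluation of the operations -/

section

variable {N : ℕ}

theorem Chord.mul_ne_right {a c : Chord N} (ha : a.Nontrivial) (hc : c.Nontrivial) :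
    a.mul c ≠ some c := by
  rcases a with i | ⟨i, k⟩ | ⟨i, k⟩ <;> rcases c with j | ⟨j, l⟩ | ⟨j, l⟩
  · exact ha.elim
  · exact ha.elim
  · exact ha.elim
  · exact hc.elim
  · rw [Chord.petal_mul_petal]
    split_ifs
    · simp only [ne_eq, Option.some.injEq, Chord.petal.injEq, not_and]
      omega
    · simp
  · rw [Chord.petal_mul_central]; simp
  · exact hc.elim
  · rw [Chord.central_mul_petal]; simp
  · rw [Chord.central_mul_central]
    split_ifs
    · simp only [ne_eq, Option.some.injEq, Chord.central.injEq, not_and]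
      omega
    · simp

section classSet
variable [NeZero N] {w : Weight N} {l l' : List (Chord N)} {q : RootedClass N}

theorem nontrivial_of_mem_classSet (h : q ∈ classSet w l) {a : Chord N} (ha : a ∈ l) :
    a.Nontrivial := by
  obtain ⟨V, _, G, r, L, -, -, H, rfl, rfl⟩ := h
  obtain ⟨⟨x, a⟩, hx, rfl⟩ := List.mem_map.1 ha
  obtain ⟨p, hp⟩ := H.walk.exists_lab hx
  exact hp ▸ lab_nontrivial _ _

theorem eq_of_mem_classSet (h : q ∈ classSet w l) (h' : q ∈ classSet w l') : l = l' := by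
  obtain ⟨V, _, G, r, L, -, -, H, rfl, rfl⟩ := h
  obtain ⟨V', _, G', r', L', -, -, H', rfl, e⟩ := h'
  obtain ⟨σ, E, rfl⟩ := cls_eq_iff.1 e
  rw [← (H.map E).unique H', List.map_map]
  rfl

theorem ne_singleton_of_mem_classSet (h : q ∈ classSet w l) (a : Chord N) : l ≠ [a] := by
  obtain ⟨V, _, G, r, L, -, -, H, rfl, rfl⟩ := h
  rcases L with _ | ⟨⟨x, b⟩, _ | ⟨y, L⟩⟩
  · simp
  · exact H.ne_singleton.elim
  · simp

end classSet

section evaluation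
variable [NeZero N] [Fact (2 ≤ N)] (F : Type*) [Field F] (w : Weight N)

omit [Fact (2 ≤ N)] in
theorem graphOperation_nil : graphOperation N F w [] = 0 := by
  rw [OperationGraph.graphOperation_eq F ∅, Finset.sum_empty]
  rintro ⟨q, α⟩
  refine ⟨fun h => absurd h (Finset.notMem_empty _), ?_⟩
  rintro ⟨l', h, -⟩
  dsimp only at h
  generalize hl : ([] : List (Chord N)) = l at h
  rcases h with ⟨a, l⟩ | ⟨α, a, b, l, -, -⟩ | ⟨α, a, b, l, -, -⟩ <;> simp at hl

/-- The graphs of a given input sequence are centered, left extended or right extended. -/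
theorem graphOperation_eq_sum {b b' : Chord N} {m m' : List (Chord N)}
    (hm : b :: m = m' ++ [b']) : graphOperation N F w (b :: m) =
      ∑ q ∈ classes w (b :: m),
        Finsupp.single (Chord.idem b.source) (MvPolynomial.X 0 ^ q.size : Ground N F) +
      ∑ x ∈ b.factors, ∑ q ∈ classes w (x.2 :: m),
        Finsupp.single x.1 (MvPolynomial.X 0 ^ q.size) +
      ∑ x ∈ b'.factors, ∑ q ∈ classes w (m' ++ [x.1]),
        Finsupp.single x.2 (MvPolynomial.X 0 ^ q.size) := by
  have mem_c : ∀ {q l}, q ∈ classes w l ↔ q ∈ classSet w l := mem_classes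
  have inj : ∀ α : Chord N, Function.Injective fun q : RootedClass N => (q, α) :=
    fun α q q' h => congrArg Prod.fst h
  have hl : ((b.factors : Set (Chord N × Chord N)).PairwiseDisjoint fun x =>
      (classes w (x.2 :: m)).image fun q => (q, x.1)) := by
    intro x hx y hy hxy
    refine Finset.disjoint_left.2 fun z hz hz' => hxy ?_
    obtain ⟨q, hq, rfl⟩ := Finset.mem_image.1 hz
    obtain ⟨q', hq', h⟩ := Finset.mem_image.1 hz'
    obtain ⟨rfl, h1⟩ := Prod.mk.inj h
    have h2 := eq_of_mem_classSet (mem_c.1 hq) (mem_c.1 hq')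
    exact Prod.ext h1.symm (List.cons.inj h2).1
  have hr : ((b'.factors : Set (Chord N × Chord N)).PairwiseDisjoint fun x =>
      (classes w (m' ++ [x.1])).image fun q => (q, x.2)) := by
    intro x hx y hy hxy
    refine Finset.disjoint_left.2 fun z hz hz' => hxy ?_
    obtain ⟨q, hq, rfl⟩ := Finset.mem_image.1 hz
    obtain ⟨q', hq', h⟩ := Finset.mem_image.1 hz'
    obtain ⟨rfl, h1⟩ := Prod.mk.inj h
    have h2 := eq_of_mem_classSet (mem_c.1 hq) (mem_c.1 hq')
    exact Prod.ext (by simpa using h2) h1.symm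
  rw [OperationGraph.graphOperation_eq F
    ((classes w (b :: m)).image (fun q => (q, Chord.idem b.source)) ∪
      b.factors.biUnion (fun x => (classes w (x.2 :: m)).image fun q => (q, x.1)) ∪
      b'.factors.biUnion fun x => (classes w (m' ++ [x.1])).image fun q => (q, x.2)),
    Finset.sum_union, Finset.sum_union, Finset.sum_image (inj _).injOn, Finset.sum_biUnion hl,
    Finset.sum_biUnion hr]
  · simp only [Finset.sum_image (inj _).injOn]
  -- Centered and extended graphs are distinguished by their extension, which is an idempotent only
  -- for the former.
  · refine Finset.disjoint_left.2 fun z hz hz' => ?_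
    obtain ⟨q, -, rfl⟩ := Finset.mem_image.1 hz
    simp only [Finset.mem_biUnion, Finset.mem_image] at hz'
    obtain ⟨x, hx, q', -, h⟩ := hz'
    have := (Chord.mem_factors.1 hx).1
    rw [(Prod.mk.inj h).2] at this
    exact this
  -- A left extended graph has a proper factor of `b` as its first label; a right extended graph
  -- with the same inputs has `b` itself there, since it has at least two labels.
  · refine Finset.disjoint_left.2 fun z hz hz' => ?_
    simp only [Finset.mem_biUnion, Finset.mem_image, Finset.mem_union] at hz hz'
    obtain ⟨y, hy, q', hq', rfl⟩ := hz'
    obtain ⟨y1, y2, -⟩ := Chord.mem_factors.1 hy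
    rcases hz with ⟨q, -, h⟩ | ⟨x, hx, q, hq, h⟩
    · rw [← (Prod.mk.inj h).2] at y2
      exact y2
    · obtain ⟨rfl, -⟩ := Prod.mk.inj h
      obtain ⟨x1, x2, x3⟩ := Chord.mem_factors.1 hx
      have h2 := eq_of_mem_classSet (mem_c.1 hq) (mem_c.1 hq')
      rcases m' with _ | ⟨e, m'⟩
      · exact ne_singleton_of_mem_classSet (mem_c.1 hq') _ rfl
      · have h3 := (List.cons.inj h2).1
        have h4 := (List.cons.inj hm).1
        rw [h4, ← h3] at x3
        exact Chord.mul_ne_right x1 x2 x3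
  · rintro ⟨q, α⟩
    simp only [Finset.mem_biUnion, Finset.mem_image, Finset.mem_union, Prod.mk.injEq]
    constructor
    · rintro ((⟨_, hq, rfl, rfl⟩ | ⟨x, hx, _, hq, rfl, rfl⟩) | ⟨x, hx, _, hq, rfl, rfl⟩)
      · exact ⟨_, Extends.centered _ _, mem_c.1 hq⟩
      · obtain ⟨x1, x2, x3⟩ := Chord.mem_factors.1 hx
        exact ⟨_, Extends.left _ _ _ _ x1 x3, mem_c.1 hq⟩
      · obtain ⟨x1, x2, x3⟩ := Chord.mem_factors.1 hx
        refine ⟨_, ?_, mem_c.1 hq⟩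
        rw [hm]
        exact Extends.right _ _ _ _ x2 x3
    · rintro ⟨l', h, hq⟩
      generalize he : b :: m = l at h
      rcases h with ⟨a, l⟩ | ⟨α, a, c, l, h1, h2⟩ | ⟨α, a, c, l, h1, h2⟩
      · obtain ⟨rfl, rfl⟩ := List.cons.inj he
        exact Or.inl (Or.inl ⟨q, mem_c.2 hq, rfl, rfl⟩)
      · obtain ⟨rfl, rfl⟩ := List.cons.inj he
        exact Or.inl (Or.inr ⟨(α, a), Chord.mem_factors.2
          ⟨h1, nontrivial_of_mem_classSet hq (by simp), h2⟩, q, mem_c.2 hq, rfl, rfl⟩)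
      · rw [hm] at he
        obtain ⟨rfl, he'⟩ := List.append_inj' he rfl
        obtain rfl := (List.cons.inj he').1
        exact Or.inr ⟨(a, α), Chord.mem_factors.2
          ⟨nontrivial_of_mem_classSet hq (by simp), h1, h2⟩, q, mem_c.2 hq, rfl, rfl⟩

variable {F}

/-- The linear functional on the algebra with given values on the chords. -/
abbrev eval (φ : Chord N → Ground N F) : Alg N F →ₗ[Ground N F] Ground N F :=
  Finsupp.linearCombination (Ground N F) φ

theorem eval_graphOperation (φ : Chord N → Ground N F) (l : List (Chord N)) :
    eval φ (graphOperation N F w l) = graphOp (count (MvPolynomial.X 0) w) φ l := by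
  rcases l with _ | ⟨b, m⟩
  · rw [graphOperation_nil, map_zero]
    simp [graphOp, centered, leftExt, rightExt, lastSum]
  obtain ⟨m', b', hm⟩ : ∃ m' b', b :: m = m' ++ [b'] := by
    rcases List.eq_nil_or_concat (b :: m) with h | ⟨m', b', h⟩
    · cases h
    · exact ⟨m', b', by rw [h, List.concat_eq_append]⟩
  have h1 : rightExt (count (MvPolynomial.X 0) w) φ (b :: m) =
      ∑ x ∈ b'.factors, count (MvPolynomial.X 0) w (m' ++ [x.1]) * φ x.2 := by
    rw [hm, rightExt_concat]
  rw [graphOperation_eq_sum F w hm, graphOp, h1]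
  simp only [map_add, map_sum, Finsupp.linearCombination_single, smul_eq_mul, centered, leftExt,
    count, Finset.sum_mul]

omit [NeZero N] [Fact (2 ≤ N)] in
theorem eval_product (φ : Chord N → Ground N F) (a b : Chord N) :
    eval φ (product N F a b) = (a.mul b).elim 0 φ := by
  unfold product
  cases a.mul b <;> simp

/-- The coefficient of the weight `w` in the variable of the basic weight `o`. -/
def basic (F : Type*) [Field F] (w : Weight N) (o : Option (ZMod N)) : Ground N F :=
  if w = Finsupp.single o 1 then 1 else 0

omit [Fact (2 ≤ N)] in
theorem eval_orbit (φ : Chord N → Ground N F) :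
    eval φ (∑ᶠ (o : Option (ZMod N)) (_ : w = Finsupp.single o 1), orbit N F o) =
      orb (basic F w) φ := by
  have h1 : ∀ o, (∑ᶠ (_ : w = Finsupp.single o 1), orbit N F o) =
      basic F w o • orbit N F o := by
    intro o
    rw [finsum_eq_if, basic]
    split_ifs <;> simp
  have h2 : orbit N F none = ∑ i : ZMod N, Finsupp.single (Chord.central i (N - 1)) 1 :=
    finsum_eq_sum_of_fintype _
  have h3 : eval φ (orbit N F none) = ∑ i : ZMod N, φ (.central i (N - 1)) := by
    rw [h2, map_sum]
    simp
  have h4 : ∀ i, eval φ (orbit N F (some i)) = φ (.petal i 0) := by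
    intro i
    simp [orbit]
  rw [finsum_congr h1, finsum_eq_sum_of_fintype, Fintype.sum_option, map_add, map_sum, map_smul, h3,
    orb, Finset.sum_add_distrib, add_comm, ← Finset.mul_sum, smul_eq_mul]
  congr 1
  exact Finset.sum_congr rfl fun i _ => by rw [map_smul, h4, smul_eq_mul]

theorem eval_basisOperation (φ : Chord N → Ground N F) (l : List (Chord N)) :
    eval φ (basisOperation N F w l) = graphOp (count (MvPolynomial.X 0) w) φ l +
      (if w = 0 then prodOp φ l else 0) + orbOp (basic F w) φ l := by
  rcases l with _ | ⟨a, _ | ⟨b, _ | ⟨c, l⟩⟩⟩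
  · rw [basisOperation, map_add, eval_orbit, eval_graphOperation, prodOp, ite_self, orbOp]
    · ring
    · simp
  · rw [basisOperation, eval_graphOperation, prodOp, ite_self, orbOp]
    · ring
    all_goals simp
  · rw [basisOperation, map_add, eval_graphOperation, prodOp, orbOp]
    · split_ifs
      · rw [eval_product]; ring
      · rw [map_zero]; ring
    all_goals simp
  · rw [basisOperation, eval_graphOperation, prodOp, ite_self, orbOp]
    · ring
    all_goals simp

end evaluation

end

/-! ### Generating functions with respect to the weight -/

section

variable {N : ℕ}

theorem map_cutSum {A S T : Type*} [AddCommMonoid S] [AddCommMonoid T] (g : S →+ T)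
    (f : List A → List A → S) (l : List A) :
    g (cutSum f l) = cutSum (fun u v => g (f u v)) l := by
  induction l generalizing f with
  | nil => rfl
  | cons a l ih =>
    rw [cutSum, cutSum, map_add, ih]

theorem map_splitSum {S T : Type*} [AddCommMonoid S] [AddCommMonoid T] (g : S →+ T)
    (f : List (Chord N) → Chord N → Chord N → List (Chord N) → S) (l : List (Chord N)) :
    g (splitSum f l) = splitSum (fun u c' c'' v => g (f u c' c'' v)) l := by
  induction l generalizing f with
  | nil => exact map_zero g
  | cons a l ih =>
    rw [splitSum, splitSum, map_add, map_sum, ih]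

theorem cutSum_sum {A S ι : Type*} [AddCommMonoid S] (s : Finset ι)
    (f : ι → List A → List A → S) (l : List A) :
    cutSum (fun u v => ∑ i ∈ s, f i u v) l = ∑ i ∈ s, cutSum (f i) l := by
  induction l generalizing f with
  | nil => rfl
  | cons a l ih =>
    rw [cutSum, ih, ← Finset.sum_add_distrib]
    rfl

variable (N) in
/-- Power series in one variable for each basic weight. -/
abbrev Series (F : Type*) [Field F] := MvPowerSeries (Option (ZMod N)) (Ground N F)

instance (F : Type*) [Field F] [CharP F 2] : CharP (Series N F) 2 :=
  charP_of_injective_ringHom (MvPowerSeries.C_injective (σ := Option (ZMod N))) 2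

section bracket
variable [NeZero N] [Fact (2 ≤ N)] (F : Type*) [Field F]

/-- The generating function of the graphs with given labels on the boundary. -/
def series (l : List (Chord N)) : Series N F := fun w => count (MvPolynomial.X 0) w l

theorem coeff_series (w : Weight N) (l : List (Chord N)) :
    MvPowerSeries.coeff w (series F l) = count (MvPolynomial.X 0) w l := rfl

/-- The counting lemmas for graphs, as identities between power series in the basic weights. -/
theorem isBracket_series : IsBracket (series (N := N) F) MvPowerSeries.X where
  single a := MvPowerSeries.ext fun w => count_singleton _ w a
  rotate a l := MvPowerSeries.ext fun w => count_rotate _ w a l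
  adj a b l h := by
    by_contra hc
    exact h (MvPowerSeries.ext fun w => by
      by_contra h'
      exact hc (adjacent_of_count_ne_zero _ h'))
  cut a b c l ha hb hc := by
    ext1 w
    rw [coeff_series, count_cut _ ha hb hc, map_add, MvPowerSeries.X,
      MvPowerSeries.coeff_monomial_mul]
    congr 1
    · split_ifs
      · rw [one_mul, coeff_series]
      · rfl
    · have h := map_splitSum (MvPowerSeries.coeff w).toAddMonoidHom
        (fun u c' c'' v => series F (b :: u ++ [c']) * series F (a :: c'' :: v)) l
      refine Eq.trans ?_ h.symm
      simp only [LinearMap.toAddMonoidHom_coe, MvPowerSeries.coeff_mul, coeff_series]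
      rw [splitSum_sum]
      exact Finset.sum_congr rfl fun x _ => sum_splits (fun u c' c'' v =>
        count (MvPolynomial.X 0) x.1 (b :: u ++ [c']) *
          count (MvPolynomial.X 0) x.2 (a :: c'' :: v)) l

variable {F}

/-- The coefficients of the total generating function `fullOp` are the operations of given weight,
where the weight is distributed between the operation and the functional `φ`. -/
theorem coeff_fullOp (w : Weight N) (φ : Chord N → Series N F) (l : List (Chord N)) :
    MvPowerSeries.coeff w (fullOp (series F) MvPowerSeries.X φ l) =
      ∑ x ∈ Finset.HasAntidiagonal.antidiagonal w,
        eval (fun c => MvPowerSeries.coeff x.2 (φ c)) (basisOperation N F x.1 l) := by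
  simp only [eval_basisOperation, Finset.sum_add_distrib]
  rw [fullOp, map_add, map_add]
  congr 1
  · congr 1
    · simp only [graphOp, map_add, Finset.sum_add_distrib]
      congr 1
      · congr 1
        · rcases l with _ | ⟨b, m⟩
          · simp [centered]
          · simp only [centered, MvPowerSeries.coeff_mul, coeff_series]
        · rcases l with _ | ⟨b, m⟩
          · simp [leftExt]
          · simp only [leftExt, map_sum, MvPowerSeries.coeff_mul, coeff_series]
            rw [Finset.sum_comm]
      · rcases List.eq_nil_or_concat l with rfl | ⟨m, b, rfl⟩
        · simp [rightExt, lastSum]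
        · simp only [List.concat_eq_append, rightExt_concat, map_sum, MvPowerSeries.coeff_mul,
            coeff_series]
          rw [Finset.sum_comm]
    · rw [Finset.sum_eq_single (0, w)]
      · rw [if_pos rfl]
        unfold prodOp
        split
        · rename_i a b
          cases a.mul b <;> simp
        · simp
      · rintro ⟨x, y⟩ h1 h2
        rw [Finset.HasAntidiagonal.mem_antidiagonal] at h1
        refine if_neg ?_
        rintro rfl
        exact h2 (by rw [← h1, zero_add])
      · intro h
        exact absurd (Finset.HasAntidiagonal.mem_antidiagonal.2 (zero_add w)) h
  · rcases l with _ | ⟨b, m⟩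
    · simp only [orbOp, orb, map_sum, map_add, MvPowerSeries.coeff_mul]
      rw [Finset.sum_comm]
      refine Finset.sum_congr rfl fun i _ => ?_
      rw [← Finset.sum_add_distrib]
      refine Finset.sum_congr rfl fun x _ => ?_
      have h : ∀ o, MvPowerSeries.coeff x.1 (MvPowerSeries.X o : Series N F) = basic F x.1 o :=
        fun o => MvPowerSeries.coeff_X _ _
      rw [h, h]
    · simp [orbOp]

/-- The weighted A-infinity relations on basis chords, evaluated by a linear functional. -/
theorem basis_relation [CharP F 2] (φ : Chord N → Ground N F) (w : Weight N)
    (l : List (Chord N)) :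
    ∑ x ∈ Finset.HasAntidiagonal.antidiagonal w,
      cutSum (fun u r => cutSum (fun m v => eval (fun c =>
        eval φ (basisOperation N F x.1 (u ++ c :: v))) (basisOperation N F x.2 m)) r) l = 0 := by
  -- For a functional with constant values, all of the weight belongs to the operation.
  have h1 : ∀ (w : Weight N) (l : List (Chord N)), MvPowerSeries.coeff w
      (fullOp (series F) MvPowerSeries.X (fun c => MvPowerSeries.C (φ c)) l) =
      eval φ (basisOperation N F w l) := by
    intro w l
    rw [coeff_fullOp, Finset.sum_eq_single (w, 0)]
    · simp only [MvPowerSeries.coeff_C, if_true]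
    · rintro ⟨x, y⟩ h1 h2
      rw [Finset.HasAntidiagonal.mem_antidiagonal] at h1
      have h3 : y ≠ 0 := by
        rintro rfl
        exact h2 (by rw [← h1, add_zero])
      have h4 : (fun c => MvPowerSeries.coeff y (MvPowerSeries.C (φ c) : Series N F)) = 0 := by
        funext c
        rw [MvPowerSeries.coeff_C, if_neg h3]
        rfl
      dsimp only
      rw [h4, eval, Finsupp.linearCombination_zero, LinearMap.zero_apply]
    · intro h
      exact absurd (Finset.HasAntidiagonal.mem_antidiagonal.2 (add_zero w)) h
  have h2 := congrArg (MvPowerSeries.coeff w)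
    ((isBracket_series F).compSum_fullOp_eq_zero (fun c => MvPowerSeries.C (φ c)) l)
  rw [map_zero] at h2
  rw [← h2, ← Finset.HasAntidiagonal.map_swap_antidiagonal, Finset.sum_map, compSum]
  have h3 := map_cutSum (MvPowerSeries.coeff w : Series N F →ₗ[Ground N F] _).toAddMonoidHom
    (A := Chord N)
  simp only [LinearMap.toAddMonoidHom_coe] at h3
  simp only [h3, coeff_fullOp, h1, cutSum_sum]
  rfl

end bracket

end

/-! ### Reduction to basis chords -/

section

section extension
variable {R B M M' : Type*} [CommRing R] [AddCommGroup M] [Module R M] [AddCommGroup M']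
  [Module R M']

/-- The value on a list of vectors of the multilinear extension of a function of basis elements. -/
def extList : List (B →₀ R) → (List B → M) → M
  | [], f => f []
  | x :: xs, f => Finsupp.linearCombination R (fun b => extList xs fun l => f (b :: l)) x

theorem multilinearExtension_apply (n : ℕ) (f : List B → M) (a : Fin n → B →₀ R) :
    multilinearExtension n f a = extList (List.ofFn a) f := by
  induction n generalizing f with
  | zero => simp [multilinearExtension, extList]
  | succ n ih =>
    rw [List.ofFn_succ, extList, multilinearExtension, LinearMap.uncurryLeft_apply]
    simp only [Finsupp.linearCombination_apply, Finsupp.sum, sum_apply,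
      smul_apply, ih]
    rfl

theorem map_extList (g : M →ₗ[R] M') (xs : List (B →₀ R)) (f : List B → M) :
    g (extList xs f) = extList xs fun l => g (f l) := by
  induction xs generalizing f with
  | nil => rfl
  | cons x xs ih =>
    simp only [extList, Finsupp.linearCombination_apply, Finsupp.sum, map_sum, map_smul, ih]

theorem extList_sum {ι : Type*} (s : Finset ι) (xs : List (B →₀ R)) (f : ι → List B → M) :
    extList xs (fun l => ∑ i ∈ s, f i l) = ∑ i ∈ s, extList xs (f i) := by
  induction xs generalizing f with
  | nil => rfl
  | cons x xs ih =>
    simp only [extList, Finsupp.linearCombination_apply, Finsupp.sum, ih, Finset.smul_sum]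
    exact Finset.sum_comm

theorem extList_linearCombination {C : Type*} (z : C →₀ R) (xs : List (B →₀ R))
    (f : C → List B → M) : Finsupp.linearCombination R (fun c => extList xs (f c)) z =
      extList xs fun l => Finsupp.linearCombination R (fun c => f c l) z := by
  simp only [Finsupp.linearCombination_apply, Finsupp.sum]
  rw [extList_sum]
  exact Finset.sum_congr rfl fun c _ => map_extList (LinearMap.lsmul R M (z c)) xs (f c)

theorem extList_append (xs ys : List (B →₀ R)) (f : List B → M) :
    extList (xs ++ ys) f = extList xs fun u => extList ys fun v => f (u ++ v) := by
  induction xs generalizing f with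
  | nil => rfl
  | cons x xs ih =>
    rw [List.cons_append, extList, extList]
    simp only [ih]
    rfl

theorem extList_congr {xs : List (B →₀ R)} {f g : List B → M}
    (h : ∀ l, l.length = xs.length → f l = g l) : extList xs f = extList xs g := by
  induction xs generalizing f g with
  | nil => exact h [] rfl
  | cons x xs ih =>
    rw [extList, extList]
    congr 2
    funext b
    exact ih fun l hl => h _ (by simp [hl])

theorem extList_append_take (xs ys : List (B →₀ R)) (f : List B → List B → M) :
    extList (xs ++ ys) (fun l => f (l.take xs.length) (l.drop xs.length)) =
      extList xs fun u => extList ys fun v => f u v := by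
  rw [extList_append]
  refine extList_congr fun u hu => ?_
  congr 1
  funext v
  rw [← hu, List.take_left, List.drop_left]

theorem extList_zero (xs : List (B →₀ R)) : extList xs (fun _ => (0 : M)) = 0 := by
  have := map_extList (0 : M →ₗ[R] M) xs fun _ => 0
  simpa using this.symm

end extension

theorem cutSum_eq_sum {A S : Type*} [AddCommMonoid S] (f : List A → List A → S) (l : List A) :
    cutSum f l =
      ∑ s ∈ Finset.HasAntidiagonal.antidiagonal l.length, f (l.take s.1) (l.drop s.1) := by
  induction l generalizing f with
  | nil => simp [cutSum]
  | cons a l ih =>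
    rw [cutSum, ih, List.length_cons, Finset.Nat.sum_antidiagonal_succ]
    rfl

theorem ofFn_splice {A : Type*} (a : ℕ → A) (p r q : ℕ) (y : A) :
    List.ofFn (fun k : Fin (p + 1 + q) => splice a p r y k) =
      List.ofFn (fun k : Fin p => a k) ++ y :: List.ofFn fun k : Fin q => a (p + r + k) := by
  refine List.ext_getElem (by simp; omega) fun k h1 h2 => ?_
  rw [List.getElem_ofFn]
  dsimp only [splice]
  rcases lt_trichotomy k p with h | rfl | h
  · rw [if_pos h, List.getElem_append_left (by simpa using h), List.getElem_ofFn]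
  · rw [if_neg (lt_irrefl _), if_pos rfl, List.getElem_append_right (by simp)]
    simp
  · rw [if_neg (by omega), if_neg (by omega), List.getElem_append_right (by simpa using h.le),
      List.getElem_cons, dif_neg (by simp; omega), List.getElem_ofFn]
    congr 1
    simp
    omega

theorem ofFn_add {A : Type*} (a : ℕ → A) (p q : ℕ) :
    List.ofFn (fun k : Fin (p + q) => a k) =
      List.ofFn (fun k : Fin p => a k) ++ List.ofFn fun k : Fin q => a (p + k) := by
  rw [List.ofFn_add]
  rfl

variable {N : ℕ} [NeZero N] [Fact (2 ≤ N)] {F : Type*} [Field F]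

omit [NeZero N] [Fact (2 ≤ N)] in
/-- A composition of two operations is multilinear in all inputs. -/
theorem eval_comp (φ : Chord N → Ground N F) (w' w'' : Weight N) (a : ℕ → Alg N F) (p r q : ℕ) :
    eval φ (operations N F w' (p + 1 + q) fun k => splice a p r
      (operations N F w'' r fun m => a (p + (m : ℕ))) (k : ℕ)) =
    extList (List.ofFn fun k : Fin (p + (r + q)) => a k) fun l =>
      eval (fun c => eval φ (basisOperation N F w' (l.take p ++ c :: (l.drop p).drop r)))
        (basisOperation N F w'' ((l.drop p).take r)) := by
  rw [operations, operations, multilinearExtension_apply, multilinearExtension_apply, ofFn_splice,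
    map_extList, extList_append, ofFn_add]
  have h1 := extList_append_take (List.ofFn fun k : Fin p => a k)
    (List.ofFn fun k : Fin (r + q) => a (p + k)) (fun u l =>
      eval (fun c => eval φ (basisOperation N F w' (u ++ c :: l.drop r)))
        (basisOperation N F w'' (l.take r)))
  rw [List.length_ofFn] at h1
  rw [h1, ofFn_add (fun k => a (p + k))]
  congr 1
  funext u
  have h2 := extList_append_take (List.ofFn fun k : Fin r => a (p + k))
    (List.ofFn fun k : Fin q => a (p + (r + k))) (fun m v =>
      eval (fun c => eval φ (basisOperation N F w' (u ++ c :: v))) (basisOperation N F w'' m))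
  rw [List.length_ofFn] at h2
  rw [h2, extList, map_extList]
  congr 1
  funext m
  rw [extList_linearCombination]
  simp only [add_assoc]

/-- The relations hold for all inputs: take the coordinate of a chord `γ` in the output, and expand
the inputs in the basis of chords. -/
theorem isWeightedAInfinity_operations [CharP F 2] : IsWeightedAInfinity (operations N F) := by
  intro w n a
  refine Finsupp.ext fun γ => ?_
  have h0 : ∀ y : Alg N F, y γ = eval (fun c => if c = γ then 1 else 0) y := by
    intro y
    simp [Finsupp.linearCombination_apply, Finsupp.sum]
  rw [Finsupp.zero_apply, h0]
  set φ : Chord N → Ground N F := fun c => if c = γ then 1 else 0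
  have h1 : ∀ x : Weight N × Weight N, ∀ s ∈ Finset.HasAntidiagonal.antidiagonal n,
      ∀ t ∈ Finset.HasAntidiagonal.antidiagonal s.2,
      eval φ (operations N F x.1 (s.1 + 1 + t.2) fun k => splice a s.1 t.1
        (operations N F x.2 t.1 fun m => a (s.1 + (m : ℕ))) (k : ℕ)) =
      extList (List.ofFn fun k : Fin n => a k) fun l =>
        eval (fun c => eval φ (basisOperation N F x.1 (l.take s.1 ++ c :: (l.drop s.1).drop t.1)))
          (basisOperation N F x.2 ((l.drop s.1).take t.1)) := by
    intro x s hs t ht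
    rw [Finset.HasAntidiagonal.mem_antidiagonal] at hs ht
    rw [← hs, ← ht]
    exact eval_comp φ x.1 x.2 a s.1 t.1 t.2
  simp only [map_sum]
  rw [Finset.sum_congr rfl fun x _ => Finset.sum_congr rfl fun s hs =>
    Finset.sum_congr rfl fun t ht => h1 x s hs t ht]
  simp only [← extList_sum]
  rw [← extList_zero (List.ofFn fun k : Fin n => a k)]
  refine extList_congr fun l hl => ?_
  rw [List.length_ofFn] at hl
  rw [← basis_relation φ w l]
  refine Finset.sum_congr rfl fun x _ => ?_
  rw [cutSum_eq_sum, hl]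
  refine Finset.sum_congr rfl fun s hs => ?_
  rw [Finset.HasAntidiagonal.mem_antidiagonal] at hs
  rw [cutSum_eq_sum, List.length_drop, hl, ← hs, Nat.add_sub_cancel_left]

end

end StarAlgebra
end

theorem theorem4p7 (N : ℕ) (hN : 3 ≤ N) (F : Type*) [Field F] [CharP F 2] :
    StarAlgebra.IsWeightedAInfinity (StarAlgebra.operations N F) := by
  have : NeZero N := ⟨by omega⟩
  have : Fact (2 ≤ N) := ⟨by omega⟩
  exact StarAlgebra.isWeightedAInfinity_operations
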